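/- **Notation.** Let $0<|q|<1$. The rank of a partition is its largest part minus its number of parts (the empty partition of $0$ has rank $0$); $p(n)$ is the number of partitions of $n$, and $N(a,M;n)$ is the number of those whose rank is $\equiv a\pmod M$. Put $$D(a,M,q)=\sum_{n\ge 0}\Big(N(a,M;n)-\frac{p(n)}{M}\Big)q^n .$$ Let $(x;q)_n=\prod_{i=0}^{n-1}(1-q^ix)$, $(x;q)_\infty=\prod_{i\ge0}(1-q^ix)$, $j(x;q)=(x;q)_\infty(q/x;q)_\infty(q;q)_\infty$, $$g(x,q)=x^{-1}\Big(-1+\sum_{n\ge0}\frac{q^{n^2}}{(x;q)_{n+1}(q/x;q)_n}\Big),\qquad m(x,q,z)=\frac1{j(z;q)}\sum_{r\in\mathbb Z}\frac{(-1)^rq^{\binom r2}z^r}{1-q^{r-1}xz},$$ the latter for $z\ne0$ such that neither $z$ nor $xz$ is an integral power of $q$. A *theta function* in $q$ and $z$ is a finite sum of *theta quotients* $$c\,q^{r}z^{k}\,\frac{\prod_i j(\omega_iq^{a_i}z^{b_i};q^{m_i})}{\prod_l j(\omega'_lq^{a'_l}z^{b'_l};q^{m'_l})},$$ where the products are finite,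 $c\in\mathbb C$, the $\omega_i,\omega'_l$ are roots of unity, $r,k,a_i,b_i,a'_l,b'_l$ are integers and $m_i,m'_l$ are positive integers. It is a theta function in $q$ alone if all $k,b_i,b'_l$ are $0$. It is *homogeneous of weight $\frac12$ and multiplier exponent $-\frac1{24}$* if each of its theta quotients has exactly one more factor $j$ in the numerator than in the denominator and satisfies, for all $s\in\mathbb Q$, $$\sum_i\frac{(m_i-2a_i-2b_is)^2}{8m_i}-\sum_l\frac{(m'_l-2a'_l-2b'_ls)^2}{8m'_l}-r-ks=-\frac1{24}.$$ **Theorem 3.1.** Let $0\le a<M$ be integers. There is a theta function $T_{a,M}$ in $q$ and $z$, homogeneous of weight $\frac12$ and multiplier exponent $-\frac1{24}$, which is a theta function in $q$ alone if $3\nmid M$, such that for every $q$ with $0<|q|<1$ the series $D(a,M,q)$ converges absolutely and $$D(a,M,q)=d(a,M,q)+T_{a,M}(q).$$ If $3\nmid M$, no $z$ occurs. If $3\mid M$, both $d(a,M,q)$ and $T_{a,M}(q)$ involve $z$; the identity holds for every $z\in\mathbb C$ for which the Appell–Lerch sums $m$ in $d(a,M,q)$ are defined, and $T_{a,M}(q)$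 really depends on $z$: for every $q$, it takes different values at some two such $z$. No factor $j$ in a denominator of $T_{a,M}$ vanishes at any such $q$ (and $z$). Here $d(a,M,q)$ is as follows, with $\epsilon=(-1)^{M+1}$. For $(a,M)\equiv(2,0),(1,1),(2,2)\pmod 3$ put $d(a,M,q)=d(M-a,M,q)$, which is one of the cases below. For $M\equiv0\pmod3$: 1. $a=0$: $\;2\,m(\epsilon q^{M(M-1)/6},q^{M^2/3},z)$. 2. $a\equiv0\pmod 3$, $a\ne0$: $\;(-1)^aq^{-a(a+1)/6}\,m(\epsilon q^{M(M-2a-1)/6},q^{M^2/3},z)+(-1)^{a+1}q^{-a(a-1)/6}\,m(\epsilon q^{M(M-2a+1)/6},q^{M^2/3},z)$. 3. $a\equiv1\pmod 3$: $\;(-1)^aq^{-a(a-1)/6}\,m(\epsilon q^{M(M-2a+1)/6},q^{M^2/3},z)$. For $M\equiv1\pmod3$: 4. $a=0$, $M=1$: $\;0$. 5. $a=0$, $M\ne1$: $\;2+2\epsilon q^{M(M-1)/6}g(\epsilon q^{M(M-1)/6},q^{M^2})$. 6. $a\equiv0\pmod 3$, $a\ne0$, $M\ne2a+1$: $\;(-1)^aq^{-a(a+1)/6}+(-1)^{M+a+1}q^{(M(M-2a-1)-a(a+1))/6}g(\epsilon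 q^{M(M-2a-1)/6},q^{M^2})+(-1)^{M+a+1}q^{(M(M+2a-1)-a(a-1))/6}g(\epsilon q^{M(M+2a-1)/6},q^{M^2})$. 7. $a\equiv0\pmod 3$, $a\ne0$, $M=2a+1$: $\;(-1)^aq^{a(7a+5)/6}g(q^{2aM/3},q^{M^2})$. 8. $a\equiv2\pmod 3$: $\;(-1)^{M+a+1}q^{(M(M+2a+1)-a(a+1))/6}g(\epsilon q^{M(M+2a+1)/6},q^{M^2})+(-1)^{a+1}q^{(2M^2-a(a-1))/6}g(\epsilon q^{M(3M+2a-1)/6},q^{M^2})$. For $M\equiv2\pmod3$: 9. $a=0$: $\;2(-1)^Mq^{M(M+1)/6}g(\epsilon q^{M(M+1)/6},q^{M^2})$. 10. $a\equiv0\pmod 3$, $a\ne0$, $M\ne2a-1$: $\;(-1)^{a+1}q^{-a(a-1)/6}+(-1)^{M+a}q^{(M(M-2a+1)-a(a-1))/6}g(\epsilon q^{M(M-2a+1)/6},q^{M^2})+(-1)^{M+a}q^{(M(M+2a+1)-a(a+1))/6}g(\epsilon q^{M(M+2a+1)/6},q^{M^2})$. 11. $a\equiv0\pmod 3$, $M=2a-1$: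 $\;(-1)^{a+1}q^{a(7a-5)/6}g(q^{2aM/3},q^{M^2})$. 12. $a\equiv1\pmod 3$: $\;(-1)^{M+a}q^{(M(M+2a-1)-a(a-1))/6}g(\epsilon q^{M(M+2a-1)/6},q^{M^2})+(-1)^aq^{(2M^2-a(a+1))/6}g(\epsilon q^{M(3M-2a-1)/6},q^{M^2})$. -/

import Mathlib

namespace DysonRank

/-! ## Partitions and ranks -/

/-- Dyson's rank of a partition: the largest part minus the number of parts
(so the empty partition of `0` has rank `0`). -/
def rank {n : ℕ} (π : n.Partition) : ℤ :=
  (π.parts.sup : ℤ) - (Multiset.card π.parts : ℤ)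

/-- `N(a, M; n)`: the number of partitions of `n` whose rank is congruent to `a` modulo `M`. -/
def rankCount (a M n : ℕ) : ℕ :=
  (Finset.univ.filter fun π : n.Partition => rank π ≡ (a : ℤ) [ZMOD (M : ℤ)]).card

/-- `p(n)`: the number of partitions of `n`. -/
def partitionCount (n : ℕ) : ℕ := Fintype.card n.Partition

noncomputable section

/-- The `n`-th term of the rank deviation `D(a, M, q)`. -/
def deviationTerm (a M : ℕ) (q : ℂ) (n : ℕ) : ℂ :=
  ((rankCount a M n : ℂ) - (partitionCount n : ℂ) / (M : ℂ)) * q ^ n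

/-- The rank deviation `D(a, M, q) = ∑ (N(a, M; n) - p(n) / M) q ^ n`. -/
def deviation (a M : ℕ) (q : ℂ) : ℂ := ∑' n : ℕ, deviationTerm a M q n

/-! ## `q`-series -/

/-- The finite `q`-Pochhammer symbol `(x; q)_n`. -/
def qPoch (x q : ℂ) (n : ℕ) : ℂ := ∏ i ∈ Finset.range n, (1 - q ^ i * x)

/-- The infinite `q`-Pochhammer symbol `(x; q)_∞`. -/
def qPochInf (x q : ℂ) : ℂ := ∏' i : ℕ, (1 - q ^ i * x)

/-- The theta function `j(x; q) = (x; q)_∞ (q / x; q)_∞ (q; q)_∞`. -/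
def thetaJ (x q : ℂ) : ℂ := qPochInf x q * qPochInf (q / x) q * qPochInf q q

/-- The universal mock theta function `g(x, q)`. -/
def mockG (x q : ℂ) : ℂ :=
  x⁻¹ * (-1 + ∑' n : ℕ, q ^ (n ^ 2) / (qPoch x q (n + 1) * qPoch (q / x) q n))

/-- The Appell–Lerch sum `m(x, q, z)`. -/
def appellM (x q z : ℂ) : ℂ :=
  (thetaJ z q)⁻¹ *
    ∑' r : ℤ, (-1 : ℂ) ^ r * q ^ (r * (r - 1) / 2) * z ^ r / (1 - q ^ (r - 1) * x * z)

/-- The condition on `z` in the definition of `m(x, q, z)`: `z` is nonzero and neither `z` nor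
`x z` is an integral power of `q`. -/
def AppellAdmissible (x q z : ℂ) : Prop :=
  z ≠ 0 ∧ ∀ k : ℤ, z ≠ q ^ k ∧ x * z ≠ q ^ k

/-! ## The mock part

The twelve cases, for integers `a` and `M`.  All divisions of exponents below are exact in the
cases in which they are used. -/

/-- The argument `(-1) ^ (M + 1) q ^ e` of the functions `m` and `g`. -/
def arg (M : ℤ) (q : ℂ) (e : ℤ) : ℂ := (-1 : ℂ) ^ (M + 1) * q ^ e

/-- The three cases with `M ≡ 0 (mod 3)`. -/
def mock0 (a M : ℤ) (q z : ℂ) : ℂ :=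
  if a = 0 then
    2 * appellM (arg M q (M * (M - 1) / 6)) (q ^ (M ^ 2 / 3)) z
  else if a % 3 = 0 then
    (-1 : ℂ) ^ a * q ^ (-(a * (a + 1) / 6)) *
        appellM (arg M q (M * (M - 2 * a - 1) / 6)) (q ^ (M ^ 2 / 3)) z
      + (-1 : ℂ) ^ (a + 1) * q ^ (-(a * (a - 1) / 6)) *
        appellM (arg M q (M * (M - 2 * a + 1) / 6)) (q ^ (M ^ 2 / 3)) z
  else
    -- here `a ≡ 1 (mod 3)`
    (-1 : ℂ) ^ a * q ^ (-(a * (a - 1) / 6)) *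
      appellM (arg M q (M * (M - 2 * a + 1) / 6)) (q ^ (M ^ 2 / 3)) z

/-- The condition on `z` for `M ≡ 0 (mod 3)`: the Appell–Lerch sums that occur in `mock0` are
defined. -/
def admissible0 (a M : ℤ) (q z : ℂ) : Prop :=
  if a = 0 then
    AppellAdmissible (arg M q (M * (M - 1) / 6)) (q ^ (M ^ 2 / 3)) z
  else if a % 3 = 0 then
    AppellAdmissible (arg M q (M * (M - 2 * a - 1) / 6)) (q ^ (M ^ 2 / 3)) z ∧
      AppellAdmissible (arg M q (M * (M - 2 * a + 1) / 6)) (q ^ (M ^ 2 / 3)) z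
  else
    AppellAdmissible (arg M q (M * (M - 2 * a + 1) / 6)) (q ^ (M ^ 2 / 3)) z

/-- The five cases with `M ≡ 1 (mod 3)`. -/
def mock1 (a M : ℤ) (q : ℂ) : ℂ :=
  if a = 0 ∧ M = 1 then 0
  else if a = 0 then
    2 + 2 * (-1 : ℂ) ^ (M + 1) * q ^ (M * (M - 1) / 6) *
      mockG (arg M q (M * (M - 1) / 6)) (q ^ (M ^ 2))
  else if a % 3 = 0 ∧ M ≠ 2 * a + 1 then
    (-1 : ℂ) ^ a * q ^ (-(a * (a + 1) / 6))
      + (-1 : ℂ) ^ (M + a + 1) * q ^ ((M * (M - 2 * a - 1) - a * (a + 1)) / 6) *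
        mockG (arg M q (M * (M - 2 * a - 1) / 6)) (q ^ (M ^ 2))
      + (-1 : ℂ) ^ (M + a + 1) * q ^ ((M * (M + 2 * a - 1) - a * (a - 1)) / 6) *
        mockG (arg M q (M * (M + 2 * a - 1) / 6)) (q ^ (M ^ 2))
  else if a % 3 = 0 then
    -- here `M = 2 a + 1`
    (-1 : ℂ) ^ a * q ^ (a * (7 * a + 5) / 6) * mockG (q ^ (2 * a * M / 3)) (q ^ (M ^ 2))
  else
    -- here `a ≡ 2 (mod 3)`
    (-1 : ℂ) ^ (M + a + 1) * q ^ ((M * (M + 2 * a + 1) - a * (a + 1)) / 6) *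
        mockG (arg M q (M * (M + 2 * a + 1) / 6)) (q ^ (M ^ 2))
      + (-1 : ℂ) ^ (a + 1) * q ^ ((2 * M ^ 2 - a * (a - 1)) / 6) *
        mockG (arg M q (M * (3 * M + 2 * a - 1) / 6)) (q ^ (M ^ 2))

/-- The four cases with `M ≡ 2 (mod 3)`. -/
def mock2 (a M : ℤ) (q : ℂ) : ℂ :=
  if a = 0 then
    2 * (-1 : ℂ) ^ M * q ^ (M * (M + 1) / 6) *
      mockG (arg M q (M * (M + 1) / 6)) (q ^ (M ^ 2))
  else if a % 3 = 0 ∧ M ≠ 2 * a - 1 then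
    (-1 : ℂ) ^ (a + 1) * q ^ (-(a * (a - 1) / 6))
      + (-1 : ℂ) ^ (M + a) * q ^ ((M * (M - 2 * a + 1) - a * (a - 1)) / 6) *
        mockG (arg M q (M * (M - 2 * a + 1) / 6)) (q ^ (M ^ 2))
      + (-1 : ℂ) ^ (M + a) * q ^ ((M * (M + 2 * a + 1) - a * (a + 1)) / 6) *
        mockG (arg M q (M * (M + 2 * a + 1) / 6)) (q ^ (M ^ 2))
  else if a % 3 = 0 then
    -- here `M = 2 a - 1`
    (-1 : ℂ) ^ (a + 1) * q ^ (a * (7 * a - 5) / 6) * mockG (q ^ (2 * a * M / 3)) (q ^ (M ^ 2))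
  else
    -- here `a ≡ 1 (mod 3)`
    (-1 : ℂ) ^ (M + a) * q ^ ((M * (M + 2 * a - 1) - a * (a - 1)) / 6) *
        mockG (arg M q (M * (M + 2 * a - 1) / 6)) (q ^ (M ^ 2))
      + (-1 : ℂ) ^ a * q ^ ((2 * M ^ 2 - a * (a + 1)) / 6) *
        mockG (arg M q (M * (3 * M - 2 * a - 1) / 6)) (q ^ (M ^ 2))

/-- The twelve cases leave out the residues determined by `D(a, M) = D(M - a, M)`, namely
`(a, M) ≡ (2, 0), (1, 1), (2, 2)` modulo `3`; such an `a` is replaced by `M - a`. -/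
def representative (a M : ℕ) : ℕ :=
  if (M % 3 = 0 ∧ a % 3 = 2) ∨ (M % 3 = 1 ∧ a % 3 = 1) ∨ (M % 3 = 2 ∧ a % 3 = 2) then M - a
  else a

/-- The mock part `d(a, M, q)`, which for `3 ∣ M` also involves `z`. -/
def mockPart (a M : ℕ) (q z : ℂ) : ℂ :=
  if M % 3 = 0 then mock0 (representative a M) M q z
  else if M % 3 = 1 then mock1 (representative a M) M q
  else mock2 (representative a M) M q

/-- The condition on the auxiliary `z` (none unless `3 ∣ M`): the Appell–Lerch sums that occur in
`mockPart a M q z` are defined. -/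
def Admissible (a M : ℕ) (q z : ℂ) : Prop :=
  M % 3 = 0 → admissible0 (representative a M) M q z

/-! ## Theta functions in `q` and `z` -/

/-- A symbol for the theta function `j(ω q ^ a z ^ b; q ^ m)`, with `ω` a root of unity, `a` and
`b` integers and `m` a positive integer.  For instance `J_{a,m}`, `J̄_{a,m}` and `J_m` are of this
form, with `(ω, a, b, m)` equal to `(1, a, 0, m)`, `(-1, a, 0, m)` and `(1, m, 0, 3 m)`. -/
structure ThetaFactor where
  /-- the root of unity `ω` -/
  root : ℂ
  root_torsion : IsOfFinOrder root
  /-- the exponent `a` of `q` -/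
  qExp : ℤ
  /-- the exponent `b` of `z` -/
  zExp : ℤ
  /-- the exponent `m` of the base -/
  level : ℕ
  level_pos : 0 < level

/-- The value `j(ω q ^ a z ^ b; q ^ m)`. -/
def ThetaFactor.eval (f : ThetaFactor) (q z : ℂ) : ℂ :=
  thetaJ (f.root * q ^ f.qExp * z ^ f.zExp) (q ^ f.level)

/-- The multiplier exponent `(m - 2 (a + b s)) ^ 2 / (8 m)` of `j(ω q ^ (a + b s); q ^ m)`, that
is of the theta function in question when `z` is `q ^ s` up to a root of unity. -/
def ThetaFactor.multiplier (f : ThetaFactor) (s : ℚ) : ℚ :=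
  ((f.level : ℚ) - 2 * ((f.qExp : ℚ) + (f.zExp : ℚ) * s)) ^ 2 / (8 * (f.level : ℚ))

/-- A theta quotient `c q ^ r z ^ k` times a product of theta functions divided by a product of
theta functions, with `c` a complex constant. -/
structure ThetaQuotient where
  coeff : ℂ
  qExp : ℤ
  zExp : ℤ
  num : List ThetaFactor
  den : List ThetaFactor

/-- The value of a theta quotient. -/
def ThetaQuotient.eval (t : ThetaQuotient) (q z : ℂ) : ℂ :=
  t.coeff * q ^ t.qExp * z ^ t.zExp * (t.num.map fun f => f.eval q z).prod /
    (t.den.map fun f => f.eval q z).prod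

/-- No theta function in the denominator vanishes at `(q, z)`. -/
def ThetaQuotient.Defined (t : ThetaQuotient) (q z : ℂ) : Prop :=
  ∀ f ∈ t.den, f.eval q z ≠ 0

/-- The multiplier exponent of a theta quotient, when `z` is `q ^ s` up to a root of unity. -/
def ThetaQuotient.multiplier (t : ThetaQuotient) (s : ℚ) : ℚ :=
  (t.num.map fun f => f.multiplier s).sum - (t.den.map fun f => f.multiplier s).sum
    - ((t.qExp : ℚ) + (t.zExp : ℚ) * s)

/-- The quotient has weight `1 / 2`: one more theta function in the numerator than in the
denominator. -/
def ThetaQuotient.WeightHalf (t : ThetaQuotient) : Prop :=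
  t.num.length = t.den.length + 1

/-- The variable `z` does not occur. -/
def ThetaQuotient.ZFree (t : ThetaQuotient) : Prop :=
  t.zExp = 0 ∧ (∀ f ∈ t.num, f.zExp = 0) ∧ ∀ f ∈ t.den, f.zExp = 0

/-- A theta function in `q` and `z`: a finite sum of theta quotients. -/
abbrev ThetaFunction := List ThetaQuotient

/-- The value of a theta function. -/
def ThetaFunction.eval (T : ThetaFunction) (q z : ℂ) : ℂ :=
  (T.map fun t => t.eval q z).sum

/-- No denominator vanishes at `(q, z)`. -/
def ThetaFunction.Defined (T : ThetaFunction) (q z : ℂ) : Prop :=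
  ∀ t ∈ T, t.Defined q z

/-- Every summand has weight `1 / 2` and multiplier exponent `-1 / 24`, identically in `s`. -/
def ThetaFunction.Homogeneous (T : ThetaFunction) : Prop :=
  ∀ t ∈ T, t.WeightHalf ∧ ∀ s : ℚ, t.multiplier s = -1 / 24

/-- The variable `z` does not occur. -/
def ThetaFunction.ZFree (T : ThetaFunction) : Prop :=
  ∀ t ∈ T, t.ZFree

end

end DysonRank

/-!
With `x = ζ ^ j` running over the nontrivial `M`-th roots of unity, orthogonality writes the deviation
as a combination of values of the rank generating function at roots of unity
(`hasSum_deviationTerm`), which is `(1 - x)` times the universal mock theta function `mockH x q`,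
that is `1 + x g(x, q)`.  The rank generating function is first obtained as a sum over largest parts;
the Rogers–Fine identity `hasSum_fine` turns it into the sum over Durfee squares.

The function `mockH` is a combination of two Appell–Lerch sums `m(q x ^ 3, q ^ 3, w)` and
`m(q⁻¹ x ^ 3, q ^ 3, w)` with an auxiliary root of unity `w`, minus one theta quotient (`mockH_eq`).
The ingredients are Watson's bilateral series for `mockH` (`hasSum_watson`), the change of the
auxiliary variable in an Appell–Lerch sum (`appellA_cross`) and a theta identity of degree three
(`thetaJ_cubic`).  The latter two are instances of one principle: holomorphic functions of `w ≠ 0`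
with the same quasi-period under `w ↦ q w` are proportional (`mul_eq_mul_of_quasiPeriodic`).

Averaging over the roots of unity isolates residue classes in the powers of `x`.  By
`appellM_dissection` a residue class of `m(x, q ^ 3, w)` is, up to theta quotients, again an
Appell–Lerch sum, with base `q ^ (3 N ^ 2)`, where `N = M` or `N = M / 3`.  So the deviation is,
modulo theta functions, a signed sum of at most four functions `part N w b`
(`isTheta_deviation_sub_parts` and its analogues for `3 ∣ M`).

If `3 ∤ M`, the identity `mockH_eq` for the base `q ^ (M ^ 2)` recognizes the difference
`part b - part (b + 2 M)` as a value of `mockH`; the parts `b` and `b + 3 M` differ by a monomial, and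
inversion of `x` gives the remaining forms of `g`.  The exceptional cases `M = 2 a ± 1` are those in
which `mockH` would be evaluated at its pole `x = 1`; there the two parts agree modulo theta functions
because inverting both variables of an Appell–Lerch sum only multiplies it by `x`
(`isTheta_part_symm`).  If `3 ∣ M`, at most two parts remain, and it suffices to change the auxiliary
variable from `w` to `z`; the theta quotient for this change is what depends on `z`.

That the theta quotients have the asserted multiplier exponent is a computation with quadratic forms;
the classes of functions of a given multiplier exponent are handled through `IsTheta`.
-/

open Filter Topology

namespace DysonRank

/-! ### Infinite `q`-products -/

section qProducts

variable {q x : ℂ}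

lemma summable_pow_mul (hq : ‖q‖ < 1) (x : ℂ) : Summable fun i : ℕ => ‖-(q ^ i * x)‖ := by
  simp only [norm_neg, norm_mul, norm_pow]
  exact (summable_geometric_of_lt_one (norm_nonneg _) hq).mul_right _

lemma multipliable_qPoch (hq : ‖q‖ < 1) (x : ℂ) :
    Multipliable fun i : ℕ => 1 - q ^ i * x := by
  simpa [sub_eq_add_neg] using multipliable_one_add_of_summable (summable_pow_mul hq x)

lemma qPochInf_ne_zero (hq : ‖q‖ < 1) (h : ∀ i : ℕ, q ^ i * x ≠ 1) : qPochInf x q ≠ 0 := by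
  have := tprod_one_add_ne_zero_of_summable (f := fun i : ℕ => -(q ^ i * x))
    (fun i => by
      have := h i
      intro h'
      apply this
      linear_combination -h') (summable_pow_mul hq x)
  simpa [qPochInf, sub_eq_add_neg] using this

lemma tendsto_qPoch (hq : ‖q‖ < 1) (x : ℂ) :
    Tendsto (fun n => qPoch x q n) atTop (𝓝 (qPochInf x q)) :=
  (multipliable_qPoch hq x).tendsto_prod_tprod_nat

lemma qPochInf_eq_mul (hq : ‖q‖ < 1) (x : ℂ) :
    qPochInf x q = (1 - x) * qPochInf (q * x) q := by
  have e : ∀ i : ℕ, 1 - q ^ (i + 1) * x = 1 - q ^ i * (q * x) := fun i => by ring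
  have h := tprod_eq_zero_mul' (f := fun i : ℕ => 1 - q ^ i * x)
    (by simpa only [e] using multipliable_qPoch hq (q * x))
  simp only [e, pow_zero, one_mul] at h
  exact h

lemma qPochInf_one (hq : ‖q‖ < 1) : qPochInf 1 q = 0 := by
  rw [qPochInf_eq_mul hq]; simp

lemma qPochInf_self_ne_zero (hq : ‖q‖ < 1) : qPochInf q q ≠ 0 := by
  apply qPochInf_ne_zero hq
  intro i h
  have h1 : ‖q‖ ^ (i + 1) = 1 := by rw [← norm_pow, pow_succ, h, norm_one]
  exact absurd h1 (pow_lt_one₀ (norm_nonneg _) hq (Nat.succ_ne_zero i)).ne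

/-- `x` is not an integral power of `q`. -/
def NotPower (x q : ℂ) : Prop := ∀ k : ℤ, x ≠ q ^ k

lemma NotPower.zpow_mul_ne (h : NotPower x q) (k : ℤ) : q ^ k * x ≠ 1 := by
  intro h1
  apply h (-k)
  rw [zpow_neg]
  exact eq_inv_of_mul_eq_one_right h1

lemma notPower_zpow_mul_iff (hq0 : q ≠ 0) (k : ℤ) : NotPower (q ^ k * x) q ↔ NotPower x q := by
  constructor
  · intro h l hl
    apply h (k + l)
    rw [hl, zpow_add₀ hq0]
  · intro h l hl
    apply h (l - k)
    rw [zpow_sub₀ hq0, ← hl]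
    field_simp

lemma notPower_inv_iff : NotPower x⁻¹ q ↔ NotPower x q := by
  constructor
  · intro h l hl
    apply h (-l)
    rw [hl, zpow_neg]
  · intro h l hl
    apply h (-l)
    rw [zpow_neg, ← hl, inv_inv]

/-! ### The theta function -/

lemma thetaJ_mul_left (hq0 : q ≠ 0) (hq : ‖q‖ < 1) (hx : x ≠ 0) :
    thetaJ (q * x) q = -x⁻¹ * thetaJ x q := by
  have h2 : q / (q * x) = x⁻¹ := by field_simp
  have h3 : q * x⁻¹ = q / x := by field_simp
  rw [thetaJ, thetaJ, qPochInf_eq_mul hq x, h2, qPochInf_eq_mul hq x⁻¹, h3]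
  field_simp
  ring

lemma thetaJ_inv (hq : ‖q‖ < 1) (hx : x ≠ 0) :
    thetaJ x⁻¹ q = -x⁻¹ * thetaJ x q := by
  have h3 : q * x⁻¹ = q / x := by field_simp
  have h4 : q / x⁻¹ = q * x := by field_simp
  rw [thetaJ, thetaJ, qPochInf_eq_mul hq x, qPochInf_eq_mul hq x⁻¹, h3, h4]
  field_simp
  ring

lemma thetaJ_div_eq (hq0 : q ≠ 0) : thetaJ (q / x) q = thetaJ x q := by
  rw [thetaJ, thetaJ, div_div_cancel₀ hq0]; ring

lemma thetaJ_one (hq : ‖q‖ < 1) : thetaJ 1 q = 0 := by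
  simp [thetaJ, qPochInf_one hq]

lemma thetaJ_ne_zero (hq : ‖q‖ < 1) (hx : NotPower x q) : thetaJ x q ≠ 0 := by
  refine mul_ne_zero (mul_ne_zero ?_ ?_) (qPochInf_self_ne_zero hq)
  · apply qPochInf_ne_zero hq
    intro i
    simpa using hx.zpow_mul_ne i
  · apply qPochInf_ne_zero hq
    intro i
    have := (notPower_inv_iff.2 hx).zpow_mul_ne (i + 1 : ℕ)
    rwa [zpow_natCast, pow_succ, mul_assoc] at this

/-- Splitting the factors of `(q; q)_∞` by the residue of the exponent modulo `3`. -/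
lemma thetaJ_self_cube (hq : ‖q‖ < 1) : thetaJ q (q ^ 3) = qPochInf q q := by
  have hq3 : ‖q ^ 3‖ < 1 := by rw [norm_pow]; exact pow_lt_one₀ (norm_nonneg _) hq (by norm_num)
  by_cases hq0 : q = 0
  · subst hq0; simp [thetaJ, qPochInf]
  have h2 : q ^ 3 / q = q ^ 2 := by field_simp
  rw [thetaJ, h2]
  have l1 := (((tendsto_qPoch hq3 q).mul (tendsto_qPoch hq3 (q ^ 2))).mul
    (tendsto_qPoch hq3 (q ^ 3)))
  have l2 : Tendsto (fun n => qPoch q q (3 * n)) atTop (𝓝 (qPochInf q q)) :=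
    (tendsto_qPoch hq q).comp (tendsto_id.const_mul_atTop' (by norm_num))
  refine tendsto_nhds_unique l1 (l2.congr fun n => ?_)
  induction n with
  | zero => simp [qPoch]
  | succ n ih =>
    simp only [qPoch] at ih ⊢
    rw [show 3 * (n + 1) = 3 * n + 1 + 1 + 1 by ring]
    simp only [Finset.prod_range_succ, ih]
    rw [← pow_mul]
    ring

end qProducts

/-! ### Summability of theta-like series over the integers -/

section summability

variable {q : ℂ}

/-- The exponent `r (r - 1) / 2` is a genuine quotient. -/
lemma two_mul_choose (r : ℤ) : 2 * (r * (r - 1) / 2) = r * (r - 1) := by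
  have h : (2 : ℤ) ∣ r * (r - 1) := by
    rcases Int.even_or_odd' r with ⟨k, rfl | rfl⟩
    · exact ⟨k * (2 * k - 1), by ring⟩
    · exact ⟨(2 * k + 1) * k, by ring⟩
  omega

lemma choose_succ (r : ℤ) : (r + 1) * (r + 1 - 1) / 2 = r * (r - 1) / 2 + r := by
  have h1 := two_mul_choose r
  have h2 := two_mul_choose (r + 1)
  nlinarith

lemma choose_add (r s : ℤ) :
    (r + s) * (r + s - 1) / 2 = r * (r - 1) / 2 + s * (s - 1) / 2 + r * s := by
  have h1 := two_mul_choose r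
  have h2 := two_mul_choose (r + s)
  have h3 := two_mul_choose s
  nlinarith

lemma choose_neg (r : ℤ) : (-r) * (-r - 1) / 2 = r * (r - 1) / 2 + r := by
  have h1 := two_mul_choose r
  have h2 := two_mul_choose (-r)
  nlinarith

lemma summable_nat_theta {p z : ℝ} (hp0 : 0 < p) (hp : p < 1) (hz : 0 < z) :
    Summable fun n : ℕ => p ^ ((n : ℤ) * (n - 1) / 2) * z ^ (n : ℤ) := by
  refine summable_of_ratio_test_tendsto_lt_one (l := 0) zero_lt_one
    (Eventually.of_forall fun n => (mul_pos (zpow_pos hp0 _) (zpow_pos hz _)).ne') ?_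
  have h : ∀ n : ℕ, ‖p ^ (((n + 1 : ℕ) : ℤ) * (((n + 1 : ℕ) : ℤ) - 1) / 2) * z ^ ((n + 1 : ℕ) : ℤ)‖ /
      ‖p ^ ((n : ℤ) * (n - 1) / 2) * z ^ (n : ℤ)‖ = p ^ n * z := by
    intro n
    have h1 : 0 < p ^ ((n : ℤ) * (n - 1) / 2) := zpow_pos hp0 _
    have h2 : 0 < z ^ (n : ℤ) := zpow_pos hz _
    rw [Nat.cast_succ, choose_succ, zpow_add₀ hp0.ne', zpow_add₀ hz.ne', zpow_one, norm_mul, norm_mul,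
      norm_mul, norm_mul, Real.norm_of_nonneg h1.le, Real.norm_of_nonneg h2.le,
      Real.norm_of_nonneg hz.le, zpow_natCast p, Real.norm_of_nonneg (pow_pos hp0 n).le]
    field_simp
  simp only [h]
  simpa using (tendsto_pow_atTop_nhds_zero_of_lt_one hp0.le hp).mul_const z

lemma summable_real_theta {p z : ℝ} (hp0 : 0 < p) (hp : p < 1) (hz : 0 < z) :
    Summable fun r : ℤ => p ^ (r * (r - 1) / 2) * z ^ r := by
  refine Summable.of_nat_of_neg (summable_nat_theta hp0 hp hz) ?_
  have := summable_nat_theta hp0 hp (mul_pos hp0 (inv_pos.2 hz))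
  refine this.congr fun n => ?_
  rw [choose_neg, zpow_add₀ hp0.ne', mul_zpow, inv_zpow, zpow_neg, mul_assoc]

lemma norm_theta_term (q z : ℂ) (r : ℤ) :
    ‖(-1 : ℂ) ^ r * q ^ (r * (r - 1) / 2) * z ^ r‖ = ‖q‖ ^ (r * (r - 1) / 2) * ‖z‖ ^ r := by
  simp [norm_zpow]

lemma summable_norm_theta (hq0 : q ≠ 0) (hq : ‖q‖ < 1) {z : ℂ} (hz : z ≠ 0) :
    Summable fun r : ℤ => ‖(-1 : ℂ) ^ r * q ^ (r * (r - 1) / 2) * z ^ r‖ := by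
  simp only [norm_theta_term]
  exact summable_real_theta (norm_pos_iff.2 hq0) hq (norm_pos_iff.2 hz)

lemma exists_norm_inv_le_nat (hq : ‖q‖ < 1) {u₀ : ℂ} (h : ∀ n : ℕ, q ^ n * u₀ ≠ 1) :
    ∃ C, 0 < C ∧ ∀ᶠ u in 𝓝 u₀, ∀ n : ℕ, ‖(1 - q ^ n * u)⁻¹‖ ≤ C := by
  have h1 : Tendsto (fun n : ℕ => ‖(1 - q ^ n * u₀)⁻¹‖) atTop (𝓝 1) := by
    have := (((tendsto_pow_atTop_nhds_zero_of_norm_lt_one hq).mul_const u₀).const_sub 1).inv₀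
      (by simp)
    simpa using this.norm
  obtain ⟨C, hC⟩ := h1.bddAbove_range
  have hC' : ∀ n : ℕ, ‖(1 - q ^ n * u₀)⁻¹‖ ≤ C := fun n => hC ⟨n, rfl⟩
  have hn : ∀ n : ℕ, 0 < ‖1 - q ^ n * u₀‖ := fun n =>
    norm_pos_iff.2 (sub_ne_zero.2 (h n).symm)
  have hC0 : 0 < C := lt_of_lt_of_le (by rw [norm_inv]; exact inv_pos.2 (hn 0)) (hC' 0)
  refine ⟨2 * C, by positivity, ?_⟩
  filter_upwards [Metric.ball_mem_nhds u₀ (show (0 : ℝ) < (2 * C)⁻¹ by positivity)] with u hu n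
  have e1 : C⁻¹ ≤ ‖1 - q ^ n * u₀‖ := by
    have := hC' n
    rw [norm_inv] at this
    exact inv_le_of_inv_le₀ (hn n) this
  have e2 : ‖q ^ n * (u - u₀)‖ ≤ (2 * C)⁻¹ := by
    rw [norm_mul, norm_pow]
    have h1 : ‖q‖ ^ n ≤ 1 := pow_le_one₀ (norm_nonneg _) hq.le
    have h2 : ‖u - u₀‖ < (2 * C)⁻¹ := by simpa [dist_eq_norm] using hu
    nlinarith [norm_nonneg (u - u₀), pow_nonneg (norm_nonneg q) n]
  have e3 : ‖1 - q ^ n * u₀‖ ≤ ‖1 - q ^ n * u‖ + ‖q ^ n * (u - u₀)‖ := by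
    have : 1 - q ^ n * u₀ = (1 - q ^ n * u) + q ^ n * (u - u₀) := by ring
    rw [this]; exact norm_add_le _ _
  have e4 : C⁻¹ = 2 * (2 * C)⁻¹ := by field_simp
  have e5 : (2 * C)⁻¹ ≤ ‖1 - q ^ n * u‖ := by linarith
  rw [norm_inv]
  exact inv_le_of_inv_le₀ (by positivity) e5

/-- The denominators `1 - q ^ r u` stay away from `0`, uniformly in `r : ℤ` and locally uniformly
in `u`. -/
lemma exists_norm_inv_le (hq0 : q ≠ 0) (hq : ‖q‖ < 1) {u₀ : ℂ} (hu0 : u₀ ≠ 0)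
    (h : NotPower u₀ q) :
    ∃ C, 0 < C ∧ ∀ᶠ u in 𝓝 u₀, ∀ r : ℤ, ‖(1 - q ^ r * u)⁻¹‖ ≤ C := by
  obtain ⟨C, hC0, hC⟩ := exists_norm_inv_le_nat hq (u₀ := u₀) fun n => by
    simpa using h.zpow_mul_ne n
  obtain ⟨D, hD0, hD⟩ := exists_norm_inv_le_nat hq (u₀ := u₀⁻¹) fun n => by
    simpa using (notPower_inv_iff.2 h).zpow_mul_ne n
  have hinv : Tendsto (fun u : ℂ => u⁻¹) (𝓝 u₀) (𝓝 u₀⁻¹) := (continuousAt_inv₀ hu0)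
  have hb : ∀ᶠ u in 𝓝 u₀, ‖u⁻¹‖ ≤ ‖u₀⁻¹‖ + 1 :=
    hinv.norm.eventually_le_const (by linarith)
  refine ⟨C + (‖u₀⁻¹‖ + 1) * D, by positivity, ?_⟩
  filter_upwards [hC, hinv.eventually hD, hb, eventually_ne_nhds hu0] with u h1 h2 h3 h4 r
  obtain ⟨n, rfl | rfl⟩ := r.eq_nat_or_neg
  · have := h1 n
    rw [zpow_natCast]
    have : 0 ≤ (‖u₀⁻¹‖ + 1) * D := by positivity
    linarith [h1 n]
  · have hqn : q ^ n ≠ 0 := pow_ne_zero _ hq0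
    have e : (1 - q ^ (-(n : ℤ)) * u)⁻¹ = -(q ^ n) * u⁻¹ * (1 - q ^ n * u⁻¹)⁻¹ := by
      rw [zpow_neg, zpow_natCast]
      have : 1 - (q ^ n)⁻¹ * u = -((q ^ n)⁻¹ * u) * (1 - q ^ n * u⁻¹) := by
        field_simp; ring
      rw [this, mul_inv]
      congr 1
      field_simp
    rw [e, norm_mul, norm_mul, norm_neg, norm_pow]
    have h5 : ‖q‖ ^ n ≤ 1 := pow_le_one₀ (norm_nonneg _) hq.le
    calc ‖q‖ ^ n * ‖u⁻¹‖ * ‖(1 - q ^ n * u⁻¹)⁻¹‖ ≤ 1 * (‖u₀⁻¹‖ + 1) * D := by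
          gcongr
          exact h2 n
      _ ≤ _ := by linarith

lemma exists_norm_inv_le_self (hq0 : q ≠ 0) (hq : ‖q‖ < 1) {u : ℂ} (hu0 : u ≠ 0)
    (h : NotPower u q) : ∃ C, 0 < C ∧ ∀ r : ℤ, ‖(1 - q ^ r * u)⁻¹‖ ≤ C := by
  obtain ⟨C, hC0, hC⟩ := exists_norm_inv_le hq0 hq hu0 h
  exact ⟨C, hC0, hC.self_of_nhds⟩

/-- A uniform bound for the reciprocals of finite `q`-products. -/
lemma exists_norm_qPoch_inv_le (hq : ‖q‖ < 1) {x : ℂ} (h : ∀ i : ℕ, q ^ i * x ≠ 1) :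
    ∃ C, 0 < C ∧ ∀ n, ‖(qPoch x q n)⁻¹‖ ≤ C := by
  obtain ⟨C, hC⟩ := ((tendsto_qPoch hq x).inv₀ (qPochInf_ne_zero hq h)).norm.bddAbove_range
  have hC' : ∀ n, ‖(qPoch x q n)⁻¹‖ ≤ C := fun n => hC ⟨n, rfl⟩
  exact ⟨|C| + 1, by positivity, fun n => (hC' n).trans (by linarith [le_abs_self C])⟩

end summability

/-! ### The triple product and the partial fractions of its reciprocal -/

section tripleProduct

variable {q : ℂ}

/-- `1 / (q; q)_k`, extended by `0` to negative `k`, so that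
`1 / (q; q)_{k - 1} = (1 - q ^ k) / (q; q)_k` for every integer `k`. -/
noncomputable def qFactInv (q : ℂ) (k : ℤ) : ℂ := if 0 ≤ k then (qPoch q q k.toNat)⁻¹ else 0

lemma qFactInv_natCast (n : ℕ) : qFactInv q n = (qPoch q q n)⁻¹ := by simp [qFactInv]

lemma qFactInv_of_neg {k : ℤ} (hk : k < 0) : qFactInv q k = 0 := by simp [qFactInv, hk]

lemma one_sub_pow_ne_zero (hq : ‖q‖ < 1) (n : ℕ) : 1 - q ^ n * q ≠ 0 := by
  intro h
  have h1 : ‖q‖ ^ (n + 1) = 1 := by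
    rw [← norm_pow, pow_succ, ← sub_eq_zero.1 h, norm_one]
  exact absurd h1 (pow_lt_one₀ (norm_nonneg _) hq (Nat.succ_ne_zero n)).ne

lemma qPoch_self_ne_zero (hq : ‖q‖ < 1) (n : ℕ) : qPoch q q n ≠ 0 :=
  Finset.prod_ne_zero_iff.2 fun i _ => one_sub_pow_ne_zero hq i

lemma qFactInv_pred (hq : ‖q‖ < 1) (k : ℤ) :
    qFactInv q (k - 1) = qFactInv q k * (1 - q ^ k) := by
  rcases lt_trichotomy k 0 with h | rfl | h
  · rw [qFactInv_of_neg h, qFactInv_of_neg (by omega), zero_mul]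
  · simp [qFactInv_of_neg]
  · obtain ⟨n, rfl⟩ : ∃ n : ℕ, k = (n + 1 : ℕ) := ⟨(k - 1).toNat, by omega⟩
    have h1 : ((n + 1 : ℕ) : ℤ) - 1 = n := by simp
    rw [h1, qFactInv_natCast, qFactInv_natCast, zpow_natCast]
    have h2 := qPoch_self_ne_zero hq n
    have h3 := one_sub_pow_ne_zero hq n
    have h4 : qPoch q q (n + 1) = qPoch q q n * (1 - q ^ n * q) := by
      simp [qPoch, Finset.prod_range_succ]
    rw [h4, pow_succ]
    field_simp

lemma exists_norm_qFactInv_le (hq : ‖q‖ < 1) : ∃ C, 0 < C ∧ ∀ k, ‖qFactInv q k‖ ≤ C := by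
  obtain ⟨C, hC0, hC⟩ := exists_norm_qPoch_inv_le hq (x := q)
    fun i h => one_sub_pow_ne_zero hq i (by rw [h, sub_self])
  refine ⟨C, hC0, fun k => ?_⟩
  unfold qFactInv
  split_ifs
  · exact hC _
  · simpa using hC0.le

lemma tendsto_qFactInv (hq : ‖q‖ < 1) : Tendsto (qFactInv q) atTop (𝓝 (qPochInf q q)⁻¹) := by
  have h1 := ((tendsto_qPoch hq q).inv₀ (qPochInf_self_ne_zero hq)).comp
    (tendsto_atTop_atTop.2 fun b => ⟨b, fun a ha => by omega⟩ :
      Tendsto Int.toNat atTop atTop)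
  refine h1.congr' ?_
  filter_upwards [eventually_ge_atTop 0] with k hk
  simp [qFactInv, hk]

/-- Tannery's theorem for the coefficients of the finite triple product. -/
lemma tendsto_tsum_qFactInv (hq : ‖q‖ < 1) {a : ℤ → ℂ} (ha : Summable fun r => ‖a r‖) :
    Tendsto (fun n : ℕ => ∑' r : ℤ, a r * (qFactInv q (n - r) * qFactInv q (n + r))) atTop
      (𝓝 (∑' r : ℤ, a r * ((qPochInf q q)⁻¹ * (qPochInf q q)⁻¹))) := by
  obtain ⟨C, hC0, hC⟩ := exists_norm_qFactInv_le hq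
  refine tendsto_tsum_of_dominated_convergence (bound := fun r => ‖a r‖ * (C * C))
    (ha.mul_right _) (fun r => ?_) (Eventually.of_forall fun n r => ?_)
  · refine Tendsto.const_mul _ (Tendsto.mul ?_ ?_)
    · exact (tendsto_qFactInv hq).comp (tendsto_atTop_add_const_right _ (-r)
        tendsto_natCast_atTop_atTop)
    · exact (tendsto_qFactInv hq).comp (tendsto_atTop_add_const_right _ r
        tendsto_natCast_atTop_atTop)
  · rw [norm_mul, norm_mul]
    gcongr
    · exact hC _
    · exact hC _

lemma qPoch_succ (x q : ℂ) (n : ℕ) : qPoch x q (n + 1) = qPoch x q n * (1 - q ^ n * x) := by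
  simp [qPoch, Finset.prod_range_succ]

lemma qPoch_succ' (x q : ℂ) (n : ℕ) : qPoch x q (n + 1) = (1 - x) * qPoch (x * q) q n := by
  rw [qPoch, Finset.prod_range_succ', qPoch]
  simp only [pow_succ, pow_zero, one_mul]
  rw [mul_comm]
  congr 1
  exact Finset.prod_congr rfl fun i _ => by ring

lemma hasSum_of_eq {ι : Type*} {f g : ι → ℂ} {a b : ℂ} (h : HasSum f a) (hfg : ∀ i, f i = g i)
    (hab : a = b) : HasSum g b := by
  rw [← hab, ← funext hfg]; exact h

/-- The finite form of the Jacobi triple product. -/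
lemma hasSum_finite_tripleProduct (hq0 : q ≠ 0) (hq : ‖q‖ < 1) {y : ℂ} (hy : y ≠ 0) (n : ℕ) :
    HasSum (fun r : ℤ => (-1 : ℂ) ^ r * q ^ (r * (r - 1) / 2) * y ^ r *
        (qFactInv q (n - r) * qFactInv q (n + r)))
      (qPoch y q n * qPoch (q / y) q n * (qPoch q q (2 * n))⁻¹) := by
  induction n with
  | zero =>
    have := hasSum_single (f := fun r : ℤ => (-1 : ℂ) ^ r * q ^ (r * (r - 1) / 2) * y ^ r *
        (qFactInv q (((0 : ℕ) : ℤ) - r) * qFactInv q (((0 : ℕ) : ℤ) + r))) 0 fun r hr => by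
      rcases lt_or_gt_of_ne hr with h | h
      · rw [qFactInv_of_neg (k := _ + r) (by simpa using h)]; simp
      · rw [qFactInv_of_neg (k := _ - r) (by simpa using h)]; simp
    simpa [qPoch, qFactInv] using this
  | succ n ih =>
    have e1 := ih.mul_left (1 + q ^ (2 * n + 1))
    have e2 := ((Equiv.subRight (1 : ℤ)).hasSum_iff.2 ih).mul_left (-(y * q ^ n))
    have e3 := ((Equiv.addRight (1 : ℤ)).hasSum_iff.2 ih).mul_left (-(q ^ (n + 1) / y))
    set X := q ^ n with hX
    have x1 : q ^ (2 * n) = X ^ 2 := by rw [hX]; ring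
    have x2 : q ^ (2 * n + 1) = X ^ 2 * q := by rw [hX]; ring
    have x3 : q ^ (n + 1) = X * q := by rw [hX]; ring
    have h2n : qPoch q q (2 * (n + 1)) =
        qPoch q q (2 * n) * (1 - X ^ 2 * q) * (1 - X ^ 2 * q ^ 2) := by
      rw [show 2 * (n + 1) = 2 * n + 1 + 1 by ring, qPoch_succ, qPoch_succ, x1, x2]
      ring
    have f1 := one_sub_pow_ne_zero hq (2 * n)
    have f2 := one_sub_pow_ne_zero hq (2 * n + 1)
    rw [x1] at f1
    rw [x2, show X ^ 2 * q * q = X ^ 2 * q ^ 2 by ring] at f2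
    rw [x2] at e1
    rw [x3] at e3
    have f3 := qPoch_self_ne_zero hq (2 * n)
    have key := ((e1.add e2).add e3).mul_left ((1 - X ^ 2 * q)⁻¹ * (1 - X ^ 2 * q ^ 2)⁻¹)
    refine hasSum_of_eq key (fun r => ?_) ?_
    · simp only [Function.comp, Equiv.coe_addRight, Equiv.subRight_apply]
      have c1 : (r - 1) * (r - 1 - 1) / 2 = r * (r - 1) / 2 - (r - 1) := by
        have := choose_succ (r - 1)
        simp only [sub_add_cancel] at this
        linarith
      rw [c1, choose_succ, zpow_add₀ hq0, zpow_sub₀ hq0 _ (r - 1),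
        zpow_sub_one₀ (by norm_num : (-1 : ℂ) ≠ 0), zpow_add_one₀ (by norm_num : (-1 : ℂ) ≠ 0),
        zpow_sub_one₀ hy, zpow_add_one₀ hy]
      have b1 := qFactInv_pred hq ((n + 1 : ℕ) - r)
      have b2 := qFactInv_pred hq ((n + 1 : ℕ) - r - 1)
      have b3 := qFactInv_pred hq ((n + 1 : ℕ) + r)
      have b4 := qFactInv_pred hq ((n + 1 : ℕ) + r - 1)
      push_cast at b1 b2 b3 b4 ⊢
      rw [show (n : ℤ) - (r - 1) = n + 1 - r by ring,
        show (n : ℤ) + (r - 1) = n + 1 + r - 1 - 1 by ring,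
        show (n : ℤ) - (r + 1) = n + 1 - r - 1 - 1 by ring,
        show (n : ℤ) + (r + 1) = n + 1 + r by ring,
        show (n : ℤ) - r = n + 1 - r - 1 by ring, show (n : ℤ) + r = n + 1 + r - 1 by ring,
        b2, b4, b1, b3]
      have g1 : q ^ ((n : ℤ) + 1 - r) = X * q / q ^ r := by
        rw [zpow_sub₀ hq0, zpow_add₀ hq0]; simp [hX]
      have g2 : q ^ ((n : ℤ) + 1 - r - 1) = X / q ^ r := by
        rw [show (n : ℤ) + 1 - r - 1 = n - r by ring, zpow_sub₀ hq0]; simp [hX]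
      have g3 : q ^ ((n : ℤ) + 1 + r) = X * q * q ^ r := by
        rw [zpow_add₀ hq0, zpow_add₀ hq0]; simp [hX]
      have g4 : q ^ ((n : ℤ) + 1 + r - 1) = X * q ^ r := by
        rw [show (n : ℤ) + 1 + r - 1 = n + r by ring, zpow_add₀ hq0]; simp [hX]
      rw [g1, g2, g3, g4, zpow_sub_one₀ hq0]
      have hr : q ^ r ≠ 0 := zpow_ne_zero _ hq0
      field_simp
      ring
    · rw [qPoch_succ, qPoch_succ, h2n, ← hX]
      field_simp
      ring

/-- **Jacobi's triple product identity.** -/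
lemma hasSum_thetaJ (hq0 : q ≠ 0) (hq : ‖q‖ < 1) {y : ℂ} (hy : y ≠ 0) :
    HasSum (fun r : ℤ => (-1 : ℂ) ^ r * q ^ (r * (r - 1) / 2) * y ^ r) (thetaJ y q) := by
  have hs := summable_norm_theta hq0 hq hy
  have l1 := tendsto_tsum_qFactInv hq hs
  have l2 : Tendsto (fun n : ℕ => qPoch y q n * qPoch (q / y) q n * (qPoch q q (2 * n))⁻¹) atTop
      (𝓝 (qPochInf y q * qPochInf (q / y) q * (qPochInf q q)⁻¹)) :=
    ((tendsto_qPoch hq y).mul (tendsto_qPoch hq _)).mul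
      (((tendsto_qPoch hq q).comp (tendsto_id.const_mul_atTop' (by norm_num))).inv₀
        (qPochInf_self_ne_zero hq))
  have e := tendsto_nhds_unique l1
    (l2.congr fun n => (hasSum_finite_tripleProduct hq0 hq hy n).tsum_eq.symm)
  rw [tsum_mul_right] at e
  have h0 := qPochInf_self_ne_zero hq
  have : thetaJ y q = ∑' r : ℤ, (-1 : ℂ) ^ r * q ^ (r * (r - 1) / 2) * y ^ r := by
    rw [thetaJ]
    field_simp at e
    linear_combination -e
  rw [this]
  exact hs.of_norm.hasSum

/-- The partial fraction decomposition of the reciprocal of a finite theta product. -/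
lemma hasSum_finite_partialFractions (hq0 : q ≠ 0) (hq : ‖q‖ < 1) {x : ℂ} (hx0 : x ≠ 0)
    (hx : NotPower x q) (n : ℕ) :
    HasSum (fun r : ℤ => (-1 : ℂ) ^ r * q ^ (r * (r - 1) / 2) * q ^ r * (1 - q ^ r * x)⁻¹ *
        (qFactInv q (n - r) * qFactInv q (n + r)))
      (qPoch x q (n + 1) * qPoch (q / x) q n)⁻¹ := by
  induction n with
  | zero =>
    have := hasSum_single (f := fun r : ℤ => (-1 : ℂ) ^ r * q ^ (r * (r - 1) / 2) * q ^ r *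
        (1 - q ^ r * x)⁻¹ *
        (qFactInv q (((0 : ℕ) : ℤ) - r) * qFactInv q (((0 : ℕ) : ℤ) + r))) 0 fun r hr => by
      rcases lt_or_gt_of_ne hr with h | h
      · rw [qFactInv_of_neg (k := _ + r) (by simpa using h)]; simp
      · rw [qFactInv_of_neg (k := _ - r) (by simpa using h)]; simp
    simpa [qPoch, qFactInv] using this
  | succ n ih =>
    have hsum : Summable (fun r : ℤ => (-1 : ℂ) ^ r * q ^ (r * (r - 1) / 2) * q ^ r *
        (1 - q ^ r * x)⁻¹ * (qFactInv q ((n + 1 : ℕ) - r) * qFactInv q ((n + 1 : ℕ) + r))) := by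
      refine summable_of_ne_finset_zero (s := Finset.Icc (-(n + 1 : ℤ)) (n + 1)) fun r hr => ?_
      rw [Finset.mem_Icc, not_and_or, not_le, not_le] at hr
      rcases hr with h | h
      · rw [qFactInv_of_neg (k := _ + r) (by push_cast; linarith)]; simp
      · rw [qFactInv_of_neg (k := _ - r) (by push_cast; linarith)]; simp
    obtain ⟨s, hs⟩ := hsum
    have t1 := hasSum_finite_tripleProduct hq0 hq hq0 (n + 1)
    have t2 := hasSum_finite_tripleProduct hq0 hq one_ne_zero (n + 1)
    rw [div_self hq0, qPoch_succ' 1, sub_self, zero_mul, mul_zero, zero_mul] at t1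
    rw [qPoch_succ' 1, sub_self, zero_mul, zero_mul, zero_mul] at t2
    set X := q ^ n with hX
    have key := ((hs.mul_left ((1 - x * (X * q)) * (1 - X * q / x))).add
      (t2.mul_left (-(X * q)))).add (t1.mul_left (X * q / x))
    have hx1 : ∀ i : ℕ, 1 - q ^ i * x ≠ 0 := fun i =>
      sub_ne_zero.2 (by simpa using (hx.zpow_mul_ne i).symm)
    have hx2 : ∀ i : ℕ, 1 - q ^ i * (q / x) ≠ 0 := fun i => sub_ne_zero.2 <| by
      have := ((notPower_inv_iff.2 hx).zpow_mul_ne (i + 1 : ℕ)).symm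
      rwa [zpow_natCast, pow_succ, mul_assoc] at this
    have e := ih.unique (hasSum_of_eq key (fun r => ?_) rfl)
    · have e1 : qPoch x q (n + 1 + 1) = qPoch x q (n + 1) * (1 - x * (X * q)) := by
        rw [qPoch_succ _ _ (n + 1), pow_succ, ← hX]; ring
      have e2 : qPoch (q / x) q (n + 1) = qPoch (q / x) q n * (1 - X * q / x) := by
        rw [qPoch_succ, ← hX]; ring
      have n1 : 1 - x * (X * q) ≠ 0 := by
        have := hx1 (n + 1)
        rwa [pow_succ, ← hX, mul_comm] at this
      have n2 : 1 - X * q / x ≠ 0 := by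
        have := hx2 n
        rwa [← hX, ← mul_div_assoc] at this
      refine hasSum_of_eq hs (fun _ => rfl) ?_
      rw [e1, e2]
      have n3 : qPoch x q (n + 1) ≠ 0 := Finset.prod_ne_zero_iff.2 fun i _ => hx1 i
      have n4 : qPoch (q / x) q n ≠ 0 := Finset.prod_ne_zero_iff.2 fun i _ => hx2 i
      simp only [mul_zero, add_zero] at e
      rw [show qPoch x q (n + 1) * (1 - x * (X * q)) * (qPoch (q / x) q n * (1 - X * q / x)) =
        (qPoch x q (n + 1) * qPoch (q / x) q n) * ((1 - x * (X * q)) * (1 - X * q / x)) by ring,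
        mul_inv, e]
      rw [mul_comm ((1 - x * (X * q)) * (1 - X * q / x)) s, mul_assoc,
        mul_inv_cancel₀ (mul_ne_zero n1 n2), mul_one]
    · have b1 := qFactInv_pred hq ((n + 1 : ℕ) - r)
      have b3 := qFactInv_pred hq ((n + 1 : ℕ) + r)
      push_cast at b1 b3 ⊢
      have g1 : q ^ ((n : ℤ) + 1 - r) = X * q / q ^ r := by
        rw [zpow_sub₀ hq0, zpow_add₀ hq0]; simp [hX]
      have g3 : q ^ ((n : ℤ) + 1 + r) = X * q * q ^ r := by
        rw [zpow_add₀ hq0, zpow_add₀ hq0]; simp [hX]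
      rw [show (n : ℤ) - r = n + 1 - r - 1 by ring, show (n : ℤ) + r = n + 1 + r - 1 by ring,
        b1, b3, g1, g3, one_zpow]
      have hr : q ^ r ≠ 0 := zpow_ne_zero _ hq0
      have hd : 1 - q ^ r * x ≠ 0 := sub_ne_zero.2 (hx.zpow_mul_ne r).symm
      generalize q ^ r = Y at *
      rw [mul_comm] at hd
      rw [mul_comm Y x]
      field_simp
      ring

lemma summable_norm_reciprocal (hq0 : q ≠ 0) (hq : ‖q‖ < 1) {x z : ℂ} (hz : z ≠ 0) (hx0 : x ≠ 0)
    (hx : NotPower x q) :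
    Summable fun r : ℤ => ‖(-1 : ℂ) ^ r * q ^ (r * (r - 1) / 2) * z ^ r * (1 - q ^ r * x)⁻¹‖ := by
  obtain ⟨C, hC0, hC⟩ := exists_norm_inv_le_self hq0 hq hx0 hx
  refine Summable.of_nonneg_of_le (fun _ => norm_nonneg _) (fun r => ?_)
    ((summable_norm_theta hq0 hq hz).mul_right C)
  rw [norm_mul]
  exact mul_le_mul_of_nonneg_left (hC r) (norm_nonneg _)

/-- The partial fraction decomposition of the reciprocal of the theta function. -/
lemma hasSum_inv_thetaJ (hq0 : q ≠ 0) (hq : ‖q‖ < 1) {x : ℂ} (hx0 : x ≠ 0) (hx : NotPower x q) :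
    HasSum (fun r : ℤ => (-1 : ℂ) ^ r * q ^ (r * (r - 1) / 2) * q ^ r * (1 - q ^ r * x)⁻¹)
      (qPochInf q q ^ 3 / thetaJ x q) := by
  have hs := summable_norm_reciprocal hq0 hq hq0 hx0 hx
  have l1 := tendsto_tsum_qFactInv hq hs
  have hj := thetaJ_ne_zero hq hx
  have h0 := qPochInf_self_ne_zero hq
  have h1 : qPochInf x q ≠ 0 := fun h => hj (by rw [thetaJ, h]; ring)
  have h2 : qPochInf (q / x) q ≠ 0 := fun h => hj (by rw [thetaJ, h]; ring)
  have l2 : Tendsto (fun n : ℕ => (qPoch x q (n + 1) * qPoch (q / x) q n)⁻¹) atTop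
      (𝓝 (qPochInf x q * qPochInf (q / x) q)⁻¹) :=
    ((((tendsto_qPoch hq x).comp (tendsto_add_atTop_nat 1))).mul (tendsto_qPoch hq _)).inv₀
      (mul_ne_zero h1 h2)
  have e := tendsto_nhds_unique l1
    (l2.congr fun n => (hasSum_finite_partialFractions hq0 hq hx0 hx n).tsum_eq.symm)
  rw [tsum_mul_right] at e
  refine hasSum_of_eq hs.of_norm.hasSum (fun _ => rfl) ?_
  rw [thetaJ]
  generalize (∑' r : ℤ, (-1 : ℂ) ^ r * q ^ (r * (r - 1) / 2) * q ^ r * (1 - q ^ r * x)⁻¹) = s at *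
  field_simp at e ⊢
  linear_combination e

end tripleProduct

/-! ### The Rogers–Fine identity with a vanishing parameter -/

section rogersFine

variable {q : ℂ}

lemma summable_pow_choose {p : ℝ} (hp0 : 0 ≤ p) (hp : p < 1) (z : ℝ) (hz : 0 ≤ z) :
    Summable fun n : ℕ => z ^ n * p ^ (n * (n - 1)) := by
  obtain ⟨N, hN⟩ : ∃ N, z * p ^ N ≤ 1 / 2 := by
    have : Tendsto (fun N => z * p ^ N) atTop (𝓝 (z * 0)) :=
      (tendsto_pow_atTop_nhds_zero_of_lt_one hp0 hp).const_mul z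
    rw [mul_zero] at this
    obtain ⟨N, hN⟩ := (this.eventually_le_const (show (0 : ℝ) < 1 / 2 by norm_num)).exists
    exact ⟨N, hN⟩
  refine Summable.of_norm_bounded_eventually_nat (g := fun n => (1 / 2 : ℝ) ^ n)
    (summable_geometric_of_lt_one (by norm_num) (by norm_num)) ?_
  filter_upwards [eventually_ge_atTop (N + 1)] with n hn
  rw [Real.norm_of_nonneg (by positivity), mul_comm n, pow_mul, ← mul_pow]
  refine pow_le_pow_left₀ (by positivity) ?_ _
  refine le_trans ?_ hN
  gcongr ?_ * ?_
  exact pow_le_pow_of_le_one hp0 hp.le (by omega)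

/-- The tails `∑ (τ q ^ N) ^ k / (β; q)_{N + k}` in the iteration that proves the
Rogers–Fine identity. -/
noncomputable def fineTail (β τ q : ℂ) (N : ℕ) : ℂ :=
  ∑' k : ℕ, (τ * q ^ N) ^ k * (qPoch β q (N + k))⁻¹

lemma summable_fineTail (hq : ‖q‖ < 1) {β τ : ℂ} (hβ : ∀ i : ℕ, q ^ i * β ≠ 1) (hτ : ‖τ‖ < 1)
    (N : ℕ) : Summable fun k : ℕ => ‖(τ * q ^ N) ^ k * (qPoch β q (N + k))⁻¹‖ := by
  obtain ⟨C, hC0, hC⟩ := exists_norm_qPoch_inv_le hq hβ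
  refine Summable.of_nonneg_of_le (fun _ => norm_nonneg _) (fun k => ?_)
    ((summable_geometric_of_lt_one (norm_nonneg τ) hτ).mul_right C)
  rw [norm_mul, norm_pow, norm_mul, norm_pow]
  gcongr
  · exact mul_le_of_le_one_right (norm_nonneg _) (pow_le_one₀ (norm_nonneg _) hq.le)
  · exact hC _

lemma norm_fineTail_le (hq : ‖q‖ < 1) {β τ : ℂ} (hβ : ∀ i : ℕ, q ^ i * β ≠ 1) (hτ : ‖τ‖ < 1) :
    ∃ C, 0 < C ∧ ∀ N, ‖fineTail β τ q N‖ ≤ C := by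
  obtain ⟨C, hC0, hC⟩ := exists_norm_qPoch_inv_le hq hβ
  have h1 : 0 < 1 - ‖τ‖ := by linarith
  refine ⟨(1 - ‖τ‖)⁻¹ * C, by positivity, fun N => ?_⟩
  refine tsum_of_norm_bounded ((hasSum_geometric_of_lt_one (norm_nonneg τ) hτ).mul_right C)
    fun k => ?_
  rw [norm_mul, norm_pow, norm_mul, norm_pow]
  gcongr
  · exact mul_le_of_le_one_right (norm_nonneg _) (pow_le_one₀ (norm_nonneg _) hq.le)
  · exact hC _

lemma qPoch_ne_zero {x : ℂ} (h : ∀ i : ℕ, q ^ i * x ≠ 1) (n : ℕ) : qPoch x q n ≠ 0 :=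
  Finset.prod_ne_zero_iff.2 fun i _ => sub_ne_zero.2 (h i).symm

lemma fineTail_succ (hq : ‖q‖ < 1) {β τ : ℂ} (hβ : ∀ i : ℕ, q ^ i * β ≠ 1) (hτ : ‖τ‖ < 1)
    (N : ℕ) : (1 - q ^ N * τ) * fineTail β τ q N =
      (qPoch β q N)⁻¹ + β * τ * q ^ (2 * N) * fineTail β τ q (N + 1) := by
  have s1 := (summable_fineTail hq hβ hτ N).of_norm
  have s2 := (summable_fineTail hq hβ hτ (N + 1)).of_norm
  have h1 : fineTail β τ q N = (qPoch β q N)⁻¹ +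
      ∑' k : ℕ, (τ * q ^ N) ^ (k + 1) * (qPoch β q (N + (k + 1)))⁻¹ := by
    rw [fineTail, s1.tsum_eq_zero_add]; simp
  have s3 : Summable fun k : ℕ => (τ * q ^ N) ^ (k + 1) * (qPoch β q (N + (k + 1)))⁻¹ :=
    (summable_nat_add_iff 1).2 s1
  have h2 : β * τ * q ^ (2 * N) * fineTail β τ q (N + 1) =
      (∑' k : ℕ, (τ * q ^ N) ^ (k + 1) * (qPoch β q (N + (k + 1)))⁻¹) -
        q ^ N * τ * fineTail β τ q N := by
    rw [fineTail, fineTail, ← tsum_mul_left, ← tsum_mul_left, ← s3.tsum_sub (s1.mul_left _)]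
    refine tsum_congr fun k => ?_
    have e1 : qPoch β q (N + (k + 1)) = qPoch β q (N + k) * (1 - q ^ (N + k) * β) := by
      rw [← add_assoc, qPoch_succ]
    have e2 : qPoch β q (N + 1 + k) = qPoch β q (N + k) * (1 - q ^ (N + k) * β) := by
      rw [add_right_comm, qPoch_succ]
    have n1 : 1 - q ^ (N + k) * β ≠ 0 := sub_ne_zero.2 (hβ _).symm
    have n2 := qPoch_ne_zero hβ (N + k)
    have e3 : (qPoch β q (N + k))⁻¹ =
        (1 - q ^ (N + k) * β) * (qPoch β q (N + k) * (1 - q ^ (N + k) * β))⁻¹ := by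
      field_simp
    rw [e1, e2, e3]
    ring
  rw [h2, sub_mul, one_mul]
  linear_combination h1

/-- The Rogers–Fine identity `∑ τ ^ k / (β)_k = ∑ (β τ) ^ n q ^ (n ^ 2 - n) / ((β)_n (τ)_{n + 1})`. -/
lemma hasSum_fine (hq : ‖q‖ < 1) {β τ : ℂ} (hβ : ∀ i : ℕ, q ^ i * β ≠ 1) (hτ : ‖τ‖ < 1) :
    HasSum (fun n : ℕ => (β * τ) ^ n * q ^ (n * (n - 1)) / (qPoch β q n * qPoch τ q (n + 1)))
      (∑' k : ℕ, τ ^ k * (qPoch β q k)⁻¹) := by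
  have hτ' : ∀ i : ℕ, q ^ i * τ ≠ 1 := fun i h => by
    have h1 : ‖q‖ ^ i * ‖τ‖ = 1 := by rw [← norm_pow, ← norm_mul, h, norm_one]
    nlinarith [pow_le_one₀ (n := i) (norm_nonneg q) hq.le, norm_nonneg τ]
  obtain ⟨C, hC0, hC⟩ := exists_norm_qPoch_inv_le hq hβ
  obtain ⟨D, hD0, hD⟩ := exists_norm_qPoch_inv_le hq hτ'
  obtain ⟨E, hE0, hE⟩ := norm_fineTail_le hq hβ hτ
  have hsum := summable_pow_choose (norm_nonneg q) hq ‖β * τ‖ (norm_nonneg _)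
  have hs : Summable fun n : ℕ =>
      (β * τ) ^ n * q ^ (n * (n - 1)) / (qPoch β q n * qPoch τ q (n + 1)) := by
    refine Summable.of_norm_bounded (g := fun n => ‖β * τ‖ ^ n * ‖q‖ ^ (n * (n - 1)) * (C * D))
      (hsum.mul_right _) fun n => ?_
    rw [div_eq_mul_inv, mul_inv, norm_mul, norm_mul, norm_mul, norm_pow, norm_pow]
    gcongr
    · exact hC _
    · exact hD _
  rw [hs.hasSum_iff_tendsto_nat]
  have hpart : ∀ N : ℕ, ∑ n ∈ Finset.range N,
      (β * τ) ^ n * q ^ (n * (n - 1)) / (qPoch β q n * qPoch τ q (n + 1)) =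
      (∑' k : ℕ, τ ^ k * (qPoch β q k)⁻¹) -
        (β * τ) ^ N * q ^ (N * (N - 1)) * (qPoch τ q N)⁻¹ * fineTail β τ q N := by
    intro N
    induction N with
    | zero => simp [fineTail, qPoch]
    | succ N ih =>
      rw [Finset.sum_range_succ, ih]
      have e := fineTail_succ hq hβ hτ N
      have n1 : 1 - q ^ N * τ ≠ 0 := sub_ne_zero.2 (hτ' _).symm
      have n2 := qPoch_ne_zero hβ N
      have n3 := qPoch_ne_zero hτ' N
      have e2 : (N + 1) * (N + 1 - 1) = N * (N - 1) + 2 * N := by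
        cases N with
        | zero => rfl
        | succ m => simp only [Nat.add_sub_cancel]; ring
      rw [e2, pow_add q (N * (N - 1)), qPoch_succ τ, pow_succ]
      have e3 : fineTail β τ q N = ((qPoch β q N)⁻¹ +
          β * τ * q ^ (2 * N) * fineTail β τ q (N + 1)) / (1 - q ^ N * τ) := by
        rw [← e]; field_simp
      rw [e3]
      field_simp
      ring
  simp only [hpart]
  have : Tendsto (fun N : ℕ => (β * τ) ^ N * q ^ (N * (N - 1)) * (qPoch τ q N)⁻¹ *
      fineTail β τ q N) atTop (𝓝 0) := by
    refine squeeze_zero_norm (fun N => ?_)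
      (show Tendsto (fun n : ℕ => ‖β * τ‖ ^ n * ‖q‖ ^ (n * (n - 1)) * (D * E)) atTop (𝓝 0) by
        simpa using hsum.tendsto_atTop_zero.mul_const (D * E))
    rw [norm_mul, norm_mul, norm_mul, norm_pow, norm_pow, mul_assoc]
    gcongr
    · exact hD _
    · exact hE _
  simpa using this.const_sub (∑' k : ℕ, τ ^ k * (qPoch β q k)⁻¹)

/-- Euler's product as a sum over Durfee rectangles:
`1 / (β)_∞ = ∑ β ^ n q ^ (n ^ 2 - n) / ((β)_n (q)_n)`. -/
lemma hasSum_inv_qPochInf (hq : ‖q‖ < 1) {β : ℂ} (hβ : ∀ i : ℕ, q ^ i * β ≠ 1) :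
    HasSum (fun n : ℕ => β ^ n * q ^ (n * (n - 1)) / (qPoch β q n * qPoch q q n))
      (qPochInf β q)⁻¹ := by
  have hβ1 : ∀ i : ℕ, q ^ i * (β * q) ≠ 1 := fun i => by
    have := hβ (i + 1)
    rwa [pow_succ, mul_assoc, mul_comm q] at this
  have hb0 : 1 - β ≠ 0 := sub_ne_zero.2 (by simpa using (hβ 0).symm)
  have h1 := (hasSum_fine hq hβ1 hq).mul_left (β / (1 - β))
  -- The sum over `k` telescopes.
  have h2 : HasSum (fun k : ℕ => (qPoch β q (k + 1))⁻¹ - (qPoch β q k)⁻¹)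
      (β / (1 - β) * ∑' k : ℕ, q ^ k * (qPoch (β * q) q k)⁻¹) := by
    have s1 : Summable fun k : ℕ => q ^ k * (qPoch (β * q) q k)⁻¹ := by
      simpa using (summable_fineTail hq hβ1 hq 0).of_norm
    refine hasSum_of_eq (s1.hasSum.mul_left (β / (1 - β))) (fun k => ?_) rfl
    have n1 : 1 - q ^ k * β ≠ 0 := sub_ne_zero.2 (hβ _).symm
    have n2 := qPoch_ne_zero hβ1 k
    have n3 := qPoch_ne_zero hβ k
    have e1 := qPoch_succ' β q k
    have e2 := qPoch_succ β q k
    have e3 : (qPoch β q k)⁻¹ = (1 - q ^ k * β) * (qPoch β q (k + 1))⁻¹ := by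
      rw [e2]; field_simp
    rw [e3, e1]
    field_simp
    ring
  have h3 : Tendsto (fun n => (qPoch β q n)⁻¹ - 1) atTop (𝓝 ((qPochInf β q)⁻¹ - 1)) :=
    ((tendsto_qPoch hq β).inv₀ (qPochInf_ne_zero hq hβ)).sub_const 1
  have h4 := tendsto_nhds_unique h2.tendsto_sum_nat (h3.congr fun n => by
    rw [Finset.sum_range_sub (fun k => (qPoch β q k)⁻¹)]; simp [qPoch])
  rw [h4] at h1
  refine (hasSum_nat_add_iff' 1).1 (hasSum_of_eq h1 (fun n => ?_) (by simp [qPoch]))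
  rw [qPoch_succ' β]
  have n2 := qPoch_ne_zero hβ1 n
  have e2 : (n + 1) * (n + 1 - 1) = n * (n - 1) + 2 * n := by
    cases n with
    | zero => rfl
    | succ m => simp only [Nat.add_sub_cancel]; ring
  rw [e2, pow_add q, pow_succ β, mul_assoc β q q, mul_pow, pow_mul q 2 n, ← sq]
  have n4 := qPoch_self_ne_zero hq (n + 1)
  field_simp

lemma qPoch_self_add (q : ℂ) (m n : ℕ) :
    qPoch q q (m + n) = qPoch q q m * qPoch (q ^ (m + 1)) q n := by
  induction n with
  | zero => simp [qPoch]
  | succ n ih =>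
    rw [← add_assoc, qPoch_succ, ih, qPoch_succ]
    ring

lemma hasSum_durfee_nat (hq : ‖q‖ < 1) (m : ℕ) :
    HasSum (fun n : ℕ => q ^ (n ^ 2) * (qFactInv q (n - m) * qFactInv q (n + m)))
      (q ^ (m ^ 2) * (qPochInf q q)⁻¹) := by
  have hβ : ∀ i : ℕ, q ^ i * q ^ (2 * m + 1) ≠ 1 := fun i h => by
    apply one_sub_pow_ne_zero hq (i + 2 * m)
    rw [pow_add, mul_assoc, ← pow_succ, h, sub_self]
  have h1 := (hasSum_inv_qPochInf hq hβ).mul_left (q ^ (m ^ 2) * (qPoch q q (2 * m))⁻¹)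
  have e1 : qPochInf q q = qPoch q q (2 * m) * qPochInf (q ^ (2 * m + 1)) q := by
    have l1 := (tendsto_qPoch hq q).comp (tendsto_add_atTop_nat (2 * m))
    have l2 := (tendsto_qPoch hq (q ^ (2 * m + 1))).const_mul (qPoch q q (2 * m))
    refine tendsto_nhds_unique l1 (l2.congr fun n => ?_)
    rw [← qPoch_self_add, Function.comp, add_comm]
  have hinj : Function.Injective fun n : ℕ => n + m := fun a b h => by simpa using h
  refine (hinj.hasSum_iff fun n hn => ?_).1 (hasSum_of_eq h1 (fun n => ?_) ?_)
  · rw [qFactInv_of_neg (k := _ - _)]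
    · simp
    · by_contra hc
      exact hn ⟨n - m, by simp; omega⟩
  · have n1 : ((n + m : ℕ) : ℤ) - m = n := by push_cast; ring
    have n2 : ((n + m : ℕ) : ℤ) + m = ((2 * m + n : ℕ) : ℤ) := by push_cast; ring
    simp only [Function.comp]
    rw [n1, n2, qFactInv_natCast, qFactInv_natCast, qPoch_self_add]
    have e2 : q ^ ((n + m) ^ 2) = q ^ (m ^ 2) * ((q ^ (2 * m + 1)) ^ n * q ^ (n * (n - 1))) := by
      rw [← pow_mul, ← pow_add, ← pow_add]
      congr 1
      cases n with
      | zero => ring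
      | succ k => simp only [Nat.add_sub_cancel]; ring
    rw [e2]
    have f1 := qPoch_self_ne_zero hq (2 * m)
    have f2 := qPoch_ne_zero hβ n
    have f3 := qPoch_self_ne_zero hq n
    field_simp
  · rw [e1]
    have f1 := qPoch_self_ne_zero hq (2 * m)
    have f2 := qPochInf_ne_zero hq hβ
    field_simp

lemma hasSum_durfee (hq : ‖q‖ < 1) (r : ℤ) :
    HasSum (fun n : ℕ => q ^ (n ^ 2) * (qFactInv q (n - r) * qFactInv q (n + r)))
      (q ^ (r * r) * (qPochInf q q)⁻¹) := by
  obtain ⟨m, rfl | rfl⟩ := r.eq_nat_or_neg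
  · refine hasSum_of_eq (hasSum_durfee_nat hq m) (fun _ => rfl) ?_
    norm_cast
    rw [← sq]
  · refine hasSum_of_eq (hasSum_durfee_nat hq m) (fun n => ?_) ?_
    · rw [sub_neg_eq_add, ← sub_eq_add_neg, mul_comm (qFactInv q (n - m))]
    · rw [neg_mul_neg]
      norm_cast
      rw [← sq]

/-- The series `1 + x g(x, q) = ∑ q ^ (n ^ 2) / ((x; q)_{n + 1} (q / x; q)_n)`. -/
noncomputable def mockH (x q : ℂ) : ℂ :=
  ∑' n : ℕ, q ^ (n ^ 2) / (qPoch x q (n + 1) * qPoch (q / x) q n)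

/-- The `r`-th term of Watson's Lambert series for `mockH`. -/
noncomputable def watsonTerm (x q : ℂ) (r : ℤ) : ℂ :=
  (-1 : ℂ) ^ r * q ^ (r * (r - 1) / 2) * q ^ r * (1 - q ^ r * x)⁻¹ * q ^ (r * r)

/-- Watson's Lambert series for the universal mock theta function. -/
lemma hasSum_watson (hq0 : q ≠ 0) (hq : ‖q‖ < 1) {x : ℂ} (hx0 : x ≠ 0) (hx : NotPower x q) :
    HasSum (watsonTerm x q) (qPochInf q q * mockH x q) := by
  obtain ⟨C, hC0, hC⟩ := exists_norm_qFactInv_le hq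
  have hs := summable_norm_reciprocal hq0 hq hq0 hx0 hx
  have hn : Summable fun n : ℕ => ‖q ^ (n ^ 2)‖ := by
    refine Summable.of_nonneg_of_le (fun _ => norm_nonneg _) (fun n => ?_)
      (summable_geometric_of_lt_one (norm_nonneg q) hq)
    rw [norm_pow]
    exact pow_le_pow_of_le_one (norm_nonneg _) hq.le (by nlinarith)
  set c : ℤ → ℂ := fun r => (-1 : ℂ) ^ r * q ^ (r * (r - 1) / 2) * q ^ r * (1 - q ^ r * x)⁻¹
    with hc
  have hprod : Summable fun p : ℕ × ℤ => q ^ (p.1 ^ 2) *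
      (c p.2 * (qFactInv q (p.1 - p.2) * qFactInv q (p.1 + p.2))) := by
    refine Summable.of_norm_bounded (g := fun p : ℕ × ℤ => ‖q ^ (p.1 ^ 2)‖ * ‖c p.2‖ * (C * C))
      ((hn.mul_of_nonneg hs (fun _ => norm_nonneg _) (fun _ => norm_nonneg _)).mul_right _) ?_
    rintro ⟨n, r⟩
    rw [norm_mul, norm_mul (c _), norm_mul (qFactInv q _), ← mul_assoc]
    exact mul_le_mul_of_nonneg_left (mul_le_mul (hC _) (hC _) (norm_nonneg _) hC0.le)
      (by positivity)
  have e1 : ∀ n : ℕ, q ^ (n ^ 2) / (qPoch x q (n + 1) * qPoch (q / x) q n) =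
      ∑' r : ℤ, q ^ (n ^ 2) * (c r * (qFactInv q (n - r) * qFactInv q (n + r))) := fun n => by
    rw [tsum_mul_left, (hasSum_finite_partialFractions hq0 hq hx0 hx n).tsum_eq, div_eq_mul_inv]
  have h0 := qPochInf_self_ne_zero hq
  have e2 : ∀ r : ℤ, ∑' n : ℕ, q ^ (n ^ 2) * (c r * (qFactInv q (n - r) * qFactInv q (n + r))) =
      (qPochInf q q)⁻¹ * watsonTerm x q r := by
    intro r
    rw [← tsum_congr fun n : ℕ => mul_left_comm (c r) (q ^ (n ^ 2)) _, tsum_mul_left,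
      (hasSum_durfee hq r).tsum_eq, watsonTerm]
    ring
  have h3 : Summable fun r : ℤ => (qPochInf q q)⁻¹ * watsonTerm x q r := by
    have := hprod.prod_symm.prod
    refine this.congr fun r => ?_
    exact e2 r
  have h4 : mockH x q = ∑' r : ℤ, (qPochInf q q)⁻¹ * watsonTerm x q r := by
    have := hprod.tsum_comm (f := fun (n : ℕ) (r : ℤ) =>
      q ^ (n ^ 2) * (c r * (qFactInv q (n - r) * qFactInv q (n + r))))
    rw [mockH, tsum_congr e1, ← this, tsum_congr e2]
  have h5 : Summable (watsonTerm x q) :=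
    (summable_mul_left_iff (inv_ne_zero h0)).1 h3
  rw [h4, tsum_mul_left, mul_inv_cancel_left₀ h0]
  exact h5.hasSum

end rogersFine

/-! ### Quasi-periodic holomorphic functions on the punctured plane -/

section laurent

open Complex Real

/-- The `n`-th Laurent coefficient (times `2 π i`) of a function on the punctured plane, computed
on the circle of radius `R`. -/
noncomputable def laurentInt (L : ℂ → ℂ) (n : ℤ) (R : ℝ) : ℂ := ∮ z in C(0, R), z ^ (-n - 1) * L z

lemma differentiableOn_zpow_mul {L : ℂ → ℂ} (hL : DifferentiableOn ℂ L {0}ᶜ) (n : ℤ) :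
    DifferentiableOn ℂ (fun z => z ^ n * L z) {0}ᶜ := fun z hz =>
  ((differentiableAt_zpow.2 (Or.inl hz)).differentiableWithinAt).mul (hL z hz)

lemma laurentInt_eq_of_le {L : ℂ → ℂ} (hL : DifferentiableOn ℂ L {0}ᶜ) (n : ℤ) {r R : ℝ}
    (hr : 0 < r) (hrR : r ≤ R) : laurentInt L n R = laurentInt L n r := by
  have h := differentiableOn_zpow_mul hL (-n - 1)
  refine circleIntegral_eq_of_differentiable_on_annulus_off_countable hr hrR
    (s := ∅) Set.countable_empty ?_ ?_
  · refine h.continuousOn.mono fun z hz h0 => hz.2 ?_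
    rw [Set.mem_singleton_iff] at h0
    simpa [h0] using hr
  · intro z hz
    have hz0 : z ≠ 0 := by
      rintro rfl
      exact hz.1.2 (by simpa using hr.le)
    exact h.differentiableAt (isOpen_compl_singleton.mem_nhds hz0)

lemma laurentInt_eq {L : ℂ → ℂ} (hL : DifferentiableOn ℂ L {0}ᶜ) (n : ℤ) {r R : ℝ}
    (hr : 0 < r) (hR : 0 < R) : laurentInt L n R = laurentInt L n r := by
  rcases le_total r R with h | h
  · exact laurentInt_eq_of_le hL n hr h
  · exact (laurentInt_eq_of_le hL n hR h).symm

/-- Rotation and dilation of the circle of integration. -/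
lemma laurentInt_comp_mul (L : ℂ → ℂ) (n : ℤ) {q : ℂ} (hq0 : q ≠ 0) {R : ℝ} (hR : 0 < R) :
    laurentInt (fun z => L (q * z)) n R = q ^ n * laurentInt L n (‖q‖ * R) := by
  set G : ℝ → ℂ := fun θ => circleMap 0 (‖q‖ * R) θ * I *
    (circleMap 0 (‖q‖ * R) θ ^ (-n - 1) * L (circleMap 0 (‖q‖ * R) θ)) with hG
  have hper : Function.Periodic G (2 * π) := fun θ => by
    simp only [hG, periodic_circleMap 0 (‖q‖ * R) θ]
  have h1 : laurentInt L n (‖q‖ * R) = ∫ θ in (0 : ℝ)..2 * π, G θ := by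
    rw [laurentInt, circleIntegral]
    simp [hG]
  have h2 : ∫ θ in (0 : ℝ)..2 * π, G θ = ∫ θ in (0 : ℝ)..2 * π, G (θ + Complex.arg q) := by
    rw [intervalIntegral.integral_comp_add_right, zero_add, add_comm (2 * π)]
    simpa using (hper.intervalIntegral_add_eq 0 (Complex.arg q))
  rw [h1, h2, ← intervalIntegral.integral_const_mul, laurentInt, circleIntegral]
  refine intervalIntegral.integral_congr fun θ _ => ?_
  have e : circleMap 0 (‖q‖ * R) (θ + Complex.arg q) = q * circleMap 0 R θ := by
    conv_rhs => rw [← norm_mul_exp_arg_mul_I q]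
    simp only [circleMap, zero_add]
    push_cast
    rw [add_mul, Complex.exp_add]
    ring
  have hc : circleMap 0 R θ ≠ 0 := circleMap_ne_center hR.ne'
  simp only [hG, e, deriv_circleMap, smul_eq_mul]
  rw [mul_zpow, zpow_sub₀ hq0, zpow_neg, zpow_one]
  field_simp

/-- A continuous function on a circle whose Fourier coefficients all vanish is zero. -/
lemma eq_zero_of_laurentInt_eq_zero {L : ℂ → ℂ} (hL : DifferentiableOn ℂ L {0}ᶜ)
    (h : ∀ n : ℤ, ∀ R : ℝ, 0 < R → laurentInt L n R = 0) {z : ℂ} (hz : z ≠ 0) : L z = 0 := by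
  have hR : 0 < ‖z‖ := norm_pos_iff.2 hz
  have : Fact (0 < 2 * π) := ⟨Real.two_pi_pos⟩
  let f : C(AddCircle (2 * π), ℂ) := ⟨fun t => L (‖z‖ * (AddCircle.toCircle t : ℂ)), by
    refine hL.continuousOn.comp_continuous (by fun_prop) fun t => ?_
    simp [hz]⟩
  have hval : ∀ θ : ℝ, f (θ : AddCircle (2 * π)) = L (circleMap 0 ‖z‖ θ) := fun θ => by
    simp only [f, ContinuousMap.coe_mk, AddCircle.toCircle_apply_mk, circleMap, zero_add,
      Circle.coe_exp]
    congr 3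
    rw [div_self Real.two_pi_pos.ne']
    simp
  have hcoef : ∀ n : ℤ, fourierCoeff f n = 0 := fun n => by
    rw [fourierCoeff_eq_intervalIntegral f n 0]
    have h1 := h n ‖z‖ hR
    rw [laurentInt, circleIntegral] at h1
    have h2 : ∫ x in (0 : ℝ)..0 + 2 * π, (fourier (-n)) (x : AddCircle (2 * π)) • f x =
        (I * (‖z‖ : ℂ) ^ (-n))⁻¹ * ∫ θ in (0 : ℝ)..2 * π, deriv (circleMap 0 ‖z‖) θ •
          (circleMap 0 ‖z‖ θ ^ (-n - 1) * L (circleMap 0 ‖z‖ θ)) := by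
      rw [← intervalIntegral.integral_const_mul, zero_add]
      refine intervalIntegral.integral_congr fun θ _ => ?_
      have hc : circleMap 0 ‖z‖ θ ≠ 0 := circleMap_ne_center hR.ne'
      have hz' : ((‖z‖ : ℝ) : ℂ) ≠ 0 := by exact_mod_cast hR.ne'
      have e : (fourier (-n)) (θ : AddCircle (2 * π)) =
          (‖z‖ : ℂ) ^ n * circleMap 0 ‖z‖ θ ^ (-n) := by
        rw [fourier_coe_apply, circleMap, zero_add, mul_zpow, ← Complex.exp_int_mul, ← mul_assoc,
          zpow_neg (‖z‖ : ℂ), mul_inv_cancel₀ (zpow_ne_zero _ hz'), one_mul]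
        congr 1
        have : (π : ℂ) ≠ 0 := by exact_mod_cast Real.pi_ne_zero
        push_cast
        field_simp
      simp only [hval, deriv_circleMap, smul_eq_mul, e]
      rw [zpow_sub₀ hc, zpow_one, zpow_neg (‖z‖ : ℂ)]
      have hzn : (‖z‖ : ℂ) ^ n ≠ 0 := zpow_ne_zero _ hz'
      field_simp
    rw [h2, h1]
    simp
  have hsum : Summable (fourierCoeff f) := by
    simp only [funext hcoef]; exact summable_zero
  have hs := has_pointwise_sum_fourier_series_of_summable hsum ((Complex.arg z : ℝ) : AddCircle (2 * π))
  simp only [hcoef, zero_smul] at hs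
  have h0 := hs.unique hasSum_zero
  rw [hval] at h0
  rw [← h0]
  congr 1
  rw [circleMap, zero_add, norm_mul_exp_arg_mul_I]

/-- The functions that are holomorphic on the punctured plane and satisfy
`L (q y) = c y⁻¹ L y` form a space of dimension at most one, because their Laurent coefficients
satisfy a recurrence of order one. -/
lemma mul_eq_mul_of_quasiPeriodic {q c : ℂ} (hq0 : q ≠ 0) (hc : c ≠ 0) {L T : ℂ → ℂ}
    (hL : DifferentiableOn ℂ L {0}ᶜ) (hT : DifferentiableOn ℂ T {0}ᶜ)
    (eL : ∀ y, y ≠ 0 → L (q * y) = c * y⁻¹ * L y) (eT : ∀ y, y ≠ 0 → T (q * y) = c * y⁻¹ * T y)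
    {y y' : ℂ} (hy : y ≠ 0) (hy' : y' ≠ 0) : L y * T y' = L y' * T y := by
  have main : ∀ G : ℂ → ℂ, DifferentiableOn ℂ G {0}ᶜ → (∀ y, y ≠ 0 → G (q * y) = c * y⁻¹ * G y) →
      laurentInt G 0 1 = 0 → ∀ y, y ≠ 0 → G y = 0 := by
    intro G hG eG h0 y hy
    have hrec : ∀ n : ℤ, q ^ n * laurentInt G n 1 = c * laurentInt G (n + 1) 1 := by
      intro n
      rw [laurentInt_eq hG n (by simpa using norm_pos_iff.2 hq0 : 0 < ‖q‖ * 1) one_pos,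
        ← laurentInt_comp_mul G n hq0 one_pos, laurentInt, laurentInt,
        ← circleIntegral.integral_const_mul]
      refine circleIntegral.integral_congr zero_le_one fun z hz => ?_
      have hz0 : z ≠ 0 := by
        rintro rfl
        simp at hz
      simp only [eG z hz0]
      rw [show -(n + 1) - 1 = (-n - 1) - 1 by ring, zpow_sub_one₀ hz0 (-n - 1)]
      ring
    have hall : ∀ n : ℤ, laurentInt G n 1 = 0 := by
      intro n
      induction n using Int.induction_on with
      | zero => exact h0
      | succ n ih =>
        have := hrec n
        rw [ih, mul_zero] at this
        exact (mul_eq_zero.1 this.symm).resolve_left hc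
      | pred n ih =>
        have := hrec (-(n : ℤ) - 1)
        rw [sub_add_cancel, ih, mul_zero] at this
        exact (mul_eq_zero.1 this).resolve_left (zpow_ne_zero _ hq0)
    exact eq_zero_of_laurentInt_eq_zero hG
      (fun n R hR => (laurentInt_eq hG n one_pos hR).trans (hall n)) hy
  have hint : ∀ G : ℂ → ℂ, DifferentiableOn ℂ G {0}ᶜ →
      CircleIntegrable (fun z => z ^ (-(0 : ℤ) - 1) * G z) 0 1 := fun G hG => by
    refine ContinuousOn.circleIntegrable zero_le_one
      ((differentiableOn_zpow_mul hG _).continuousOn.mono fun z hz h0 => ?_)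
    rw [Set.mem_singleton_iff] at h0
    simp [h0] at hz
  set t := laurentInt T 0 1 with ht
  set l := laurentInt L 0 1 with hl
  have key : ∀ y, y ≠ 0 → t * L y - l * T y = 0 := by
    refine main (fun y => t * L y - l * T y) ((hL.const_mul t).sub (hT.const_mul l)) ?_ ?_
    · intro y hy
      simp only [eL y hy, eT y hy]
      ring
    · have : laurentInt (fun y => t * L y - l * T y) 0 1 = t * l - l * t := by
        rw [hl, ht, laurentInt, laurentInt, laurentInt, ← circleIntegral.integral_const_mul,
          ← circleIntegral.integral_const_mul, ← circleIntegral.integral_sub]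
        · congr 1
          funext z
          ring
        · exact (hint L hL).const_smul (a := _)
        · exact (hint T hT).const_smul (a := _)
      rw [this]; ring
  by_cases h0 : t = 0
  · rw [main T hT eT h0 y hy, main T hT eT h0 y' hy']
    ring
  · have h1 := key y hy
    have h2 := key y' hy'
    apply mul_left_cancel₀ h0
    linear_combination T y' * h1 - T y * h2

/-- A Laurent series that converges absolutely on the punctured plane is holomorphic there. -/
lemma differentiableOn_tsum_zpow {a : ℤ → ℂ}
    (ha : ∀ ρ : ℝ, 0 < ρ → Summable fun r : ℤ => ‖a r‖ * ρ ^ r) :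
    DifferentiableOn ℂ (fun z => ∑' r : ℤ, a r * z ^ r) {0}ᶜ := by
  intro z hz
  have hz0 : z ≠ 0 := hz
  have hn : 0 < ‖z‖ := norm_pos_iff.2 hz0
  set U : Set ℂ := {w | ‖z‖ / 2 < ‖w‖ ∧ ‖w‖ < 2 * ‖z‖} with hU
  have hUo : IsOpen U := (isOpen_lt continuous_const continuous_norm).inter
    (isOpen_lt continuous_norm continuous_const)
  have hzU : z ∈ U := ⟨by linarith, by linarith⟩
  have hd : DifferentiableOn ℂ (fun z => ∑' r : ℤ, a r * z ^ r) U := by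
    refine differentiableOn_tsum_of_summable_norm
      (u := fun r => ‖a r‖ * (‖z‖ / 2) ^ r + ‖a r‖ * (2 * ‖z‖) ^ r)
      ((ha _ (by positivity)).add (ha _ (by positivity))) ?_ hUo ?_
    · intro r w hw
      have hw0 : w ≠ 0 := norm_pos_iff.1 (lt_trans (by positivity) hw.1)
      exact ((differentiableAt_zpow.2 (Or.inl hw0)).const_mul _).differentiableWithinAt
    · intro r w hw
      have hw0 : 0 < ‖w‖ := lt_trans (by positivity) hw.1
      rw [norm_mul, norm_zpow, ← mul_add]
      refine mul_le_mul_of_nonneg_left ?_ (norm_nonneg _)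
      rcases le_total 0 r with h | h
      · have := zpow_le_zpow_left₀ h hw0.le hw.2.le
        have h2 : 0 < (‖z‖ / 2) ^ r := zpow_pos (by positivity) _
        linarith
      · have := zpow_le_zpow_left₀ (n := -r) (by omega) (by positivity) hw.1.le
        rw [zpow_neg, zpow_neg] at this
        have h2 : 0 < (2 * ‖z‖) ^ r := zpow_pos (by positivity) _
        have h3 : ‖w‖ ^ r ≤ (‖z‖ / 2) ^ r :=
          (inv_le_inv₀ (zpow_pos (by positivity) _) (zpow_pos hw0 _)).1 this
        linarith
  exact (hd.differentiableAt (hUo.mem_nhds hzU)).differentiableWithinAt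

end laurent

/-! ### Appell–Lerch sums and the change of the auxiliary variable -/

section appell

variable {q : ℂ}

/-- The numerator of an Appell–Lerch sum, as a function of `z` and of the product `u = x z`, so that
`m(x, q, z) = appellA (x z) q z / j(z; q)`.  For fixed `u` it is holomorphic in `z ≠ 0`. -/
noncomputable def appellA (u q z : ℂ) : ℂ :=
  ∑' r : ℤ, (-1 : ℂ) ^ r * q ^ (r * (r - 1) / 2) * z ^ r * (1 - q ^ (r - 1) * u)⁻¹

lemma appellM_eq (x q z : ℂ) : appellM x q z = (thetaJ z q)⁻¹ * appellA (x * z) q z := by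
  simp only [appellM, appellA, div_eq_mul_inv, mul_assoc]

lemma summable_norm_appellA (hq0 : q ≠ 0) (hq : ‖q‖ < 1) {u z : ℂ} (hz : z ≠ 0) (hu0 : u ≠ 0)
    (hu : NotPower u q) : Summable fun r : ℤ =>
      ‖(-1 : ℂ) ^ r * q ^ (r * (r - 1) / 2) * z ^ r * (1 - q ^ (r - 1) * u)⁻¹‖ := by
  obtain ⟨C, hC0, hC⟩ := exists_norm_inv_le_self hq0 hq hu0 hu
  refine Summable.of_nonneg_of_le (fun _ => norm_nonneg _) (fun r => ?_)
    ((summable_norm_theta hq0 hq hz).mul_right C)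
  rw [norm_mul]
  exact mul_le_mul_of_nonneg_left (hC (r - 1)) (norm_nonneg _)

lemma hasSum_appellA (hq0 : q ≠ 0) (hq : ‖q‖ < 1) {u z : ℂ} (hz : z ≠ 0) (hu0 : u ≠ 0)
    (hu : NotPower u q) : HasSum (fun r : ℤ =>
      (-1 : ℂ) ^ r * q ^ (r * (r - 1) / 2) * z ^ r * (1 - q ^ (r - 1) * u)⁻¹) (appellA u q z) :=
  (summable_norm_appellA hq0 hq hz hu0 hu).of_norm.hasSum

lemma differentiableOn_thetaJ (hq0 : q ≠ 0) (hq : ‖q‖ < 1) :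
    DifferentiableOn ℂ (fun z => thetaJ z q) {0}ᶜ := by
  refine DifferentiableOn.congr (differentiableOn_tsum_zpow
    (a := fun r => (-1 : ℂ) ^ r * q ^ (r * (r - 1) / 2)) fun ρ hρ => ?_) fun z hz =>
      (hasSum_thetaJ hq0 hq hz).tsum_eq.symm
  simpa [norm_zpow] using summable_real_theta (norm_pos_iff.2 hq0) hq hρ

lemma differentiableOn_appellA (hq0 : q ≠ 0) (hq : ‖q‖ < 1) {u : ℂ} (hu0 : u ≠ 0)
    (hu : NotPower u q) : DifferentiableOn ℂ (fun z => appellA u q z) {0}ᶜ := by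
  refine DifferentiableOn.congr (differentiableOn_tsum_zpow
    (a := fun r => (-1 : ℂ) ^ r * q ^ (r * (r - 1) / 2) * (1 - q ^ (r - 1) * u)⁻¹)
      fun ρ hρ => ?_) fun z hz => tsum_congr fun r => by ring
  have := summable_norm_appellA hq0 hq (z := (ρ : ℂ)) (by exact_mod_cast hρ.ne') hu0 hu
  refine this.congr fun r => ?_
  simp only [norm_mul, norm_zpow, Complex.norm_real, Real.norm_of_nonneg hρ.le]
  ring

lemma DifferentiableOn.comp_const_mul {f : ℂ → ℂ} (hf : DifferentiableOn ℂ f {0}ᶜ) {k : ℂ}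
    (hk : k ≠ 0) : DifferentiableOn ℂ (fun z => f (k * z)) {0}ᶜ :=
  hf.comp ((differentiable_id.const_mul k).differentiableOn) fun _ hz => mul_ne_zero hk hz

lemma appellA_mul_left (hq0 : q ≠ 0) (hq : ‖q‖ < 1) {u z : ℂ} (hz : z ≠ 0) (hu0 : u ≠ 0)
    (hu : NotPower u q) :
    appellA u q (q * z) = q * u⁻¹ * (appellA u q z - thetaJ z q) := by
  have h1 := (hasSum_appellA hq0 hq hz hu0 hu).sub (hasSum_thetaJ hq0 hq hz)
  have h2 := h1.mul_left (q * u⁻¹)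
  refine (hasSum_appellA hq0 hq (mul_ne_zero hq0 hz) hu0 hu).unique
    (hasSum_of_eq h2 (fun r => ?_) rfl)
  have hd : 1 - q ^ (r - 1) * u ≠ 0 := sub_ne_zero.2 (hu.zpow_mul_ne (r - 1)).symm
  have e : q ^ r = q ^ (r - 1) * q := by rw [zpow_sub_one₀ hq0]; field_simp
  rw [mul_zpow, e]
  generalize q ^ (r - 1) = Y at *
  rw [mul_comm] at hd
  rw [mul_comm Y u]
  field_simp
  ring

lemma appellA_one (hq0 : q ≠ 0) (hq : ‖q‖ < 1) {u : ℂ} (hu0 : u ≠ 0) (hu : NotPower u q) :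
    appellA u q 1 = -(qPochInf q q ^ 3 / thetaJ u q) := by
  have h := ((Equiv.subRight (1 : ℤ)).hasSum_iff.2 (hasSum_inv_thetaJ hq0 hq hu0 hu)).neg
  refine (hasSum_appellA hq0 hq one_ne_zero hu0 hu).unique (hasSum_of_eq h (fun r => ?_) rfl)
  have c1 : (r - 1) * (r - 1 - 1) / 2 = r * (r - 1) / 2 - (r - 1) := by
    have := choose_succ (r - 1)
    simp only [sub_add_cancel] at this
    linarith
  simp only [Function.comp, Equiv.subRight_apply, one_zpow, mul_one]
  rw [c1, zpow_sub₀ hq0 _ (r - 1), zpow_sub_one₀ (by norm_num : (-1 : ℂ) ≠ 0)]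
  have hY : q ^ (r - 1) ≠ 0 := zpow_ne_zero _ hq0
  field_simp

/-- The change of the auxiliary variable in an Appell–Lerch sum, cleared of denominators.  With
`z_i = u_i y` both sides are holomorphic functions of `y ≠ 0` with the same quasi-period, and at
`y = 1 / u₀` the Appell sum is the reciprocal of a theta function. -/
lemma appellA_cross (hq0 : q ≠ 0) (hq : ‖q‖ < 1) {u₀ u₁ y : ℂ} (hy : y ≠ 0) (h0 : u₀ ≠ 0)
    (h1 : u₁ ≠ 0) (hu0 : NotPower u₀ q) (hu1 : NotPower u₁ q) :
    thetaJ (u₀ * y) q * appellA u₁ q (u₁ * y) - thetaJ (u₁ * y) q * appellA u₀ q (u₀ * y) =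
      u₀ * y * qPochInf q q ^ 3 * thetaJ (u₁ / u₀) q * thetaJ (u₀ * u₁ * y) q /
        (thetaJ u₀ q * thetaJ u₁ q) := by
  have dT := differentiableOn_thetaJ hq0 hq
  have dA0 := differentiableOn_appellA hq0 hq h0 hu0
  have dA1 := differentiableOn_appellA hq0 hq h1 hu1
  have hj0 := thetaJ_ne_zero hq hu0
  have hj1 := thetaJ_ne_zero hq hu1
  have key := mul_eq_mul_of_quasiPeriodic (c := -(q / (u₀ * u₁))) hq0
    (neg_ne_zero.2 (div_ne_zero hq0 (mul_ne_zero h0 h1)))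
    (L := fun y => thetaJ (u₀ * y) q * appellA u₁ q (u₁ * y) -
      thetaJ (u₁ * y) q * appellA u₀ q (u₀ * y))
    (T := fun y => y * thetaJ (u₀ * u₁ * y) q)
    (((DifferentiableOn.comp_const_mul dT h0).mul (DifferentiableOn.comp_const_mul dA1 h1)).sub
      ((DifferentiableOn.comp_const_mul dT h1).mul (DifferentiableOn.comp_const_mul dA0 h0)))
    (differentiableOn_id.mul (DifferentiableOn.comp_const_mul dT (mul_ne_zero h0 h1)))
    (fun y hy => by
      simp only [mul_left_comm _ q y]
      rw [thetaJ_mul_left hq0 hq (mul_ne_zero h0 hy), thetaJ_mul_left hq0 hq (mul_ne_zero h1 hy),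
        appellA_mul_left hq0 hq (mul_ne_zero h0 hy) h0 hu0,
        appellA_mul_left hq0 hq (mul_ne_zero h1 hy) h1 hu1]
      field_simp
      ring)
    (fun y hy => by
      simp only [mul_left_comm _ q y]
      rw [thetaJ_mul_left hq0 hq (mul_ne_zero (mul_ne_zero h0 h1) hy)]
      field_simp)
    hy (inv_ne_zero h0)
  rw [mul_inv_cancel₀ h0, thetaJ_one hq, appellA_one hq0 hq h0 hu0, zero_mul, zero_sub,
    mul_comm u₀ u₁, mul_assoc u₁ u₀ u₀⁻¹, mul_inv_cancel₀ h0, mul_one, ← div_eq_mul_inv] at key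
  rw [mul_comm u₀ u₁, eq_div_iff (mul_ne_zero hj0 hj1)]
  generalize appellA u₁ q (u₁ * y) = A₁ at *
  generalize appellA u₀ q (u₀ * y) = A₀ at *
  generalize thetaJ (u₁ * y) q = T₁ at *
  generalize thetaJ (u₀ * y) q = T₀ at *
  generalize thetaJ (u₁ * u₀ * y) q = T₂ at *
  field_simp at key
  linear_combination key

/-! ### The universal mock theta function as a combination of Appell–Lerch sums -/

/-- Watson's series is a combination of three numerators of Appell–Lerch sums: multiply numerator and
denominator of each term by `1 + q ^ n x + (q ^ n x) ^ 2`. -/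
lemma tsum_watsonTerm (hq0 : q ≠ 0) (hq : ‖q‖ < 1) {x : ℂ} (hx0 : x ≠ 0)
    (hx : NotPower (x ^ 3) (q ^ 3)) :
    ∑' r, watsonTerm x q r = -(q * appellA (x ^ 3) (q ^ 3) q⁻¹ + x * appellA (x ^ 3) (q ^ 3) 1 +
      x ^ 2 * q⁻¹ * appellA (x ^ 3) (q ^ 3) q) := by
  have hq3 : ‖q ^ 3‖ < 1 := by rw [norm_pow]; exact pow_lt_one₀ (norm_nonneg _) hq (by norm_num)
  have hq30 : q ^ 3 ≠ 0 := pow_ne_zero _ hq0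
  have hx3 : x ^ 3 ≠ 0 := pow_ne_zero _ hx0
  have a0 := (hasSum_appellA hq30 hq3 (inv_ne_zero hq0) hx3 hx).mul_left q
  have a1 := (hasSum_appellA hq30 hq3 one_ne_zero hx3 hx).mul_left x
  have a2 := (hasSum_appellA hq30 hq3 hq0 hx3 hx).mul_left (x ^ 2 * q⁻¹)
  have h := ((Equiv.addRight (1 : ℤ)).hasSum_iff.2 ((a0.add a1).add a2)).neg
  refine (hasSum_of_eq h (fun r => ?_) rfl).tsum_eq
  simp only [Function.comp, Equiv.coe_addRight, add_sub_cancel_right, watsonTerm, one_zpow]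
  have hr : q ^ r ≠ 0 := zpow_ne_zero _ hq0
  have e0 : (q ^ 3) ^ r = (q ^ r) ^ 3 := by
    rw [← zpow_natCast, ← zpow_natCast, ← zpow_mul, ← zpow_mul, mul_comm]
  have hd3 : 1 - (q ^ r) ^ 3 * x ^ 3 ≠ 0 := by
    rw [← e0]; exact sub_ne_zero.2 (hx.zpow_mul_ne r).symm
  have hfac : 1 - (q ^ r) ^ 3 * x ^ 3 =
      (1 - q ^ r * x) * (1 + q ^ r * x + (q ^ r * x) ^ 2) := by ring
  have hd1 : 1 - q ^ r * x ≠ 0 := fun h => hd3 (by rw [hfac, h, zero_mul])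
  have hd2 : 1 + q ^ r * x + (q ^ r * x) ^ 2 ≠ 0 := fun h => hd3 (by rw [hfac, h, mul_zero])
  have e1 : (q ^ 3) ^ ((r + 1) * r / 2) = q ^ (r * (r - 1) / 2) * q ^ (r * r) * (q ^ r) ^ 2 := by
    have h1 := two_mul_choose r
    have h2 := two_mul_choose (r + 1)
    simp only [add_sub_cancel_right] at h2
    rw [← zpow_natCast, ← zpow_natCast, ← zpow_mul, ← zpow_mul, ← zpow_add₀ hq0, ← zpow_add₀ hq0]
    congr 1
    push_cast
    nlinarith
  rw [e0, e1, zpow_add_one₀ (by norm_num : (-1 : ℂ) ≠ 0), zpow_add_one₀ (inv_ne_zero hq0),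
    zpow_add_one₀ hq0, inv_zpow, hfac]
  generalize q ^ r = Y at *
  rw [mul_pow] at hd2 ⊢
  field_simp
  ring

lemma thetaJ_inv_mul_left (hq0 : q ≠ 0) (hq : ‖q‖ < 1) {x : ℂ} (hx : x ≠ 0) :
    thetaJ (q⁻¹ * x) q = -(q⁻¹ * x) * thetaJ x q := by
  have h := thetaJ_mul_left hq0 hq (mul_ne_zero (inv_ne_zero hq0) hx)
  rw [mul_inv_cancel_left₀ hq0] at h
  rw [h]
  field_simp

/-- A theta identity of degree three: in `w` both sides are holomorphic with the same
quasi-period under `w ↦ q w`, which permutes the summands on the left, and two of the summands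
vanish at `w = 1 / (q x ^ 3)`. -/
lemma thetaJ_cubic (hq0 : q ≠ 0) (hq : ‖q‖ < 1) {x w : ℂ} (hx0 : x ≠ 0) (hw : w ≠ 0)
    (hx : NotPower x q) :
    thetaJ (q * w) (q ^ 3) * thetaJ (x ^ 3 * w) (q ^ 3) * thetaJ (x ^ 3 * q⁻¹ * w) (q ^ 3) +
      x * thetaJ w (q ^ 3) * thetaJ (x ^ 3 * q * w) (q ^ 3) * thetaJ (x ^ 3 * q⁻¹ * w) (q ^ 3) +
      x ^ 2 * thetaJ (q⁻¹ * w) (q ^ 3) * thetaJ (x ^ 3 * q * w) (q ^ 3) *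
        thetaJ (x ^ 3 * w) (q ^ 3) =
    -(qPochInf q q ^ 2 * (x ^ 2 * w / q) * thetaJ (x ^ 3) (q ^ 3) * thetaJ (x ^ 2 * w) q /
      thetaJ x q) := by
  have hq3 : ‖q ^ 3‖ < 1 := by rw [norm_pow]; exact pow_lt_one₀ (norm_nonneg _) hq (by norm_num)
  have hq30 : q ^ 3 ≠ 0 := pow_ne_zero _ hq0
  have hx3 : x ^ 3 ≠ 0 := pow_ne_zero _ hx0
  have hqi := inv_ne_zero hq0
  have dT := differentiableOn_thetaJ hq30 hq3
  have wrap : ∀ k y : ℂ, k ≠ 0 → y ≠ 0 → thetaJ (k * (q * (q * y))) (q ^ 3) =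
      -(k * (q⁻¹ * y))⁻¹ * thetaJ (k * (q⁻¹ * y)) (q ^ 3) := fun k y hk hy => by
    rw [← thetaJ_mul_left hq30 hq3 (mul_ne_zero hk (mul_ne_zero hqi hy))]
    congr 1
    field_simp
  have key := mul_eq_mul_of_quasiPeriodic (c := -(q / x ^ 2)) hq0
    (neg_ne_zero.2 (div_ne_zero hq0 (pow_ne_zero _ hx0)))
    (L := fun w => thetaJ (q * w) (q ^ 3) * thetaJ (x ^ 3 * w) (q ^ 3) *
          thetaJ (x ^ 3 * q⁻¹ * w) (q ^ 3) +
      x * thetaJ w (q ^ 3) * thetaJ (x ^ 3 * q * w) (q ^ 3) * thetaJ (x ^ 3 * q⁻¹ * w) (q ^ 3) +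
      x ^ 2 * thetaJ (q⁻¹ * w) (q ^ 3) * thetaJ (x ^ 3 * q * w) (q ^ 3) *
        thetaJ (x ^ 3 * w) (q ^ 3))
    (T := fun w => thetaJ (x ^ 2 * q⁻¹ * w) q)
    (((((DifferentiableOn.comp_const_mul dT hq0).mul
          (DifferentiableOn.comp_const_mul dT hx3)).mul
          (DifferentiableOn.comp_const_mul dT (mul_ne_zero hx3 hqi))).add
        (((dT.const_mul x).mul (DifferentiableOn.comp_const_mul dT (mul_ne_zero hx3 hq0))).mul
          (DifferentiableOn.comp_const_mul dT (mul_ne_zero hx3 hqi)))).add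
        ((((DifferentiableOn.comp_const_mul dT hqi).const_mul (x ^ 2)).mul
          (DifferentiableOn.comp_const_mul dT (mul_ne_zero hx3 hq0))).mul
          (DifferentiableOn.comp_const_mul dT hx3)))
    (DifferentiableOn.comp_const_mul (differentiableOn_thetaJ hq0 hq)
      (mul_ne_zero (pow_ne_zero _ hx0) hqi))
    (fun y hy => by
      have e1 := wrap 1 y one_ne_zero hy
      have e2 := wrap (x ^ 3) y hx3 hy
      simp only [one_mul, mul_assoc, inv_mul_cancel_left₀ hq0] at e1 e2 ⊢
      rw [e1, e2]
      field_simp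
      ring)
    (fun y hy => by
      have h := thetaJ_mul_left hq0 hq (mul_ne_zero (mul_ne_zero (pow_ne_zero 2 hx0) hqi) hy)
      simp only [mul_left_comm _ q y]
      rw [h]
      field_simp)
    hw (inv_ne_zero (mul_ne_zero hx3 hq0))
  have f1 : thetaJ (x ^ 3 * q * (x ^ 3 * q)⁻¹) (q ^ 3) = 0 := by
    rw [mul_inv_cancel₀ (mul_ne_zero hx3 hq0)]; exact thetaJ_one hq3
  have f2 : thetaJ (q * (x ^ 3 * q)⁻¹) (q ^ 3) = -(x ^ 3)⁻¹ * thetaJ (x ^ 3) (q ^ 3) := by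
    rw [← thetaJ_inv hq3 hx3]
    congr 1
    field_simp
  have f3 : thetaJ (x ^ 3 * (x ^ 3 * q)⁻¹) (q ^ 3) = -q⁻¹ * qPochInf q q := by
    rw [← thetaJ_self_cube hq, ← thetaJ_inv hq3 hq0]
    congr 1
    field_simp
  have f4 : thetaJ (x ^ 3 * q⁻¹ * (x ^ 3 * q)⁻¹) (q ^ 3) = -(q ^ 2)⁻¹ * qPochInf q q := by
    rw [← thetaJ_self_cube hq, ← thetaJ_div_eq (x := q) hq30, show q ^ 3 / q = q ^ 2 by field_simp,
      ← thetaJ_inv hq3 (pow_ne_zero 2 hq0)]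
    congr 1
    field_simp
  have f5 : thetaJ (x ^ 2 * q⁻¹ * (x ^ 3 * q)⁻¹) q = -(q ^ 3 * x ^ 3)⁻¹ * thetaJ x q := by
    have : x ^ 2 * q⁻¹ * (x ^ 3 * q)⁻¹ = q⁻¹ * (q⁻¹ * x⁻¹) := by field_simp
    rw [this, thetaJ_inv_mul_left hq0 hq (mul_ne_zero hqi (inv_ne_zero hx0)),
      thetaJ_inv_mul_left hq0 hq (inv_ne_zero hx0), thetaJ_inv hq hx0]
    field_simp
  have f6 : thetaJ (x ^ 2 * q⁻¹ * w) q = -(x ^ 2 * w / q) * thetaJ (x ^ 2 * w) q := by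
    have : x ^ 2 * q⁻¹ * w = q⁻¹ * (x ^ 2 * w) := by ring
    rw [this, thetaJ_inv_mul_left hq0 hq (mul_ne_zero (pow_ne_zero _ hx0) hw)]
    congr 1
    ring
  rw [f1, f2, f3, f4, f5, f6] at key
  have hj := thetaJ_ne_zero hq hx
  rw [← neg_div, eq_div_iff hj]
  have hc : -(q ^ 3 * x ^ 3)⁻¹ ≠ 0 := neg_ne_zero.2 (inv_ne_zero (mul_ne_zero hq30 hx3))
  apply mul_left_cancel₀ hc
  rw [mul_left_comm, key]
  field_simp
  ring

lemma NotPower.pow_base {x : ℂ} (h : NotPower x q) (n : ℕ) : NotPower x (q ^ n) := fun k hk =>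
  h (n * k) (by rw [hk, zpow_mul, zpow_natCast])

lemma notPower_mul_iff (hq0 : q ≠ 0) {x : ℂ} : NotPower (q * x) q ↔ NotPower x q := by
  simpa using notPower_zpow_mul_iff (x := x) hq0 1

lemma notPower_inv_mul_iff (hq0 : q ≠ 0) {x : ℂ} : NotPower (q⁻¹ * x) q ↔ NotPower x q := by
  simpa using notPower_zpow_mul_iff (x := x) hq0 (-1)

/-- The theta quotient that separates `mockH` from a combination of Appell–Lerch sums. -/
noncomputable def mockTheta (x q w : ℂ) : ℂ :=
  x ^ 2 * w / q * (qPochInf (q ^ 3) (q ^ 3) ^ 3 * qPochInf q q * thetaJ (x ^ 2 * w) q) /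
    (thetaJ w (q ^ 3) * thetaJ (x ^ 3 * q * w) (q ^ 3) * thetaJ (x ^ 3 * q⁻¹ * w) (q ^ 3) *
      thetaJ x q)

lemma watson_eq_of_generic (hq0 : q ≠ 0) (hq : ‖q‖ < 1) {x w : ℂ} (hx0 : x ≠ 0) (hw0 : w ≠ 0)
    (hx : NotPower x q) (hx3 : NotPower (x ^ 3) (q ^ 3)) (hw : NotPower w q)
    (hxw : NotPower (x ^ 3 * w) q) :
    ∑' r, watsonTerm x q r = qPochInf q q * ((thetaJ w (q ^ 3))⁻¹ *
      (appellA (x ^ 3 * q * w) (q ^ 3) w - x ^ 2 * q⁻¹ * appellA (x ^ 3 * q⁻¹ * w) (q ^ 3) w) -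
      mockTheta x q w) := by
  have hq3 : ‖q ^ 3‖ < 1 := by rw [norm_pow]; exact pow_lt_one₀ (norm_nonneg _) hq (by norm_num)
  have hq30 : q ^ 3 ≠ 0 := pow_ne_zero _ hq0
  have hx30 : x ^ 3 ≠ 0 := pow_ne_zero _ hx0
  have hqi := inv_ne_zero hq0
  have n0 : NotPower (x ^ 3 * q * w) (q ^ 3) := by
    refine NotPower.pow_base ?_ 3
    rwa [show x ^ 3 * q * w = q * (x ^ 3 * w) by ring, notPower_mul_iff hq0]
  have n1 : NotPower (x ^ 3 * w) (q ^ 3) := hxw.pow_base 3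
  have n2 : NotPower (x ^ 3 * q⁻¹ * w) (q ^ 3) := by
    refine NotPower.pow_base ?_ 3
    rwa [show x ^ 3 * q⁻¹ * w = q⁻¹ * (x ^ 3 * w) by ring, notPower_inv_mul_iff hq0]
  have c0 := appellA_cross hq30 hq3 (y := (q * x ^ 3)⁻¹) (inv_ne_zero (mul_ne_zero hq0 hx30))
    (mul_ne_zero (mul_ne_zero hx30 hq0) hw0) hx30 n0 hx3
  have c1 := appellA_cross hq30 hq3 (y := (x ^ 3)⁻¹) (inv_ne_zero hx30)
    (mul_ne_zero hx30 hw0) hx30 n1 hx3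
  have c2 := appellA_cross hq30 hq3 (y := (q⁻¹ * x ^ 3)⁻¹) (inv_ne_zero (mul_ne_zero hqi hx30))
    (mul_ne_zero (mul_ne_zero hx30 hqi) hw0) hx30 n2 hx3
  rw [show x ^ 3 * q * w * (q * x ^ 3)⁻¹ = w by field_simp,
    show x ^ 3 * (q * x ^ 3)⁻¹ = q⁻¹ by field_simp,
    show x ^ 3 / (x ^ 3 * q * w) = (q * w)⁻¹ by field_simp,
    show x ^ 3 * q * w * x ^ 3 * (q * x ^ 3)⁻¹ = x ^ 3 * w by field_simp,
    thetaJ_inv hq3 hq0, thetaJ_inv hq3 (mul_ne_zero hq0 hw0), thetaJ_self_cube hq] at c0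
  rw [show x ^ 3 * w * (x ^ 3)⁻¹ = w by field_simp,
    show x ^ 3 * (x ^ 3)⁻¹ = 1 by field_simp,
    show x ^ 3 / (x ^ 3 * w) = w⁻¹ by field_simp,
    show x ^ 3 * w * x ^ 3 * (x ^ 3)⁻¹ = x ^ 3 * w by field_simp,
    thetaJ_one hq3, thetaJ_inv hq3 hw0] at c1
  rw [show x ^ 3 * q⁻¹ * w * (q⁻¹ * x ^ 3)⁻¹ = w by field_simp,
    show x ^ 3 * (q⁻¹ * x ^ 3)⁻¹ = q by field_simp,
    show x ^ 3 / (x ^ 3 * q⁻¹ * w) = (q⁻¹ * w)⁻¹ by field_simp,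
    show x ^ 3 * q⁻¹ * w * x ^ 3 * (q⁻¹ * x ^ 3)⁻¹ = x ^ 3 * w by field_simp,
    thetaJ_self_cube hq, thetaJ_inv hq3 (mul_ne_zero hqi hw0)] at c2
  have hK := thetaJ_cubic hq0 hq hx0 hw0 hx
  rw [tsum_watsonTerm hq0 hq hx0 hx3, mockTheta]
  have jw := thetaJ_ne_zero hq3 (hw.pow_base 3)
  have j0 := thetaJ_ne_zero hq3 n0
  have j1 := thetaJ_ne_zero hq3 n1
  have j2 := thetaJ_ne_zero hq3 n2
  have jx := thetaJ_ne_zero hq hx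
  have jx3 := thetaJ_ne_zero hq3 hx3
  generalize thetaJ (x ^ 3 * q * w) (q ^ 3) = s₀ at *
  generalize thetaJ (x ^ 3 * w) (q ^ 3) = s₁ at *
  generalize thetaJ (x ^ 3 * q⁻¹ * w) (q ^ 3) = s₂ at *
  generalize thetaJ (q * w) (q ^ 3) = t₀ at *
  generalize thetaJ (q⁻¹ * w) (q ^ 3) = t₂ at *
  generalize thetaJ w (q ^ 3) = t₁ at *
  generalize thetaJ (x ^ 3) (q ^ 3) = X at *
  generalize thetaJ (x ^ 2 * w) q = V at *
  generalize thetaJ x q = Y at *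
  generalize appellA (x ^ 3 * q * w) (q ^ 3) w = B₀ at *
  generalize appellA (x ^ 3 * w) (q ^ 3) w = B₁ at *
  generalize appellA (x ^ 3 * q⁻¹ * w) (q ^ 3) w = B₂ at *
  generalize appellA (x ^ 3) (q ^ 3) q⁻¹ = A₀ at *
  generalize appellA (x ^ 3) (q ^ 3) 1 = A₁ at *
  generalize appellA (x ^ 3) (q ^ 3) q = A₂ at *
  generalize qPochInf (q ^ 3) (q ^ 3) = E at *
  generalize qPochInf q q = J at *
  have hV : J ^ 2 * (x ^ 2 * w / q) * V / Y =
      -(t₀ * s₁ * s₂ + x * t₁ * s₀ * s₂ + x ^ 2 * t₂ * s₀ * s₁) / X := by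
    rw [hK]; field_simp
  have hTh : J * (x ^ 2 * w / q * (E ^ 3 * J * V) / (t₁ * s₀ * s₂ * Y)) =
      E ^ 3 / (t₁ * s₀ * s₂) * (-(t₀ * s₁ * s₂ + x * t₁ * s₀ * s₂ + x ^ 2 * t₂ * s₀ * s₁) / X) := by
    rw [← hV]; field_simp
  have d0 : A₀ = (-q⁻¹ * J * B₀ + w * E ^ 3 * (-(q * w)⁻¹ * t₀) * s₁ / (s₀ * X)) / t₁ := by
    rw [eq_div_iff jw]
    linear_combination (norm := (field_simp; ring)) c0
  have d1 : A₁ = w * E ^ 3 * (-w⁻¹ * t₁) * s₁ / (s₁ * X) / t₁ := by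
    rw [eq_div_iff jw]
    linear_combination (norm := (field_simp; ring)) c1
  have d2 : A₂ = (J * B₂ + w * E ^ 3 * (-(q⁻¹ * w)⁻¹ * t₂) * s₁ / (s₂ * X)) / t₁ := by
    rw [eq_div_iff jw]
    linear_combination (norm := (field_simp; ring)) c2
  rw [mul_sub, hTh, d0, d1, d2]
  field_simp
  ring

lemma continuousAt_thetaJ (hq0 : q ≠ 0) (hq : ‖q‖ < 1) {z : ℂ} (hz : z ≠ 0) :
    ContinuousAt (fun z => thetaJ z q) z :=
  (differentiableOn_thetaJ hq0 hq).continuousOn.continuousAt (isOpen_compl_singleton.mem_nhds hz)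

lemma continuousAt_inv_one_sub {u : ℂ} (hu : NotPower u q) (r : ℤ) :
    ContinuousAt (fun u => (1 - q ^ r * u)⁻¹) u :=
  ContinuousAt.inv₀ (by fun_prop) (sub_ne_zero.2 (hu.zpow_mul_ne r).symm)

lemma continuousAt_appellA (hq0 : q ≠ 0) (hq : ‖q‖ < 1) {u z : ℂ} (hz : z ≠ 0) (hu0 : u ≠ 0)
    (hu : NotPower u q) : ContinuousAt (fun u => appellA u q z) u := by
  obtain ⟨C, hC0, hC⟩ := exists_norm_inv_le hq0 hq hu0 hu
  refine tendsto_tsum_of_dominated_convergence ((summable_norm_theta hq0 hq hz).mul_right C)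
    (fun r => ?_) ?_
  · exact (continuousAt_inv_one_sub hu (r - 1)).const_mul _
  · filter_upwards [hC] with v hv r
    rw [norm_mul]
    exact mul_le_mul_of_nonneg_left (hv (r - 1)) (norm_nonneg _)

lemma norm_zpow_mul_self_le (hq : ‖q‖ < 1) (r : ℤ) : ‖q ^ (r * r)‖ ≤ 1 := by
  obtain ⟨n, hn⟩ := Int.eq_ofNat_of_zero_le (mul_self_nonneg r)
  rw [hn, zpow_natCast, norm_pow]
  exact pow_le_one₀ (norm_nonneg _) hq.le

lemma continuousAt_tsum_watsonTerm (hq0 : q ≠ 0) (hq : ‖q‖ < 1) {x : ℂ} (hx0 : x ≠ 0)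
    (hx : NotPower x q) : ContinuousAt (fun x => ∑' r, watsonTerm x q r) x := by
  obtain ⟨C, hC0, hC⟩ := exists_norm_inv_le hq0 hq hx0 hx
  refine tendsto_tsum_of_dominated_convergence ((summable_norm_theta hq0 hq hq0).mul_right C)
    (fun r => ?_) ?_
  · exact ((continuousAt_inv_one_sub hx r).const_mul _).mul_const _
  · filter_upwards [hC] with v hv r
    rw [watsonTerm, norm_mul, norm_mul]
    refine (mul_le_of_le_one_right (by positivity) (norm_zpow_mul_self_le hq r)).trans ?_
    exact mul_le_mul_of_nonneg_left (hv r) (norm_nonneg _)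

lemma eventually_notPower_mul (hq0 : q ≠ 0) (hq : ‖q‖ < 1) (y : ℂ) :
    ∀ᶠ t : ℝ in 𝓝[>] 1, NotPower ((t : ℂ) * y) q := by
  rcases eq_or_ne y 0 with rfl | hy
  · refine Eventually.of_forall fun t k hk => zpow_ne_zero k hq0 ?_
    rw [← hk, mul_zero]
  have h1 : 1 < ‖q‖⁻¹ := (one_lt_inv₀ (norm_pos_iff.2 hq0)).2 hq
  have hy0 : 0 < ‖y‖ := norm_pos_iff.2 hy
  obtain ⟨n, hn1, hn2⟩ := exists_mem_Ico_zpow hy0 h1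
  have h2 : 1 < (‖q‖⁻¹) ^ (n + 1) / ‖y‖ := (one_lt_div hy0).2 hn2
  filter_upwards [Ioo_mem_nhdsGT h2] with t ht l hl
  have ht0 : 0 < t := zero_lt_one.trans ht.1
  have e : t * ‖y‖ = ‖q‖⁻¹ ^ (-l) := by
    rw [inv_zpow, zpow_neg, inv_inv, ← norm_zpow, ← hl, norm_mul, Complex.norm_real,
      Real.norm_of_nonneg ht0.le]
  have e1 : ‖q‖⁻¹ ^ n < ‖q‖⁻¹ ^ (-l) := by
    rw [← e]
    nlinarith [ht.1]
  have e2 : ‖q‖⁻¹ ^ (-l) < ‖q‖⁻¹ ^ (n + 1) := by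
    rw [← e]
    exact (lt_div_iff₀ hy0).1 ht.2
  rw [zpow_lt_zpow_iff_right₀ h1] at e1 e2
  omega

/-- The universal mock theta function as a combination of two Appell–Lerch sums and a theta
quotient.  If `x ^ 3` is a power of `q ^ 3` this follows by continuity in `x`. -/
lemma mockH_eq (hq0 : q ≠ 0) (hq : ‖q‖ < 1) {x w : ℂ} (hx0 : x ≠ 0) (hw0 : w ≠ 0)
    (hx : NotPower x q) (hw : NotPower w q) (hxw : NotPower (x ^ 3 * w) q) :
    mockH x q = appellM (q * x ^ 3) (q ^ 3) w - x ^ 2 * q⁻¹ * appellM (q⁻¹ * x ^ 3) (q ^ 3) w -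
      mockTheta x q w := by
  have hJ := qPochInf_self_ne_zero hq
  suffices h : ∑' r, watsonTerm x q r = qPochInf q q * ((thetaJ w (q ^ 3))⁻¹ *
      (appellA (x ^ 3 * q * w) (q ^ 3) w - x ^ 2 * q⁻¹ * appellA (x ^ 3 * q⁻¹ * w) (q ^ 3) w) -
      mockTheta x q w) by
    apply mul_left_cancel₀ hJ
    rw [← (hasSum_watson hq0 hq hx0 hx).tsum_eq, h, appellM_eq, appellM_eq, mul_comm q (x ^ 3),
      mul_comm q⁻¹ (x ^ 3)]
    ring
  have hq3 : ‖q ^ 3‖ < 1 := by rw [norm_pow]; exact pow_lt_one₀ (norm_nonneg _) hq (by norm_num)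
  have hq30 : q ^ 3 ≠ 0 := pow_ne_zero _ hq0
  have hx30 : x ^ 3 ≠ 0 := pow_ne_zero _ hx0
  have hqi := inv_ne_zero hq0
  have n0 : NotPower (x ^ 3 * q * w) (q ^ 3) := by
    refine NotPower.pow_base ?_ 3
    rwa [show x ^ 3 * q * w = q * (x ^ 3 * w) by ring, notPower_mul_iff hq0]
  have n2 : NotPower (x ^ 3 * q⁻¹ * w) (q ^ 3) := by
    refine NotPower.pow_base ?_ 3
    rwa [show x ^ 3 * q⁻¹ * w = q⁻¹ * (x ^ 3 * w) by ring, notPower_inv_mul_iff hq0]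
  have z0 : x ^ 3 * q * w ≠ 0 := mul_ne_zero (mul_ne_zero hx30 hq0) hw0
  have z2 : x ^ 3 * q⁻¹ * w ≠ 0 := mul_ne_zero (mul_ne_zero hx30 hqi) hw0
  have jw := thetaJ_ne_zero hq3 (hw.pow_base 3)
  have j0 := thetaJ_ne_zero hq3 n0
  have j2 := thetaJ_ne_zero hq3 n2
  have jx := thetaJ_ne_zero hq hx
  have A0 : ContinuousAt (fun x => appellA (x ^ 3 * q * w) (q ^ 3) w) x :=
    ContinuousAt.comp (f := fun x => x ^ 3 * q * w) (g := fun u => appellA u (q ^ 3) w)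
      (continuousAt_appellA hq30 hq3 hw0 z0 n0) (by fun_prop)
  have A2 : ContinuousAt (fun x => appellA (x ^ 3 * q⁻¹ * w) (q ^ 3) w) x :=
    ContinuousAt.comp (f := fun x => x ^ 3 * q⁻¹ * w) (g := fun u => appellA u (q ^ 3) w)
      (continuousAt_appellA hq30 hq3 hw0 z2 n2) (by fun_prop)
  have T0 : ContinuousAt (fun x => thetaJ (x ^ 3 * q * w) (q ^ 3)) x :=
    ContinuousAt.comp (f := fun x => x ^ 3 * q * w) (g := fun u => thetaJ u (q ^ 3))
      (continuousAt_thetaJ hq30 hq3 z0) (by fun_prop)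
  have T2 : ContinuousAt (fun x => thetaJ (x ^ 3 * q⁻¹ * w) (q ^ 3)) x :=
    ContinuousAt.comp (f := fun x => x ^ 3 * q⁻¹ * w) (g := fun u => thetaJ u (q ^ 3))
      (continuousAt_thetaJ hq30 hq3 z2) (by fun_prop)
  have Tv : ContinuousAt (fun x => thetaJ (x ^ 2 * w) q) x :=
    ContinuousAt.comp (f := fun x => x ^ 2 * w) (g := fun u => thetaJ u q)
      (continuousAt_thetaJ hq0 hq (mul_ne_zero (pow_ne_zero _ hx0) hw0)) (by fun_prop)
  have Tx := continuousAt_thetaJ hq0 hq hx0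
  have hsq : ContinuousAt (fun x : ℂ => x ^ 2) x := by fun_prop
  have R : ContinuousAt (fun x => qPochInf q q * ((thetaJ w (q ^ 3))⁻¹ *
      (appellA (x ^ 3 * q * w) (q ^ 3) w - x ^ 2 * q⁻¹ * appellA (x ^ 3 * q⁻¹ * w) (q ^ 3) w) -
      mockTheta x q w)) x := by
    unfold mockTheta
    refine ContinuousAt.const_mul (ContinuousAt.sub (ContinuousAt.const_mul
      (A0.sub ((hsq.mul_const _).mul A2)) _) (ContinuousAt.div ?_ ?_ ?_)) _
    · exact ((hsq.mul_const _).div_const _).mul (Tv.const_mul _)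
    · exact ((T0.const_mul _).mul T2).mul Tx
    · exact mul_ne_zero (mul_ne_zero (mul_ne_zero jw j0) j2) jx
  have hL := continuousAt_tsum_watsonTerm hq0 hq hx0 hx
  -- Move `x` slightly away from the origin, along its ray.
  have ht : Tendsto (fun t : ℝ => (t : ℂ) * x) (𝓝[>] 1) (𝓝 x) := by
    have : Tendsto (fun t : ℝ => (t : ℂ) * x) (𝓝 1) (𝓝 (((1 : ℝ) : ℂ) * x)) :=
      Continuous.tendsto (by fun_prop) 1
    rw [Complex.ofReal_one, one_mul] at this
    exact this.mono_left nhdsWithin_le_nhds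
  refine tendsto_nhds_unique (hL.tendsto.comp ht) ((R.tendsto.comp ht).congr' ?_)
  have hpow : ∀ n : ℕ, Tendsto (fun t : ℝ => t ^ (n + 1)) (𝓝[>] 1) (𝓝[>] 1) := fun n => by
    refine tendsto_nhdsWithin_iff.2 ⟨?_, ?_⟩
    · have : Tendsto (fun t : ℝ => t ^ (n + 1)) (𝓝 1) (𝓝 (1 ^ (n + 1))) :=
        Continuous.tendsto (by fun_prop) 1
      rw [one_pow] at this
      exact this.mono_left nhdsWithin_le_nhds
    · filter_upwards [self_mem_nhdsWithin] with t ht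
      exact one_lt_pow₀ (Set.mem_Ioi.1 ht) (Nat.succ_ne_zero n)
  filter_upwards [self_mem_nhdsWithin, eventually_notPower_mul hq0 hq x,
    (hpow 2).eventually (eventually_notPower_mul hq30 hq3 (x ^ 3)),
    (hpow 2).eventually (eventually_notPower_mul hq0 hq (x ^ 3 * w))] with t ht1 h1 h2 h3
  have ht0 : (t : ℂ) ≠ 0 := by
    have : (0 : ℝ) < t := zero_lt_one.trans ht1
    exact_mod_cast this.ne'
  refine (watson_eq_of_generic hq0 hq (mul_ne_zero ht0 hx0) hw0 h1 ?_ hw ?_).symm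
  · rw [mul_pow]; exact_mod_cast h2
  · rw [mul_pow, mul_assoc]; exact_mod_cast h3

lemma one_add_mul_mockG {x : ℂ} (hx0 : x ≠ 0) : 1 + x * mockG x q = mockH x q := by
  rw [mockG, mockH]
  field_simp
  ring

end appell

/-! ### Partitions and the rank generating function -/

section partitions

variable {q x : ℂ}

/-- Multisets of positive integers that are at most `k`: partitions with parts at most `k`. -/
abbrev BoundedParts (k : ℕ) : Type := {m : Multiset ℕ // ∀ i ∈ m, 0 < i ∧ i ≤ k}

/-- Multisets of positive integers: partitions of all natural numbers. -/
abbrev PosParts : Type := {m : Multiset ℕ // ∀ i ∈ m, 0 < i}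

/-- The weight of a partition that counts its parts by `x` and its size by `q`. -/
noncomputable def partsWeight (x q : ℂ) (m : Multiset ℕ) : ℂ := x ^ Multiset.card m * q ^ m.sum

/-- A partition with parts at most `k + 1` is a partition with parts at most `k` together with the
multiplicity of the part `k + 1`. -/
def boundedPartsEquiv (k : ℕ) : BoundedParts k × ℕ ≃ BoundedParts (k + 1) where
  toFun p := ⟨p.1.1 + Multiset.replicate p.2 (k + 1), fun i hi => by
    rcases Multiset.mem_add.1 hi with h | h
    · exact ⟨(p.1.2 i h).1, (p.1.2 i h).2.trans (Nat.le_succ k)⟩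
    · rw [Multiset.eq_of_mem_replicate h]
      exact ⟨Nat.succ_pos k, le_rfl⟩⟩
  invFun m := (⟨m.1.filter (· ≠ k + 1), fun i hi => by
    obtain ⟨h1, h2⟩ := Multiset.mem_filter.1 hi
    have := m.2 i h1
    omega⟩, m.1.count (k + 1))
  left_inv p := by
    rcases p with ⟨⟨m, hm⟩, j⟩
    have h1 : m.filter (· ≠ k + 1) = m := Multiset.filter_eq_self.2 fun i hi => by
      have := hm i hi
      omega
    have h2 : (Multiset.replicate j (k + 1)).filter (· ≠ k + 1) = 0 :=
      Multiset.filter_eq_nil.2 fun i hi h => h (Multiset.eq_of_mem_replicate hi)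
    have h3 : m.count (k + 1) = 0 := Multiset.count_eq_zero.2 fun h => by
      have := hm _ h
      omega
    refine Prod.ext (Subtype.ext ?_) ?_
    · simp only [Multiset.filter_add, h1, h2, add_zero]
    · simp only [Multiset.count_add, h3, Multiset.count_replicate_self, zero_add]
  right_inv m := by
    refine Subtype.ext ?_
    simp only
    rw [← Multiset.filter_eq', add_comm]
    exact Multiset.filter_add_not (· = k + 1) m.1

lemma partsWeight_boundedPartsEquiv (k : ℕ) (p : BoundedParts k × ℕ) :
    partsWeight x q (boundedPartsEquiv k p).1 = partsWeight x q p.1.1 * (x * q ^ (k + 1)) ^ p.2 := by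
  simp only [partsWeight, boundedPartsEquiv, Equiv.coe_fn_mk, Multiset.card_add,
    Multiset.card_replicate, Multiset.sum_add, Multiset.sum_replicate, smul_eq_mul]
  rw [pow_add, pow_add, mul_pow, ← pow_mul, mul_comm p.2]
  ring

lemma norm_mul_pow_lt_one (hq : ‖q‖ < 1) (hx : ‖x‖ ≤ 1) (k : ℕ) : ‖x * q ^ (k + 1)‖ < 1 := by
  rw [norm_mul, norm_pow]
  have h1 : ‖q‖ ^ (k + 1) < 1 := pow_lt_one₀ (norm_nonneg _) hq (Nat.succ_ne_zero k)
  have h2 : 0 ≤ ‖q‖ ^ (k + 1) := pow_nonneg (norm_nonneg _) _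
  nlinarith [norm_nonneg x]

lemma hasSum_partsWeight (hq : ‖q‖ < 1) (hx : ‖x‖ ≤ 1) (k : ℕ) :
    HasSum (fun m : BoundedParts k => partsWeight x q m.1) (qPoch (x * q) q k)⁻¹ := by
  induction k with
  | zero =>
    have : ∀ m : BoundedParts 0, m.1 = 0 := fun m =>
      Multiset.eq_zero_of_forall_notMem fun i hi => by have := m.2 i hi; omega
    have h := hasSum_single (f := fun m : BoundedParts 0 => partsWeight x q m.1)
      ⟨0, by simp⟩ fun m hm => absurd (Subtype.ext (this m)) hm
    simpa [partsWeight, qPoch] using h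
  | succ k ih =>
    have h1 := norm_mul_pow_lt_one hq hx k
    have h2 := hasSum_geometric_of_norm_lt_one h1
    have hs : Summable fun p : BoundedParts k × ℕ =>
        partsWeight x q p.1.1 * (x * q ^ (k + 1)) ^ p.2 :=
      summable_mul_of_summable_norm (f := fun m : BoundedParts k => partsWeight x q m.1)
        (summable_norm_iff.2 ih.summable) (summable_norm_iff.2 h2.summable)
    have h3 := ih.mul h2 hs
    refine (boundedPartsEquiv k).hasSum_iff.1 (hasSum_of_eq h3 (fun p => ?_) ?_)
    · exact (partsWeight_boundedPartsEquiv k p).symm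
    · rw [qPoch_succ, mul_inv]
      congr 3
      ring

/-- The summand `x ^ (number of parts - largest part) q ^ size` of the rank generating function. -/
noncomputable def rankWeight (x q : ℂ) (m : Multiset ℕ) : ℂ :=
  x ^ ((Multiset.card m : ℤ) - (m.sup : ℤ)) * q ^ m.sum

/-- Adjoining a largest part `k + 1`. -/
def consLargest (p : Σ k : ℕ, BoundedParts (k + 1)) : PosParts :=
  ⟨(p.1 + 1) ::ₘ p.2.1, fun i hi => by
    rcases Multiset.mem_cons.1 hi with rfl | h
    · exact Nat.succ_pos _
    · exact (p.2.2 i h).1⟩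

lemma sup_consLargest (p : Σ k : ℕ, BoundedParts (k + 1)) :
    (consLargest p).1.sup = p.1 + 1 := by
  rw [consLargest, Multiset.sup_cons, sup_eq_left]
  exact Multiset.sup_le.2 fun i hi => (p.2.2 i hi).2

lemma consLargest_injective : Function.Injective consLargest := by
  rintro ⟨k, m, hm⟩ ⟨l, n, hn⟩ h
  have h1 := sup_consLargest ⟨k, m, hm⟩
  rw [h, sup_consLargest] at h1
  simp only at h1
  obtain rfl : l = k := by omega
  have h2 : (l + 1) ::ₘ m = (l + 1) ::ₘ n := congrArg Subtype.val h
  rw [Multiset.cons_inj_right] at h2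
  subst h2
  rfl

lemma mem_range_consLargest (m : PosParts) (hm : m.1 ≠ 0) : m ∈ Set.range consLargest := by
  have hmem : m.1.sup ∈ m.1 := by
    obtain ⟨i, hi⟩ := Multiset.exists_mem_of_ne_zero hm
    have h1 : m.1.toFinset.Nonempty := ⟨i, Multiset.mem_toFinset.2 hi⟩
    have h2 : m.1.sup = m.1.toFinset.sup id := by
      refine le_antisymm (Multiset.sup_le.2 fun b hb => ?_) (Finset.sup_le fun b hb => ?_)
      · exact Finset.le_sup (f := id) (Multiset.mem_toFinset.2 hb)
      · exact Multiset.le_sup (Multiset.mem_toFinset.1 hb)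
    obtain ⟨b, hb, hb'⟩ := Finset.exists_mem_eq_sup _ h1 id
    rw [h2, hb']
    exact Multiset.mem_toFinset.1 hb
  have hpos := m.2 _ hmem
  have e : m.1.sup - 1 + 1 = m.1.sup := by omega
  refine ⟨⟨m.1.sup - 1, m.1.erase m.1.sup, fun i hi => ?_⟩, ?_⟩
  · have := Multiset.mem_of_mem_erase hi
    exact ⟨m.2 i this, by rw [e]; exact Multiset.le_sup this⟩
  · refine Subtype.ext ?_
    simp only [consLargest, e]
    exact Multiset.cons_erase hmem

lemma rankWeight_consLargest (hx : x ≠ 0) (p : Σ k : ℕ, BoundedParts (k + 1)) :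
    rankWeight x q (consLargest p).1 = q * (q / x) ^ p.1 * partsWeight x q p.2.1 := by
  rw [rankWeight, sup_consLargest]
  simp only [consLargest, Multiset.card_cons, Multiset.sum_cons, partsWeight]
  rw [show ((Multiset.card p.2.1 + 1 : ℕ) : ℤ) - ((p.1 + 1 : ℕ) : ℤ) =
    (Multiset.card p.2.1 : ℤ) - p.1 by push_cast; ring, zpow_sub₀ hx, zpow_natCast, zpow_natCast,
    div_pow, pow_add, pow_succ]
  field_simp

lemma hasSum_rankWeight (hq : ‖q‖ < 1) (hx : ‖x‖ = 1) :
    HasSum (fun m : PosParts => rankWeight x q m.1)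
      (1 + ∑' k : ℕ, q * (q / x) ^ k * (qPoch (x * q) q (k + 1))⁻¹) := by
  have hx0 : x ≠ 0 := norm_pos_iff.1 (by rw [hx]; exact one_pos)
  have hr : ‖((‖q‖ : ℝ) : ℂ)‖ < 1 := by simpa using hq
  have hnorm : ∀ m, ‖partsWeight x q m‖ = ‖partsWeight 1 ((‖q‖ : ℝ) : ℂ) m‖ := fun m => by
    simp [partsWeight, hx]
  have hreal : ∀ k, HasSum (fun m : BoundedParts k => ‖partsWeight x q m.1‖)
      ‖(qPoch (1 * ((‖q‖ : ℝ) : ℂ)) ((‖q‖ : ℝ) : ℂ) k)⁻¹‖ := fun k => by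
    have h1 := hasSum_partsWeight hr (x := 1) (by simp) k
    have hs : Summable fun m : BoundedParts k => ‖partsWeight x q m.1‖ := by
      simp only [hnorm]
      exact summable_norm_iff.2 h1.summable
    have h2 : ∀ m, partsWeight 1 ((‖q‖ : ℝ) : ℂ) m = ((‖partsWeight x q m‖ : ℝ) : ℂ) := fun m => by
      simp [partsWeight, hx]
    simp only [h2] at h1
    rw [h1.unique (Complex.hasSum_ofReal.2 hs.hasSum), Complex.norm_real,
      Real.norm_of_nonneg (tsum_nonneg fun _ => norm_nonneg _)]
    exact hs.hasSum
  have hsig : HasSum (fun p : Σ k : ℕ, BoundedParts (k + 1) => rankWeight x q (consLargest p).1)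
      (∑' k : ℕ, q * (q / x) ^ k * (qPoch (x * q) q (k + 1))⁻¹) := by
    simp only [rankWeight_consLargest hx0]
    have hs : Summable fun p : Σ k : ℕ, BoundedParts (k + 1) =>
        q * (q / x) ^ p.1 * partsWeight x q p.2.1 := by
      refine Summable.of_norm ((summable_sigma_of_nonneg fun _ => norm_nonneg _).2 ⟨fun k => ?_, ?_⟩)
      · simp only [norm_mul]
        exact ((hreal (k + 1)).summable).mul_left _
      · obtain ⟨C, hC0, hC⟩ := exists_norm_qPoch_inv_le hr (x := 1 * ((‖q‖ : ℝ) : ℂ)) fun i h => by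
          apply one_sub_pow_ne_zero hr i
          rw [← h]; ring
        refine Summable.of_nonneg_of_le (fun k => tsum_nonneg fun _ => norm_nonneg _) (fun k => ?_)
          (((summable_geometric_of_lt_one (norm_nonneg q) hq).mul_left ‖q‖).mul_right C)
        simp only [norm_mul, norm_pow, norm_div, hx, div_one]
        rw [tsum_mul_left, (hreal (k + 1)).tsum_eq]
        gcongr
        exact hC _
    have h := hs.hasSum.sigma fun k => ((hasSum_partsWeight hq hx.le (k + 1)).mul_left
      (q * (q / x) ^ k))
    rw [h.tsum_eq]
    exact hs.hasSum
  set z : PosParts := ⟨0, by simp⟩ with hz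
  have h0 : HasSum (Function.update (fun m : PosParts => rankWeight x q m.1) z 0)
      (∑' k : ℕ, q * (q / x) ^ k * (qPoch (x * q) q (k + 1))⁻¹) := by
    refine (consLargest_injective.hasSum_iff fun m hm => ?_).1 (hasSum_of_eq hsig (fun p => ?_) rfl)
    · by_cases h : m = z
      · rw [h, Function.update_self]
      · exact absurd (mem_range_consLargest m fun h' => h (Subtype.ext h')) hm
    · rw [Function.comp, Function.update_of_ne]
      intro h
      have := congrArg Subtype.val h
      simp [consLargest, hz] at this
  have h1 := h0.update z (rankWeight x q z.1)
  rw [Function.update_idem, Function.update_eq_self, Function.update_self] at h1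
  refine hasSum_of_eq h1 (fun _ => rfl) ?_
  simp [rankWeight, hz]

/-- The size and the parts of a partition. -/
def partitionEquiv : (Σ n : ℕ, n.Partition) ≃ PosParts where
  toFun p := ⟨p.2.parts, fun _ hi => p.2.parts_pos hi⟩
  invFun m := ⟨m.1.sum, ⟨m.1, fun hi => m.2 _ hi, rfl⟩⟩
  left_inv p := by
    rcases p with ⟨n, ⟨parts, hpos, rfl⟩⟩
    rfl
  right_inv m := rfl

/-- The rank generating function at a point of the unit circle. -/
lemma hasSum_rank (hq : ‖q‖ < 1) (hx : ‖x‖ = 1) :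
    HasSum (fun n : ℕ => (∑ π : n.Partition, x ^ (-rank π)) * q ^ n)
      (1 + ∑' k : ℕ, q * (q / x) ^ k * (qPoch (x * q) q (k + 1))⁻¹) := by
  have h := (partitionEquiv.hasSum_iff.2 (hasSum_rankWeight hq hx)).sigma
    fun n => hasSum_fintype _
  refine hasSum_of_eq h (fun n => ?_) rfl
  rw [Finset.sum_mul]
  refine Finset.sum_congr rfl fun π _ => ?_
  simp only [Function.comp, partitionEquiv, Equiv.coe_fn_mk, rankWeight, rank, π.parts_sum, neg_sub]

/-- `∑ q ^ (n ^ 2) / ((x q; q)_n (q / x; q)_n)`, which is visibly invariant under `x ↦ 1 / x`. -/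
noncomputable def rankSeries (x q : ℂ) : ℂ :=
  ∑' n : ℕ, q ^ (n ^ 2) / (qPoch (x * q) q n * qPoch (q / x) q n)

lemma rankSeries_inv (x q : ℂ) : rankSeries x⁻¹ q = rankSeries x q := by
  unfold rankSeries
  refine tsum_congr fun n => ?_
  rw [div_inv_eq_mul, mul_comm (qPoch _ _ _), mul_comm q x, div_eq_mul_inv q x, mul_comm q x⁻¹]

lemma rankSeries_eq (hx : x ≠ 1) : rankSeries x q = (1 - x) * mockH x q := by
  rw [rankSeries, mockH, ← tsum_mul_left]
  refine tsum_congr fun n => ?_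
  have : 1 - x ≠ 0 := sub_ne_zero.2 hx.symm
  rw [qPoch_succ']
  field_simp

/-- The sum over largest parts equals the sum over Durfee squares, by the Rogers–Fine identity. -/
lemma largestPart_eq_rankSeries (hq : ‖q‖ < 1) (hx : ‖x‖ = 1) :
    1 + ∑' k : ℕ, q * (q / x) ^ k * (qPoch (x * q) q (k + 1))⁻¹ = rankSeries x q := by
  have hx0 : x ≠ 0 := norm_pos_iff.1 (by rw [hx]; exact one_pos)
  have hβ0 : ∀ i : ℕ, q ^ i * (x * q) ≠ 1 := fun i h => by
    have h1 := norm_mul_pow_lt_one hq hx.le i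
    rw [pow_succ, show x * (q ^ i * q) = q ^ i * (x * q) by ring, h, norm_one] at h1
    exact lt_irrefl _ h1
  have hβ : ∀ i : ℕ, q ^ i * (x * q * q) ≠ 1 := fun i => by
    have := hβ0 (i + 1)
    rwa [pow_succ, mul_assoc, mul_comm q] at this
  have hτ : ‖q / x‖ < 1 := by rw [norm_div, hx, div_one]; exact hq
  have h1 := (hasSum_fine hq hβ hτ).mul_left (q / (1 - x * q))
  have hb : 1 - x * q ≠ 0 := sub_ne_zero.2 (by simpa using (hβ0 0).symm)
  have e1 : ∑' k : ℕ, q * (q / x) ^ k * (qPoch (x * q) q (k + 1))⁻¹ =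
      q / (1 - x * q) * ∑' k : ℕ, (q / x) ^ k * (qPoch (x * q * q) q k)⁻¹ := by
    rw [← tsum_mul_left]
    refine tsum_congr fun k => ?_
    rw [qPoch_succ', mul_inv]
    field_simp
  rw [rankSeries, e1]
  symm
  refine HasSum.tsum_eq ((hasSum_nat_add_iff' 1).1 (hasSum_of_eq h1 (fun n => ?_) ?_))
  · rw [qPoch_succ' (x * q)]
    have e2 : q * ((x * q * q * (q / x)) ^ n * q ^ (n * (n - 1))) = q ^ ((n + 1) ^ 2) := by
      rw [show x * q * q * (q / x) = q ^ 3 by field_simp, ← pow_mul, ← pow_add, ← pow_succ']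
      congr 1
      cases n with
      | zero => rfl
      | succ m => simp only [Nat.add_sub_cancel]; ring
    rw [← e2]
    field_simp
  · simp [qPoch]

lemma sum_zpow_primitiveRoot {N : ℕ} {η : ℂ} (hη : IsPrimitiveRoot η N) (k : ℤ) :
    ∑ j ∈ Finset.range N, (η ^ k) ^ j = if (N : ℤ) ∣ k then (N : ℂ) else 0 := by
  split_ifs with h
  · rw [(hη.zpow_eq_one_iff_dvd k).2 h]; simp
  · have hne : η ^ k ≠ 1 := fun h' => h ((hη.zpow_eq_one_iff_dvd k).1 h')
    rw [geom_sum_eq hne, ← zpow_natCast, ← zpow_mul, mul_comm, zpow_mul, zpow_natCast,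
      hη.pow_eq_one, one_zpow, sub_self, zero_div]

/-- The deviation as a combination of values of the rank generating function at the nontrivial
roots of unity of order dividing `M`. -/
lemma hasSum_deviationTerm (hq : ‖q‖ < 1) {M : ℕ} (hM : 0 < M) (a : ℕ) {ζ : ℂ}
    (hζ : IsPrimitiveRoot ζ M) :
    HasSum (deviationTerm a M q)
      ((M : ℂ)⁻¹ * ∑ j ∈ Finset.Ico 1 M, ζ ^ (j * a) * rankSeries (ζ ^ j) q) := by
  have hM0 : (M : ℂ) ≠ 0 := by exact_mod_cast hM.ne'
  have hζ1 : ‖ζ‖ = 1 := hζ.norm'_eq_one hM.ne'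
  have hζ0 : ζ ≠ 0 := hζ.ne_zero hM.ne'
  have h : HasSum (fun n => (M : ℂ)⁻¹ * ∑ j ∈ Finset.Ico 1 M, ζ ^ (j * a) *
      ((∑ π : n.Partition, (ζ ^ j) ^ (-rank π)) * q ^ n)) _ :=
    (hasSum_sum (s := Finset.Ico 1 M) fun j _ => (hasSum_of_eq (hasSum_rank hq
      (x := ζ ^ j) (by rw [norm_pow, hζ1, one_pow])) (fun _ => rfl)
      (largestPart_eq_rankSeries hq (by rw [norm_pow, hζ1, one_pow]))).mul_left
      (ζ ^ (j * a))).mul_left (M : ℂ)⁻¹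
  refine hasSum_of_eq h (fun n => ?_) rfl
  have hcount : (rankCount a M n : ℂ) =
      (M : ℂ)⁻¹ * ∑ j ∈ Finset.range M, ζ ^ (j * a) * ∑ π : n.Partition, (ζ ^ j) ^ (-rank π) := by
    simp only [Finset.mul_sum]
    rw [Finset.sum_comm, rankCount, Finset.card_filter]
    push_cast
    refine Finset.sum_congr rfl fun π _ => ?_
    rw [← Finset.mul_sum]
    have e : ∀ j : ℕ, ζ ^ (j * a) * (ζ ^ j) ^ (-rank π) = (ζ ^ ((a : ℤ) - rank π)) ^ j := fun j => by
      rw [← zpow_natCast, ← zpow_natCast, ← zpow_natCast, ← zpow_mul, ← zpow_mul, ← zpow_add₀ hζ0]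
      congr 1
      push_cast
      ring
    simp only [e]
    rw [sum_zpow_primitiveRoot hζ]
    by_cases hc : rank π ≡ (a : ℤ) [ZMOD (M : ℤ)]
    · rw [if_pos hc, if_pos (Int.modEq_iff_dvd.1 hc), inv_mul_cancel₀ hM0]
    · rw [if_neg hc, if_neg fun h' => hc (Int.modEq_iff_dvd.2 h'), mul_zero]
  have hp : (partitionCount n : ℂ) = ζ ^ (0 * a) * ∑ π : n.Partition, (ζ ^ 0) ^ (-rank π) := by
    simp [partitionCount]
  rw [deviationTerm, hcount, Finset.range_eq_Ico, Finset.sum_eq_sum_Ico_succ_bot hM, ← hp]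
  simp only [← mul_assoc, ← Finset.sum_mul]
  field_simp
  ring

end partitions

/-! ### Dissection of Appell–Lerch sums by roots of unity -/

section dissection

variable {p : ℂ}

/-- Extracting a residue class from the geometric series. -/
lemma sum_inv_one_sub_root {N : ℕ} {η : ℂ} (hη : IsPrimitiveRoot η N) {c : ℕ} (hc : c < N) {v : ℂ}
    (hv : v ^ N ≠ 1) :
    ∑ j ∈ Finset.range N, (η ^ (-(c : ℤ))) ^ j * (1 - η ^ j * v)⁻¹ =
      N * (v ^ c * (1 - v ^ N)⁻¹) := by
  have hN : 0 < N := by omega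
  have hη0 : η ≠ 0 := hη.ne_zero hN.ne'
  have hv' : 1 - v ^ N ≠ 0 := sub_ne_zero.2 hv.symm
  have hgeo : ∀ j : ℕ, (1 - η ^ j * v)⁻¹ =
      (∑ k ∈ Finset.range N, (η ^ j * v) ^ k) * (1 - v ^ N)⁻¹ := fun j => by
    have h1 : (η ^ j * v) ^ N = v ^ N := by
      rw [mul_pow, ← pow_mul, mul_comm j, pow_mul, hη.pow_eq_one, one_pow, one_mul]
    have h2 := geom_sum_mul_neg (η ^ j * v) N
    rw [h1] at h2
    have h3 : 1 - η ^ j * v ≠ 0 := fun h => hv' (by rw [← h2, h, mul_zero])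
    rw [eq_mul_inv_iff_mul_eq₀ hv', ← h2, mul_comm (∑ k ∈ _, _), inv_mul_cancel_left₀ h3]
  have e : ∀ k j : ℕ, (η ^ (-(c : ℤ))) ^ j * ((η ^ j * v) ^ k * (1 - v ^ N)⁻¹) =
      (η ^ ((k : ℤ) - c)) ^ j * (v ^ k * (1 - v ^ N)⁻¹) := fun k j => by
    rw [zpow_sub₀ hη0, zpow_neg, zpow_natCast, zpow_natCast, mul_pow, div_pow, inv_pow,
      ← pow_mul, ← pow_mul, ← pow_mul, mul_comm j k]
    ring
  simp only [hgeo, Finset.sum_mul, Finset.mul_sum, e]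
  rw [Finset.sum_comm, Finset.sum_eq_single_of_mem c (Finset.mem_range.2 hc)]
  · simp
  · intro k hk hkc
    rw [← Finset.sum_mul, sum_zpow_primitiveRoot hη, if_neg, zero_mul]
    intro hd
    have h1 := Finset.mem_range.1 hk
    have h2 := Int.eq_zero_of_abs_lt_dvd hd (by rw [abs_lt]; constructor <;> omega)
    omega

/-- Splitting a sum over the integers by residues modulo `N`. -/
lemma hasSum_residues {N : ℕ} (hN : 0 < N) {f : ℤ → ℂ} {S : ℂ} (h : HasSum f S) :
    S = ∑ t ∈ Finset.range N, ∑' s : ℤ, f (N * s + t) := by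
  have : NeZero N := ⟨hN.ne'⟩
  have h1 := (Int.divModEquiv N).symm.hasSum_iff.2 h
  have h2 := ((Equiv.prodComm (Fin N) ℤ).hasSum_iff.2 h1)
  have h3 := h2.prod_fiberwise fun t => (h2.summable.prod_factor t).hasSum
  have h4 := h3.unique (hasSum_fintype _)
  rw [h4, Finset.sum_range]
  refine Finset.sum_congr rfl fun t _ => tsum_congr fun s => ?_
  simp only [Function.comp, Equiv.prodComm_apply, Prod.swap_prod_mk, Int.divModEquiv_symm_apply]
  congr 1
  ring

lemma thetaJ_zpow_mul (hp0 : p ≠ 0) (hp : ‖p‖ < 1) {w : ℂ} (hw : w ≠ 0) (c : ℕ) :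
    thetaJ (p ^ c * w) p = (-1) ^ c * p ^ (-((c : ℤ) * (c - 1) / 2)) * (w ^ c)⁻¹ * thetaJ w p := by
  induction c with
  | zero => simp
  | succ c ih =>
    rw [pow_succ', mul_assoc, thetaJ_mul_left hp0 hp (mul_ne_zero (pow_ne_zero _ hp0) hw), ih,
      Nat.cast_succ, choose_succ, neg_add, zpow_add₀ hp0, zpow_neg _ (c : ℤ), zpow_natCast,
      pow_succ w, pow_succ (-1 : ℂ)]
    field_simp

lemma choose_mul (N s : ℤ) :
    N * s * (N * s - 1) / 2 = N ^ 2 * (s * (s - 1) / 2) + s * (N * (N - 1) / 2) := by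
  have h1 := two_mul_choose (N * s)
  have h2 := two_mul_choose s
  have h3 := two_mul_choose N
  have h : 2 * (N * s * (N * s - 1) / 2) =
      2 * (N ^ 2 * (s * (s - 1) / 2) + s * (N * (N - 1) / 2)) := by
    linear_combination h1 - N ^ 2 * h2 - s * h3
  linarith

/-- The variable of the summand with residue `t` when the theta function `j(y; p)` is dissected
modulo `N`. -/
noncomputable def splitVar (N : ℕ) (p y : ℂ) (t : ℕ) : ℂ :=
  (-1) ^ (N + 1) * p ^ ((N : ℤ) * (N - 1) / 2 + N * t) * y ^ N

lemma splitVar_ne_zero (hp0 : p ≠ 0) {y : ℂ} (hy : y ≠ 0) (N t : ℕ) : splitVar N p y t ≠ 0 :=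
  mul_ne_zero (mul_ne_zero (pow_ne_zero _ (by norm_num)) (zpow_ne_zero _ hp0)) (pow_ne_zero _ hy)

lemma theta_term_split (hp0 : p ≠ 0) {y : ℂ} (hy : y ≠ 0) (N t : ℕ) (s : ℤ) :
    (-1 : ℂ) ^ ((N : ℤ) * s + t) * p ^ (((N : ℤ) * s + t) * (N * s + t - 1) / 2) *
        y ^ ((N : ℤ) * s + t) =
      (-1) ^ t * p ^ ((t : ℤ) * (t - 1) / 2) * y ^ t *
        ((-1) ^ s * (p ^ N ^ 2) ^ (s * (s - 1) / 2) * splitVar N p y t ^ s) := by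
  have h1 : (-1 : ℂ) ≠ 0 := by norm_num
  rw [choose_add, choose_mul, splitVar, mul_zpow, mul_zpow, ← zpow_natCast p, ← zpow_mul,
    ← zpow_mul, ← zpow_natCast (-1) (N + 1), ← zpow_natCast y N, ← zpow_mul, ← zpow_mul,
    zpow_add₀ h1, zpow_add₀ hy, zpow_natCast, zpow_natCast]
  push_cast
  rw [add_mul, zpow_add₀ h1, one_mul, zpow_add₀ hp0, zpow_add₀ hp0, zpow_add₀ hp0, add_mul,
    zpow_add₀ hp0, mul_comm s ((N : ℤ) * (N - 1) / 2), show (N : ℤ) * s * t = N * t * s by ring]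
  have h2 : (-1 : ℂ) ^ s * (-1) ^ s = 1 := by
    rw [← mul_zpow]; norm_num
  linear_combination -(-1 : ℂ) ^ t * p ^ ((t : ℤ) * (t - 1) / 2) * y ^ t *
    (-1) ^ ((N : ℤ) * s) * p ^ ((N : ℤ) ^ 2 * (s * (s - 1) / 2)) * p ^ ((N : ℤ) * (N - 1) / 2 * s) *
    p ^ ((N : ℤ) * t * s) * y ^ ((N : ℤ) * s) * h2

lemma norm_pow_lt_one (hp : ‖p‖ < 1) {n : ℕ} (hn : n ≠ 0) : ‖p ^ n‖ < 1 := by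
  rw [norm_pow]; exact pow_lt_one₀ (norm_nonneg _) hp hn

lemma thetaJ_dissection (hp0 : p ≠ 0) (hp : ‖p‖ < 1) {N : ℕ} (hN : 0 < N) {y : ℂ} (hy : y ≠ 0) :
    thetaJ y p = ∑ t ∈ Finset.range N,
      (-1) ^ t * p ^ ((t : ℤ) * (t - 1) / 2) * y ^ t * thetaJ (splitVar N p y t) (p ^ N ^ 2) := by
  rw [hasSum_residues hN (hasSum_thetaJ hp0 hp hy)]
  refine Finset.sum_congr rfl fun t _ => ?_
  simp only [theta_term_split hp0 hy]
  rw [tsum_mul_left, (hasSum_thetaJ (pow_ne_zero _ hp0)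
    (norm_pow_lt_one hp (pow_ne_zero 2 hN.ne')) (splitVar_ne_zero hp0 hy N t)).tsum_eq]

/-- The base variable of the Appell–Lerch sum that is the part of residue `c` modulo `N` in the
powers of `x` of `m(x, p, w)`, up to theta functions. -/
noncomputable def splitArg (N c : ℕ) (p x : ℂ) : ℂ :=
  (-1) ^ (N + 1) * p ^ ((N : ℤ) * (N - 1) / 2 - c * N) * x ^ N

lemma splitArg_mul_splitVar (hp0 : p ≠ 0) (N c t : ℕ) (x w : ℂ) :
    splitArg N c p x * splitVar N p (p ^ c * w) t =
      p ^ ((N : ℤ) * (N - 1) + N * t) * (x * w) ^ N := by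
  have h := two_mul_choose N
  have h2 : (-1 : ℂ) ^ (N + 1) * (-1) ^ (N + 1) = 1 := by rw [← mul_pow]; norm_num
  have e : p ^ ((N : ℤ) * (N - 1) + N * t) = p ^ ((N : ℤ) * (N - 1) / 2 - c * N) *
      (p ^ ((N : ℤ) * (N - 1) / 2 + N * t) * (p ^ c) ^ N) := by
    rw [← pow_mul, ← zpow_natCast, ← zpow_add₀ hp0, ← zpow_add₀ hp0]
    congr 1
    push_cast
    linear_combination -h
  rw [splitArg, splitVar, e, mul_pow, mul_pow]
  linear_combination p ^ ((N : ℤ) * (N - 1) / 2 - c * N) * x ^ N *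
    p ^ ((N : ℤ) * (N - 1) / 2 + N * t) * ((p ^ c) ^ N * w ^ N) * h2

/-- Change of the auxiliary variable in an Appell–Lerch sum. -/
lemma appellM_sub (hp0 : p ≠ 0) (hp : ‖p‖ < 1) {x z₀ z₁ : ℂ} (hx : x ≠ 0) (h0 : z₀ ≠ 0)
    (h1 : z₁ ≠ 0) (hz0 : NotPower z₀ p) (hz1 : NotPower z₁ p) (hx0 : NotPower (x * z₀) p)
    (hx1 : NotPower (x * z₁) p) :
    appellM x p z₁ - appellM x p z₀ = z₀ * qPochInf p p ^ 3 * thetaJ (z₁ / z₀) p *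
      thetaJ (x * z₀ * z₁) p /
        (thetaJ z₀ p * thetaJ z₁ p * thetaJ (x * z₀) p * thetaJ (x * z₁) p) := by
  have h := appellA_cross hp0 hp (y := x⁻¹) (inv_ne_zero hx) (mul_ne_zero hx h0)
    (mul_ne_zero hx h1) hx0 hx1
  rw [show x * z₀ * x⁻¹ = z₀ by field_simp, show x * z₁ * x⁻¹ = z₁ by field_simp,
    mul_div_mul_left _ _ hx, show x * z₀ * (x * z₁) * x⁻¹ = x * z₀ * z₁ by field_simp] at h
  have j0 := thetaJ_ne_zero hp hz0
  have j1 := thetaJ_ne_zero hp hz1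
  rw [appellM_eq, appellM_eq, mul_assoc (thetaJ z₀ p * thetaJ z₁ p), mul_comm (_ * _) (_ * _),
    ← div_div, ← h]
  field_simp

/-- The part of `m(x, p, w)` with residue `c` modulo `N` in the powers of `x` is again an
Appell–Lerch sum, up to theta functions. -/
lemma appellM_dissection (hp0 : p ≠ 0) (hp : ‖p‖ < 1) {N : ℕ} {η : ℂ} (hη : IsPrimitiveRoot η N)
    {c : ℕ} (hc : c < N) {x w w₀ : ℂ} (hx0 : x ≠ 0) (hw0 : w ≠ 0) (hw00 : w₀ ≠ 0)
    (hw : NotPower w p) (hxw : NotPower ((x * w) ^ N) p) (hw₀ : NotPower w₀ (p ^ N ^ 2))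
    (hxw₀ : NotPower (splitArg N c p x * w₀) (p ^ N ^ 2)) :
    (N : ℂ)⁻¹ * ∑ j ∈ Finset.range N, (η ^ (-(c : ℤ))) ^ j * appellM (η ^ j * x) p w =
      (-x) ^ c * p ^ (-((c : ℤ) * (c + 1) / 2)) * appellM (splitArg N c p x) (p ^ N ^ 2) w₀ +
      ∑ t ∈ Finset.range N, (p⁻¹ * x * w) ^ c * ((-1) ^ t * p ^ ((t : ℤ) * (t - 1) / 2) *
        (p ^ c * w) ^ t) * w₀ * (qPochInf (p ^ N ^ 2) (p ^ N ^ 2) ^ 3 *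
          thetaJ (splitVar N p (p ^ c * w) t / w₀) (p ^ N ^ 2) *
          thetaJ (splitArg N c p x * w₀ * splitVar N p (p ^ c * w) t) (p ^ N ^ 2)) /
        (thetaJ w p * thetaJ w₀ (p ^ N ^ 2) * thetaJ (splitArg N c p x * w₀) (p ^ N ^ 2) *
          thetaJ (splitArg N c p x * splitVar N p (p ^ c * w) t) (p ^ N ^ 2)) := by
  have hN : 0 < N := by omega
  have hη0 : η ≠ 0 := hη.ne_zero hN.ne'
  have hN0 : (N : ℂ) ≠ 0 := by exact_mod_cast hN.ne'
  have hP := norm_pow_lt_one hp (pow_ne_zero 2 hN.ne')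
  have hP0 : p ^ N ^ 2 ≠ 0 := pow_ne_zero _ hp0
  have hy0 : p ^ c * w ≠ 0 := mul_ne_zero (pow_ne_zero _ hp0) hw0
  have hX0 : splitArg N c p x ≠ 0 :=
    mul_ne_zero (mul_ne_zero (pow_ne_zero _ (by norm_num)) (zpow_ne_zero _ hp0)) (pow_ne_zero _ hx0)
  have hU : ∀ t, NotPower (splitArg N c p x * splitVar N p (p ^ c * w) t) (p ^ N ^ 2) := fun t => by
    rw [splitArg_mul_splitVar hp0]
    exact ((notPower_zpow_mul_iff hp0 _).2 hxw).pow_base _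
  have hηp : ∀ j : ℕ, (η ^ j) ^ N = 1 := fun j => by
    rw [← pow_mul, mul_comm, pow_mul, hη.pow_eq_one, one_pow]
  have hjx : ∀ j : ℕ, NotPower (η ^ j * x * w) p := fun j k hk => hxw (k * N) <| by
    rw [zpow_mul, ← hk, zpow_natCast, mul_assoc, mul_pow (η ^ j), hηp, one_mul]
  have hA := hasSum_sum (s := Finset.range N) fun j _ => (hasSum_appellA hp0 hp hw0
    (mul_ne_zero (mul_ne_zero (pow_ne_zero j hη0) hx0) hw0) (hjx j)).mul_left ((η ^ (-(c : ℤ))) ^ j)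
  have hv : ∀ r : ℤ, (p ^ (r - 1) * (x * w)) ^ N ≠ 1 := fun r h => hxw ((1 - r) * N) <| by
    rw [mul_pow] at h
    rw [zpow_mul, zpow_natCast, ← neg_sub r, zpow_neg, inv_pow]
    exact eq_inv_of_mul_eq_one_right h
  have hB : HasSum (fun r : ℤ => (-1 : ℂ) ^ r * p ^ (r * (r - 1) / 2) * w ^ r *
      (N * ((p ^ (r - 1) * (x * w)) ^ c * (1 - (p ^ (r - 1) * (x * w)) ^ N)⁻¹))) _ :=
    hasSum_of_eq hA (fun r => by
      rw [← sum_inv_one_sub_root hη hc (hv r), Finset.mul_sum]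
      refine Finset.sum_congr rfl fun j _ => ?_
      rw [show p ^ (r - 1) * (η ^ j * x * w) = η ^ j * (p ^ (r - 1) * (x * w)) by ring]
      ring) rfl
  have hC := hasSum_residues hN hB
  have hterm : ∀ t : ℕ, ∑' s : ℤ, (-1 : ℂ) ^ ((N : ℤ) * s + t) *
      p ^ (((N : ℤ) * s + t) * ((N : ℤ) * s + t - 1) / 2) * w ^ ((N : ℤ) * s + t) *
      (N * ((p ^ ((N : ℤ) * s + t - 1) * (x * w)) ^ c *
        (1 - (p ^ ((N : ℤ) * s + t - 1) * (x * w)) ^ N)⁻¹)) =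
      N * ((p⁻¹ * x * w) ^ c * ((-1) ^ t * p ^ ((t : ℤ) * (t - 1) / 2) * (p ^ c * w) ^ t)) *
        appellA (splitArg N c p x * splitVar N p (p ^ c * w) t) (p ^ N ^ 2)
          (splitVar N p (p ^ c * w) t) := fun t => by
    rw [appellA, ← tsum_mul_left]
    refine tsum_congr fun s => ?_
    have h1 := theta_term_split hp0 hy0 N t s
    rw [mul_zpow, ← zpow_natCast p c, ← zpow_mul] at h1
    have h2 : (p ^ ((N : ℤ) * s + t - 1) * (x * w)) ^ N = (p ^ N ^ 2) ^ (s - 1) *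
        (splitArg N c p x * splitVar N p (p ^ c * w) t) := by
      rw [splitArg_mul_splitVar hp0, mul_pow, ← mul_assoc, ← zpow_natCast, ← zpow_natCast p (N ^ 2),
        ← zpow_mul, ← zpow_mul, ← zpow_add₀ hp0]
      congr 2
      push_cast
      ring
    have h3 : (p ^ ((N : ℤ) * s + t - 1) * (x * w)) ^ c =
        (p⁻¹ * x * w) ^ c * p ^ ((c : ℤ) * (N * s + t)) := by
      rw [zpow_sub_one₀ hp0, mul_comm (c : ℤ), zpow_mul, zpow_natCast, ← mul_pow]
      congr 1
      ring
    rw [h2, h3]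
    rw [zpow_natCast p c] at h1
    linear_combination (N : ℂ) * (p⁻¹ * x * w) ^ c * (1 - (p ^ N ^ 2) ^ (s - 1) *
      (splitArg N c p x * splitVar N p (p ^ c * w) t))⁻¹ * h1
  have hcross : ∀ t : ℕ, appellA (splitArg N c p x * splitVar N p (p ^ c * w) t) (p ^ N ^ 2)
      (splitVar N p (p ^ c * w) t) = thetaJ (splitVar N p (p ^ c * w) t) (p ^ N ^ 2) *
        appellM (splitArg N c p x) (p ^ N ^ 2) w₀ + w₀ * (qPochInf (p ^ N ^ 2) (p ^ N ^ 2) ^ 3 *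
          thetaJ (splitVar N p (p ^ c * w) t / w₀) (p ^ N ^ 2) *
          thetaJ (splitArg N c p x * w₀ * splitVar N p (p ^ c * w) t) (p ^ N ^ 2)) /
        (thetaJ w₀ (p ^ N ^ 2) * thetaJ (splitArg N c p x * w₀) (p ^ N ^ 2) *
          thetaJ (splitArg N c p x * splitVar N p (p ^ c * w) t) (p ^ N ^ 2)) := fun t => by
    have hz0 := splitVar_ne_zero hp0 hy0 N t
    have h := appellA_cross hP0 hP (y := (splitArg N c p x)⁻¹) (inv_ne_zero hX0)
      (mul_ne_zero hX0 hw00) (mul_ne_zero hX0 hz0) hxw₀ (hU t)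
    rw [appellM_eq]
    have j0 := thetaJ_ne_zero hP hw₀
    have j1 := thetaJ_ne_zero hP hxw₀
    have j2 := thetaJ_ne_zero hP (hU t)
    generalize splitArg N c p x = X at *
    generalize splitVar N p (p ^ c * w) t = Z at *
    rw [show X * w₀ * X⁻¹ = w₀ by field_simp, show X * Z * X⁻¹ = Z by field_simp,
      mul_div_mul_left _ _ hX0, show X * w₀ * (X * Z) * X⁻¹ = X * w₀ * Z by field_simp] at h
    linear_combination (norm := skip) (thetaJ w₀ (p ^ N ^ 2))⁻¹ * h
    field_simp
    ring
  have jw := thetaJ_ne_zero hp hw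
  have hθ := thetaJ_dissection hp0 hp hN hy0
  rw [thetaJ_zpow_mul hp0 hp hw0] at hθ
  have hlhs : (N : ℂ)⁻¹ * ∑ j ∈ Finset.range N, (η ^ (-(c : ℤ))) ^ j * appellM (η ^ j * x) p w =
      (thetaJ w p)⁻¹ * ((p⁻¹ * x * w) ^ c * ∑ t ∈ Finset.range N,
        ((-1) ^ t * p ^ ((t : ℤ) * (t - 1) / 2) * (p ^ c * w) ^ t) *
        appellA (splitArg N c p x * splitVar N p (p ^ c * w) t) (p ^ N ^ 2)
          (splitVar N p (p ^ c * w) t)) := by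
    have h1 : ∑ j ∈ Finset.range N, (η ^ (-(c : ℤ))) ^ j * appellM (η ^ j * x) p w =
        (thetaJ w p)⁻¹ * ∑ j ∈ Finset.range N,
          (η ^ (-(c : ℤ))) ^ j * appellA (η ^ j * x * w) p w := by
      rw [Finset.mul_sum]
      refine Finset.sum_congr rfl fun j _ => ?_
      rw [appellM_eq]; ring
    rw [h1, hC]
    simp only [hterm, Finset.mul_sum]
    refine Finset.sum_congr rfl fun t _ => ?_
    field_simp
  have hpre : (-x) ^ c * p ^ (-((c : ℤ) * (c + 1) / 2)) =
      (thetaJ w p)⁻¹ * (p⁻¹ * x * w) ^ c * ((-1) ^ c * p ^ (-((c : ℤ) * (c - 1) / 2)) *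
        (w ^ c)⁻¹ * thetaJ w p) := by
    have h1 := choose_succ c
    rw [add_sub_cancel_right, mul_comm ((c : ℤ) + 1)] at h1
    rw [h1, neg_add, zpow_add₀ hp0, zpow_neg _ (c : ℤ), zpow_natCast, neg_pow, mul_pow, mul_pow,
      inv_pow]
    field_simp
  rw [hlhs, hpre, hθ, Finset.mul_sum, Finset.mul_sum, Finset.mul_sum, Finset.sum_mul,
    ← Finset.sum_add_distrib]
  refine Finset.sum_congr rfl fun t _ => ?_
  rw [hcross t]
  field_simp

end dissection

/-! ### Theta functions in `q` alone -/

section thetaRep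

/-- `F` is, on the punctured unit disc, a theta function in `q` alone of weight `1 / 2` and
multiplier exponent `μ`, with denominators that do not vanish there. -/
def IsTheta (μ : ℚ) (F : ℂ → ℂ) : Prop :=
  ∃ T : ThetaFunction, (∀ t ∈ T, t.WeightHalf ∧ ∀ s : ℚ, t.multiplier s = μ) ∧ T.ZFree ∧
    ∀ q : ℂ, q ≠ 0 → ‖q‖ < 1 → ∀ z, T.Defined q z ∧ T.eval q z = F q

variable {μ : ℚ} {F G : ℂ → ℂ}

lemma IsTheta.congr (h : IsTheta μ F) (e : ∀ q : ℂ, q ≠ 0 → ‖q‖ < 1 → F q = G q) :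
    IsTheta μ G := by
  obtain ⟨T, h1, h2, h3⟩ := h
  exact ⟨T, h1, h2, fun q hq0 hq z => ⟨(h3 q hq0 hq z).1, (h3 q hq0 hq z).2.trans (e q hq0 hq)⟩⟩

lemma isTheta_zero (μ : ℚ) : IsTheta μ fun _ => 0 :=
  ⟨[], by simp, by simp [ThetaFunction.ZFree],
    fun q _ _ z => ⟨by simp [ThetaFunction.Defined], by simp [ThetaFunction.eval]⟩⟩

lemma ThetaFunction.eval_append (T S : ThetaFunction) (q z : ℂ) :
    ThetaFunction.eval (T ++ S) q z = T.eval q z + S.eval q z := by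
  simp [ThetaFunction.eval]

lemma IsTheta.add (hF : IsTheta μ F) (hG : IsTheta μ G) : IsTheta μ fun q => F q + G q := by
  obtain ⟨T, h1, h2, h3⟩ := hF
  obtain ⟨S, g1, g2, g3⟩ := hG
  refine ⟨T ++ S, fun t ht => ?_, fun t ht => ?_, fun q hq0 hq z => ⟨fun t ht => ?_, ?_⟩⟩
  · exact (List.mem_append.1 ht).elim (h1 t) (g1 t)
  · exact (List.mem_append.1 ht).elim (h2 t) (g2 t)
  · exact (List.mem_append.1 ht).elim ((h3 q hq0 hq z).1 t) ((g3 q hq0 hq z).1 t)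
  · rw [ThetaFunction.eval_append, (h3 q hq0 hq z).2, (g3 q hq0 hq z).2]

lemma isTheta_sum {ι : Type*} {s : Finset ι} {F : ι → ℂ → ℂ} (h : ∀ i ∈ s, IsTheta μ (F i)) :
    IsTheta μ fun q => ∑ i ∈ s, F i q := by
  classical
  induction s using Finset.induction_on with
  | empty => simpa using isTheta_zero μ
  | insert i s hi ih =>
    refine ((h i (Finset.mem_insert_self _ _)).add
      (ih fun j hj => h j (Finset.mem_insert_of_mem hj))).congr fun q _ _ => ?_
    rw [Finset.sum_insert hi]

/-- The product of a theta quotient with `c q ^ r`. -/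
noncomputable def ThetaQuotient.mulMonomial (c : ℂ) (r : ℤ) (t : ThetaQuotient) : ThetaQuotient :=
  ⟨c * t.coeff, r + t.qExp, t.zExp, t.num, t.den⟩

lemma IsTheta.mul_monomial (h : IsTheta μ F) (c : ℂ) (r : ℤ) {ν : ℚ} (hν : ν = μ - r) :
    IsTheta ν fun q => c * q ^ r * F q := by
  obtain ⟨T, h1, h2, h3⟩ := h
  refine ⟨T.map (ThetaQuotient.mulMonomial c r), ?_, ?_, fun q hq0 hq z => ⟨?_, ?_⟩⟩
  · simp only [List.mem_map]
    rintro _ ⟨t, ht, rfl⟩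
    refine ⟨(h1 t ht).1, fun s => ?_⟩
    rw [hν, ← (h1 t ht).2 s]
    simp only [ThetaQuotient.multiplier, ThetaQuotient.mulMonomial]
    push_cast
    ring
  · simp only [ThetaFunction.ZFree, List.mem_map]
    rintro _ ⟨t, ht, rfl⟩
    exact h2 t ht
  · simp only [ThetaFunction.Defined, List.mem_map]
    rintro _ ⟨t, ht, rfl⟩
    exact (h3 q hq0 hq z).1 t ht
  · show _ = c * q ^ r * F q
    rw [← (h3 q hq0 hq z).2, ThetaFunction.eval, ThetaFunction.eval, List.map_map,
      ← List.sum_map_mul_left]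
    congr 1
    refine List.map_congr_left fun t _ => ?_
    simp only [Function.comp, ThetaQuotient.eval, ThetaQuotient.mulMonomial, zpow_add₀ hq0]
    ring

lemma IsTheta.const_mul (h : IsTheta μ F) (c : ℂ) : IsTheta μ fun q => c * F q :=
  (h.mul_monomial c 0 (by simp)).congr fun q _ _ => by simp

lemma IsTheta.neg (h : IsTheta μ F) : IsTheta μ fun q => -F q :=
  (h.const_mul (-1)).congr fun q _ _ => by simp

lemma IsTheta.sub (hF : IsTheta μ F) (hG : IsTheta μ G) : IsTheta μ fun q => F q - G q :=
  (hF.add hG.neg).congr fun q _ _ => by ring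

/-- The theta function `j(ω q ^ e; q ^ n)`. -/
def factor (ω : ℂ) (h : IsOfFinOrder ω) (e : ℤ) (n : ℕ) (hn : 0 < n) : ThetaFactor :=
  ⟨ω, h, e, 0, n, hn⟩

/-- The Euler product `(q ^ n; q ^ n)_∞`, which is the theta function `j(q ^ n; q ^ (3 n))`. -/
def eulerFactor (n : ℕ) (hn : 0 < n) : ThetaFactor :=
  factor 1 IsOfFinOrder.one n (3 * n) (by omega)

lemma eval_factor (ω : ℂ) (h : IsOfFinOrder ω) (e : ℤ) (n : ℕ) (hn : 0 < n) (q z : ℂ) :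
    (factor ω h e n hn).eval q z = thetaJ (ω * q ^ e) (q ^ n) := by
  simp [factor, ThetaFactor.eval]

lemma eval_eulerFactor (n : ℕ) (hn : 0 < n) {q : ℂ} (hq : ‖q‖ < 1) (z : ℂ) :
    (eulerFactor n hn).eval q z = qPochInf (q ^ n) (q ^ n) := by
  rw [eulerFactor, eval_factor, one_mul, zpow_natCast, mul_comm, pow_mul,
    thetaJ_self_cube (norm_pow_lt_one hq hn.ne')]

lemma multiplier_factor (ω : ℂ) (h : IsOfFinOrder ω) (e : ℤ) (n : ℕ) (hn : 0 < n) (s : ℚ) :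
    (factor ω h e n hn).multiplier s = (n - 2 * e) ^ 2 / (8 * n) := by
  simp [factor, ThetaFactor.multiplier]

lemma multiplier_eulerFactor (n : ℕ) (hn : 0 < n) (s : ℚ) :
    (eulerFactor n hn).multiplier s = n / 24 := by
  rw [eulerFactor, multiplier_factor]
  have : (n : ℚ) ≠ 0 := by exact_mod_cast hn.ne'
  push_cast
  field_simp
  ring

lemma zExp_factor (ω : ℂ) (h : IsOfFinOrder ω) (e : ℤ) (n : ℕ) (hn : 0 < n) :
    (factor ω h e n hn).zExp = 0 := rfl

lemma zExp_eulerFactor (n : ℕ) (hn : 0 < n) : (eulerFactor n hn).zExp = 0 := rfl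

lemma norm_eq_one_of_isOfFinOrder {ω : ℂ} (h : IsOfFinOrder ω) : ‖ω‖ = 1 := by
  obtain ⟨n, hn, h1⟩ := isOfFinOrder_iff_pow_eq_one.1 h
  exact Complex.norm_eq_one_of_pow_eq_one h1 hn.ne'

lemma IsOfFinOrder.ne_zero' {ω : ℂ} (h : IsOfFinOrder ω) : ω ≠ 0 := fun h0 => by
  simpa [h0] using norm_eq_one_of_isOfFinOrder h

lemma IsOfFinOrder.inv' {ω : ℂ} (h : IsOfFinOrder ω) : IsOfFinOrder ω⁻¹ := by
  obtain ⟨n, hn, h1⟩ := isOfFinOrder_iff_pow_eq_one.1 h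
  exact isOfFinOrder_iff_pow_eq_one.2 ⟨n, hn, by rw [inv_pow, h1, inv_one]⟩

/-- A root of unity times a power of `q` is a power of `q ^ n` only if it visibly is, because
`‖q‖ < 1`. -/
lemma notPower_root_mul {q : ℂ} (hq0 : q ≠ 0) (hq : ‖q‖ < 1) {ω : ℂ} (h : IsOfFinOrder ω) {e : ℤ}
    {n : ℕ} (hne : ω ≠ 1 ∨ ¬(n : ℤ) ∣ e) : NotPower (ω * q ^ e) (q ^ n) := by
  intro k hk
  rw [← zpow_natCast, ← zpow_mul] at hk
  have h1 : e = n * k := by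
    have h2 := congrArg norm hk
    rw [norm_mul, norm_eq_one_of_isOfFinOrder h, one_mul, norm_zpow, norm_zpow] at h2
    exact zpow_right_injective₀ (norm_pos_iff.2 hq0) hq.ne h2
  rcases hne with h2 | h2
  · rw [h1] at hk
    exact h2 (mul_eq_right₀ (zpow_ne_zero _ hq0) |>.1 hk)
  · exact h2 ⟨k, h1⟩

/-- The denominators of `t` do not vanish for visible reasons. -/
lemma isTheta_quotient (t : ThetaQuotient) (hz : t.ZFree) (hw : t.WeightHalf)
    (hμ : t.multiplier 0 = μ) (hd : ∀ f ∈ t.den, f.root ≠ 1 ∨ ¬(f.level : ℤ) ∣ f.qExp)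
    (hF : ∀ q : ℂ, q ≠ 0 → ‖q‖ < 1 → t.eval q 1 = F q) : IsTheta μ F := by
  have he : ∀ (f : ThetaFactor), f.zExp = 0 → ∀ q z, f.eval q z = f.eval q 1 := fun f hf q z => by
    simp [ThetaFactor.eval, hf]
  have hm : ∀ (f : ThetaFactor), f.zExp = 0 → ∀ s, f.multiplier s = f.multiplier 0 :=
    fun f hf s => by simp [ThetaFactor.multiplier, hf]
  refine ⟨[t], ?_, ?_, fun q hq0 hq z => ⟨?_, ?_⟩⟩
  · simp only [List.mem_singleton, forall_eq]
    refine ⟨hw, fun s => ?_⟩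
    rw [← hμ, ThetaQuotient.multiplier, ThetaQuotient.multiplier, hz.1,
      List.map_congr_left fun f hf => hm f (hz.2.1 f hf) s,
      List.map_congr_left fun f hf => hm f (hz.2.2 f hf) s]
    simp
  · simpa [ThetaFunction.ZFree] using hz
  · simp only [ThetaFunction.Defined, List.mem_singleton, forall_eq]
    intro f hf
    rw [he f (hz.2.2 f hf), ThetaFactor.eval, one_zpow, mul_one]
    exact thetaJ_ne_zero (norm_pow_lt_one hq f.level_pos.ne')
      (notPower_root_mul hq0 hq f.root_torsion (hd f hf))
  · rw [← hF q hq0 hq, ThetaFunction.eval, List.map_singleton, List.sum_singleton,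
      ThetaQuotient.eval, ThetaQuotient.eval, hz.1,
      List.map_congr_left fun f hf => he f (hz.2.1 f hf) q z,
      List.map_congr_left fun f hf => he f (hz.2.2 f hf) q z]
    simp

/-- The theta quotient `mockTheta` at roots of unity times powers of `q`. -/
lemma isTheta_mockTheta {ω w : ℂ} (hω : IsOfFinOrder ω) (hw : IsOfFinOrder w) (hw1 : w ≠ 1)
    (hωw : ω ^ 3 * w ≠ 1) {f : ℤ} {n : ℕ} (hn : 0 < n) (hf : ω ≠ 1 ∨ ¬(n : ℤ) ∣ f) :
    IsTheta (-((n : ℚ) - 6 * f) ^ 2 / (24 * n))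
      fun q => mockTheta (ω * q ^ f) (q ^ n) w := by
  have h3n : 0 < 3 * n := by omega
  have h3 := (hω.pow (n := 3)).mul hw
  refine isTheta_quotient ⟨ω ^ 2 * w, 2 * f - n, 0,
    [eulerFactor (3 * n) h3n, eulerFactor (3 * n) h3n, eulerFactor (3 * n) h3n, eulerFactor n hn,
      factor (ω ^ 2 * w) ((hω.pow (n := 2)).mul hw) (2 * f) n hn],
    [factor w hw 0 (3 * n) h3n, factor (ω ^ 3 * w) h3 (3 * f + n) (3 * n) h3n,
      factor (ω ^ 3 * w) h3 (3 * f - n) (3 * n) h3n, factor ω hω f n hn]⟩ ?_ ?_ ?_ ?_ ?_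
  · simp [ThetaQuotient.ZFree, zExp_factor, zExp_eulerFactor]
  · simp [ThetaQuotient.WeightHalf]
  · have : (n : ℚ) ≠ 0 := by exact_mod_cast hn.ne'
    simp only [ThetaQuotient.multiplier, List.map_cons, List.map_nil, List.sum_cons, List.sum_nil,
      multiplier_factor, multiplier_eulerFactor]
    push_cast
    field_simp
    ring
  · simp only [List.mem_cons, List.not_mem_nil, or_false, forall_eq_or_imp, forall_eq, factor]
    exact ⟨.inl hw1, .inl hωw, .inl hωw, hf⟩
  · intro q hq0 hq
    simp only [ThetaQuotient.eval, List.map_cons, List.map_nil, List.prod_cons, List.prod_nil,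
      eval_factor, eval_eulerFactor _ _ hq]
    rw [mockTheta, ← pow_mul q n 3, mul_comm n 3]
    have e1 : (ω * q ^ f) ^ 2 * w = ω ^ 2 * w * q ^ (2 * f) := by
      rw [mul_pow, mul_comm 2 f, zpow_mul, zpow_ofNat]; ring
    have e2 : (ω * q ^ f) ^ 3 * q ^ n * w = ω ^ 3 * w * q ^ (3 * f + n) := by
      rw [mul_pow, mul_comm 3 f, zpow_add₀ hq0, zpow_mul, zpow_ofNat, zpow_natCast]; ring
    have e3 : (ω * q ^ f) ^ 3 * (q ^ n)⁻¹ * w = ω ^ 3 * w * q ^ (3 * f - n) := by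
      rw [mul_pow, mul_comm 3 f, zpow_sub₀ hq0, zpow_mul, zpow_ofNat, zpow_natCast]; ring
    rw [e1, e2, e3, zpow_sub₀ hq0, zpow_natCast]
    simp only [zpow_zero, mul_one]
    ring

/-- The difference of the values of an Appell–Lerch sum at two choices of its auxiliary variable. -/
lemma isTheta_appellM_sub {ω ω₀ ω₁ : ℂ} (hω : IsOfFinOrder ω) (h0 : IsOfFinOrder ω₀)
    (h1 : IsOfFinOrder ω₁) (h01 : ω₀ ≠ 1) (h11 : ω₁ ≠ 1) (hx0 : ω * ω₀ ≠ 1) (hx1 : ω * ω₁ ≠ 1)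
    (e : ℤ) {n : ℕ} (hn : 0 < n) :
    IsTheta (-((n : ℚ) - 2 * e) ^ 2 / (8 * n))
      fun q => appellM (ω * q ^ e) (q ^ n) ω₁ - appellM (ω * q ^ e) (q ^ n) ω₀ := by
  have hω0 := IsOfFinOrder.ne_zero' hω
  have h00 := IsOfFinOrder.ne_zero' h0
  have h10 := IsOfFinOrder.ne_zero' h1
  refine isTheta_quotient ⟨ω₀, 0, 0,
    [eulerFactor n hn, eulerFactor n hn, eulerFactor n hn,
      factor (ω₁ * ω₀⁻¹) (h1.mul (IsOfFinOrder.inv' h0)) 0 n hn,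
      factor (ω * ω₀ * ω₁) ((hω.mul h0).mul h1) e n hn],
    [factor ω₀ h0 0 n hn, factor ω₁ h1 0 n hn, factor (ω * ω₀) (hω.mul h0) e n hn,
      factor (ω * ω₁) (hω.mul h1) e n hn]⟩ ?_ ?_ ?_ ?_ ?_
  · simp [ThetaQuotient.ZFree, zExp_factor, zExp_eulerFactor]
  · simp [ThetaQuotient.WeightHalf]
  · have : (n : ℚ) ≠ 0 := by exact_mod_cast hn.ne'
    simp only [ThetaQuotient.multiplier, List.map_cons, List.map_nil, List.sum_cons, List.sum_nil,
      multiplier_factor, multiplier_eulerFactor]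
    push_cast
    field_simp
    ring
  · simp only [List.mem_cons, List.not_mem_nil, or_false, forall_eq_or_imp, forall_eq, factor]
    exact ⟨.inl h01, .inl h11, .inl hx0, .inl hx1⟩
  · intro q hq0 hq
    have c0 : ω * q ^ e * ω₀ = ω * ω₀ * q ^ e := by ring
    have c1 : ω * q ^ e * ω₁ = ω * ω₁ * q ^ e := by ring
    rw [appellM_sub (pow_ne_zero _ hq0) (norm_pow_lt_one hq hn.ne')
      (mul_ne_zero hω0 (zpow_ne_zero _ hq0)) h00 h10
      (by simpa using notPower_root_mul hq0 hq (e := 0) (n := n) h0 (.inl h01))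
      (by simpa using notPower_root_mul hq0 hq (e := 0) (n := n) h1 (.inl h11))
      (by rw [c0]; exact notPower_root_mul hq0 hq (hω.mul h0) (.inl hx0))
      (by rw [c1]; exact notPower_root_mul hq0 hq (hω.mul h1) (.inl hx1))]
    simp only [ThetaQuotient.eval, List.map_cons, List.map_nil, List.prod_cons, List.prod_nil,
      eval_factor, eval_eulerFactor _ _ hq]
    rw [c0, c1, show ω * ω₀ * q ^ e * ω₁ = ω * ω₀ * ω₁ * q ^ e by ring]
    simp only [zpow_zero, mul_one, div_eq_mul_inv]
    ring

end thetaRep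

/-! ### The parts of an Appell–Lerch sum in the residue classes -/

section parts

lemma isOfFinOrder_neg_one_pow (n : ℕ) : IsOfFinOrder ((-1 : ℂ) ^ n) :=
  IsOfFinOrder.pow (isOfFinOrder_iff_pow_eq_one.2 ⟨2, by norm_num, by norm_num⟩)

/-- The sum of the terms of `m(q ^ e, q ^ 3, w)` with residue `c`, up to theta functions. -/
lemma isTheta_dissection {N : ℕ} {η w : ℂ} (hη : IsPrimitiveRoot η N) {c : ℕ} (hc : c < N)
    (hw : IsOfFinOrder w) (hwN : w ^ N ≠ 1) (hws : (-1) ^ (N + 1) * w ≠ 1) (e : ℤ) :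
    IsTheta (-(3 - 2 * (e : ℚ)) ^ 2 / 24) fun q =>
      (N : ℂ)⁻¹ * ∑ j ∈ Finset.range N, (η ^ (-(c : ℤ))) ^ j * appellM (η ^ j * q ^ e) (q ^ 3) w -
      (-1) ^ c * q ^ (e * c - 3 * ((c : ℤ) * (c + 1) / 2)) *
        appellM ((-1) ^ (N + 1) * q ^ (3 * ((N : ℤ) * (N - 1) / 2 - c * N) + e * N))
          (q ^ (3 * N ^ 2)) w := by
  have hN : 0 < N := by omega
  have hP : 0 < 3 * N ^ 2 := by positivity
  have hw0 := IsOfFinOrder.ne_zero' hw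
  have hw1 : w ≠ 1 := fun h => hwN (by rw [h, one_pow])
  have hs := isOfFinOrder_neg_one_pow (N + 1)
  have hss : (-1 : ℂ) ^ (N + 1) * (-1) ^ (N + 1) = 1 := by rw [← mul_pow]; norm_num
  have hwp := hw.pow (n := N)
  set h : ℤ := (N : ℤ) * (N - 1) / 2 with hh
  have h2 : 2 * h = N * (N - 1) := two_mul_choose N
  have main : ∀ t ∈ Finset.range N, IsTheta (-(3 - 2 * (e : ℚ)) ^ 2 / 24) fun q =>
      ((q ^ 3)⁻¹ * q ^ e * w) ^ c * ((-1) ^ t * (q ^ 3) ^ ((t : ℤ) * (t - 1) / 2) *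
        ((q ^ 3) ^ c * w) ^ t) * w * (qPochInf ((q ^ 3) ^ N ^ 2) ((q ^ 3) ^ N ^ 2) ^ 3 *
          thetaJ (splitVar N (q ^ 3) ((q ^ 3) ^ c * w) t / w) ((q ^ 3) ^ N ^ 2) *
          thetaJ (splitArg N c (q ^ 3) (q ^ e) * w * splitVar N (q ^ 3) ((q ^ 3) ^ c * w) t)
            ((q ^ 3) ^ N ^ 2)) /
        (thetaJ w (q ^ 3) * thetaJ w ((q ^ 3) ^ N ^ 2) *
          thetaJ (splitArg N c (q ^ 3) (q ^ e) * w) ((q ^ 3) ^ N ^ 2) *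
          thetaJ (splitArg N c (q ^ 3) (q ^ e) * splitVar N (q ^ 3) ((q ^ 3) ^ c * w) t)
            ((q ^ 3) ^ N ^ 2)) := fun t _ => by
    have t2 : 2 * ((t : ℤ) * (t - 1) / 2) = t * (t - 1) := two_mul_choose t
    refine isTheta_quotient ⟨w ^ c * (-1) ^ t * w ^ t * w,
      (e - 3) * c + 3 * ((t : ℤ) * (t - 1) / 2) + 3 * c * t, 0,
      [eulerFactor (3 * N ^ 2) hP, eulerFactor (3 * N ^ 2) hP, eulerFactor (3 * N ^ 2) hP,
        factor ((-1) ^ (N + 1) * w ^ N * w⁻¹) ((hs.mul hwp).mul (IsOfFinOrder.inv' hw))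
          (3 * (h + N * t + c * N)) (3 * N ^ 2) hP,
        factor (w ^ N * w) (hwp.mul hw) (3 * (2 * h + N * t) + e * N) (3 * N ^ 2) hP],
      [factor w hw 0 3 (by norm_num), factor w hw 0 (3 * N ^ 2) hP,
        factor ((-1) ^ (N + 1) * w) (hs.mul hw) (3 * (h - c * N) + e * N) (3 * N ^ 2) hP,
        factor (w ^ N) hwp (3 * (2 * h + N * t) + e * N) (3 * N ^ 2) hP]⟩ ?_ ?_ ?_ ?_ ?_
    · simp [ThetaQuotient.ZFree, zExp_factor, zExp_eulerFactor]
    · simp [ThetaQuotient.WeightHalf]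
    · have hN0 : (N : ℚ) ≠ 0 := by exact_mod_cast hN.ne'
      simp only [ThetaQuotient.multiplier, List.map_cons, List.map_nil, List.sum_cons,
        List.sum_nil, multiplier_factor, multiplier_eulerFactor]
      have q2 : (h : ℚ) = N * (N - 1) / 2 := by
        rw [eq_div_iff two_ne_zero, mul_comm]; exact_mod_cast h2
      have q3 : (((t : ℤ) * (t - 1) / 2 : ℤ) : ℚ) = t * (t - 1) / 2 := by
        rw [eq_div_iff two_ne_zero, mul_comm]; exact_mod_cast t2
      push_cast [q3]
      rw [q2]
      field_simp
      ring
    · simp only [List.mem_cons, List.not_mem_nil, or_false, forall_eq_or_imp, forall_eq, factor]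
      exact ⟨.inl hw1, .inl hw1, .inl hws, .inl hwN⟩
    · intro q hq0 hq
      simp only [ThetaQuotient.eval, List.map_cons, List.map_nil, List.prod_cons, List.prod_nil,
        eval_factor, eval_eulerFactor _ _ hq]
      have zc : ∀ (a : ℤ) (k : ℕ), (q ^ a) ^ k = q ^ (a * k) := fun a k => by
        rw [zpow_mul, zpow_natCast]
      have n3 : q ^ 3 = q ^ (3 : ℤ) := (zpow_ofNat q 3).symm
      have z3 : ∀ a : ℤ, (q ^ 3) ^ a = q ^ (3 * a) := fun a => by rw [zpow_mul, zpow_ofNat]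
      have e1 : splitVar N (q ^ 3) ((q ^ 3) ^ c * w) t =
          (-1) ^ (N + 1) * w ^ N * q ^ (3 * (h + N * t + c * N)) := by
        rw [splitVar, mul_pow, z3, n3, zc, zc, show 3 * (h + N * t + c * N) =
          3 * (h + N * t) + 3 * c * N by ring, zpow_add₀ hq0]
        ring
      have e2 : splitArg N c (q ^ 3) (q ^ e) =
          (-1) ^ (N + 1) * q ^ (3 * (h - c * N) + e * N) := by
        rw [splitArg, z3, zc, zpow_add₀ hq0]
        ring
      have e3 : (-1) ^ (N + 1) * q ^ (3 * (h - c * N) + e * N) *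
          ((-1) ^ (N + 1) * w ^ N * q ^ (3 * (h + N * t + c * N))) =
          w ^ N * q ^ (3 * (2 * h + N * t) + e * N) := by
        rw [show 3 * (2 * h + N * t) + e * N = 3 * (h - c * N) + e * N +
          3 * (h + N * t + c * N) by ring, zpow_add₀ hq0 _ (3 * (h + N * t + c * N))]
        linear_combination q ^ (3 * (h - c * N) + e * N) * w ^ N *
          q ^ (3 * (h + N * t + c * N)) * hss
      have e4 : ((q ^ 3)⁻¹ * q ^ e * w) ^ c * ((-1) ^ t * (q ^ 3) ^ ((t : ℤ) * (t - 1) / 2) *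
          ((q ^ 3) ^ c * w) ^ t) = w ^ c * (-1) ^ t * w ^ t *
          q ^ ((e - 3) * c + 3 * ((t : ℤ) * (t - 1) / 2) + 3 * c * t) := by
        rw [zpow_add₀ hq0, zpow_add₀ hq0, z3, mul_pow, mul_pow, mul_pow, n3, zc, zc, zc, inv_pow,
          zc, sub_mul, zpow_sub₀ hq0]
        ring
      have e5 : (-1) ^ (N + 1) * q ^ (3 * (h - c * N) + e * N) * w *
          ((-1) ^ (N + 1) * w ^ N * q ^ (3 * (h + N * t + c * N))) =
          w ^ N * w * q ^ (3 * (2 * h + N * t) + e * N) := by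
        rw [mul_right_comm, e3, mul_right_comm]
      have e6 : (-1) ^ (N + 1) * w ^ N * q ^ (3 * (h + N * t + c * N)) / w =
          (-1) ^ (N + 1) * w ^ N * w⁻¹ * q ^ (3 * (h + N * t + c * N)) := by
        rw [div_eq_mul_inv, mul_right_comm]
      rw [e1, e2, e5, e3, e4, e6, ← pow_mul q 3 (N ^ 2),
        mul_right_comm ((-1) ^ (N + 1)) (q ^ (3 * (h - c * N) + e * N)) w]
      simp only [zpow_zero, mul_one, div_eq_mul_inv]
      ring
  refine (isTheta_sum main).congr fun q hq0 hq => ?_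
  have h3 := norm_pow_lt_one hq (n := 3) (by norm_num)
  have h30 : q ^ 3 ≠ 0 := pow_ne_zero _ hq0
  have root : ∀ {ω : ℂ} (_ : IsOfFinOrder ω) (_ : ω ≠ 1) (e : ℤ) (n : ℕ),
      NotPower (ω * q ^ e) (q ^ n) := fun ho h1 e n => notPower_root_mul hq0 hq ho (.inl h1)
  have hX : splitArg N c (q ^ 3) (q ^ e) =
      (-1) ^ (N + 1) * q ^ (3 * (h - c * N) + e * N) := by
    rw [splitArg, ← zpow_natCast (q ^ e), ← zpow_mul, ← zpow_ofNat q 3, ← zpow_mul, zpow_add₀ hq0]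
    ring
  have hd := appellM_dissection h30 h3 hη hc (x := q ^ e) (w := w) (w₀ := w)
    (zpow_ne_zero _ hq0) hw0 hw0 (by simpa using root hw hw1 0 3)
    (by
      rw [mul_pow, mul_comm, ← zpow_natCast (q ^ e), ← zpow_mul]
      exact root hwp hwN _ 3)
    (by rw [← pow_mul]; simpa using root hw hw1 0 (3 * N ^ 2))
    (by
      rw [← pow_mul, hX, mul_right_comm]
      exact root (hs.mul hw) hws _ _)
  have e5 : (-q ^ e) ^ c * (q ^ 3) ^ (-((c : ℤ) * (c + 1) / 2)) =
      (-1) ^ c * q ^ (e * c - 3 * ((c : ℤ) * (c + 1) / 2)) := by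
    rw [neg_pow, ← zpow_natCast (q ^ e), ← zpow_mul, ← zpow_ofNat q 3, ← zpow_mul, zpow_sub₀ hq0,
      mul_neg, zpow_neg]
    ring
  simp only [hX] at hd ⊢
  rw [hd, e5, pow_mul q 3 (N ^ 2), add_sub_cancel_left]

end parts

/-! ### Functional equations of Appell–Lerch sums -/

section functionalEquations

variable {q : ℂ}

/-- The effect of multiplying the base variable of an Appell–Lerch sum by `q`. -/
lemma appellM_mul_left (hq0 : q ≠ 0) (hq : ‖q‖ < 1) {x z : ℂ} (hx : x ≠ 0) (hz : z ≠ 0)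
    (hzq : NotPower z q) (hu : NotPower (x * z) q) :
    appellM (q * x) q z = 1 - x * appellM x q z := by
  have hu0 := mul_ne_zero hx hz
  have h1 := (hasSum_thetaJ hq0 hq (mul_ne_zero (inv_ne_zero hq0) hz)).mul_left q
  have h2 := ((h1.add ((hasSum_appellA hq0 hq hz hu0 hu).mul_left (x * z))).mul_left (-z⁻¹))
  have h3 := (Equiv.addRight (1 : ℤ)).hasSum_iff.2 h2
  have h4 := (hasSum_appellA hq0 hq hz (mul_ne_zero hq0 hu0)
    ((notPower_mul_iff hq0).2 hu)).unique (hasSum_of_eq h3 (fun r => ?_) rfl)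
  · rw [appellM_eq, appellM_eq, mul_assoc q, h4, thetaJ_inv_mul_left hq0 hq hz]
    have := thetaJ_ne_zero hq hzq
    field_simp
    ring
  · simp only [Function.comp, Equiv.coe_addRight]
    have hd : 1 - q ^ r * (x * z) ≠ 0 := sub_ne_zero.2 (hu.zpow_mul_ne r).symm
    have e : (r + 1) * (r + 1 - 1) / 2 = r * (r - 1) / 2 + r := choose_succ r
    rw [add_sub_cancel_right] at e ⊢
    rw [e, mul_zpow, inv_zpow, zpow_add₀ hq0 _ r, zpow_add_one₀ hq0, zpow_add_one₀ hz,
      zpow_add_one₀ (by norm_num : (-1 : ℂ) ≠ 0), zpow_sub_one₀ hq0]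
    have hr : q ^ r ≠ 0 := zpow_ne_zero _ hq0
    generalize q ^ r = Y at *
    rw [show q * (x * z) = x * z * q by ring, show Y * q⁻¹ * (x * z * q) = Y * (x * z) by
      field_simp]
    obtain ⟨I, hI⟩ : ∃ I, (1 - Y * (x * z))⁻¹ = I := ⟨_, rfl⟩
    have hI' := mul_inv_cancel₀ hd
    rw [hI] at hI' ⊢
    field_simp
    linear_combination -hI'

/-- Inverting both variables of an Appell–Lerch sum. -/
lemma appellM_inv (hq : ‖q‖ < 1) (hq0 : q ≠ 0) {x z : ℂ} (hx : x ≠ 0) (hz : z ≠ 0)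
    (hu : NotPower (x * z) q) : appellM x⁻¹ q z⁻¹ = x * appellM x q z := by
  have hu0 := mul_ne_zero hx hz
  have h1 := (hasSum_appellA hq0 hq hz hu0 hu).mul_left (-(x * z⁻¹))
  have h2 := (Equiv.subLeft (2 : ℤ)).hasSum_iff.2 h1
  have h3 := (hasSum_appellA hq0 hq (inv_ne_zero hz) (inv_ne_zero hu0)
    (notPower_inv_iff.2 hu)).unique (hasSum_of_eq h2 (fun r => ?_) rfl)
  · rw [appellM_eq, appellM_eq, ← mul_inv, h3, thetaJ_inv hq hz]
    rw [mul_inv]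
    field_simp
  · simp only [Function.comp, Equiv.subLeft_apply]
    have hd : 1 - q ^ (2 - r - 1) * (x * z) ≠ 0 := sub_ne_zero.2 (hu.zpow_mul_ne _).symm
    have e : (2 - r) * (2 - r - 1) / 2 = r * (r - 1) / 2 - (r - 1) := by
      have h := choose_succ (r - 1)
      rw [sub_add_cancel] at h
      rw [h, show (2 - r) * (2 - r - 1) = (r - 1) * (r - 1 - 1) by ring]
      ring
    have e2 : q ^ (2 - r - 1) = (q ^ (r - 1))⁻¹ := by rw [← zpow_neg]; congr 1; ring
    rw [e2] at hd ⊢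
    rw [e, zpow_sub₀ hq0 _ (r - 1), inv_zpow, zpow_sub₀ (by norm_num : (-1 : ℂ) ≠ 0),
      zpow_sub₀ hz]
    have hr : q ^ (r - 1) ≠ 0 := zpow_ne_zero _ hq0
    have h1r : (-1 : ℂ) ^ r * (-1) ^ r = 1 := by rw [← mul_zpow]; norm_num
    have h1r' : ((-1 : ℂ) ^ r)⁻¹ = (-1) ^ r := inv_eq_of_mul_eq_one_left h1r
    rw [div_eq_mul_inv _ ((-1 : ℂ) ^ r), h1r']
    generalize q ^ (r - 1) = Y at *
    have hd1 : Y - x * z ≠ 0 := fun h => hd (by rw [← sub_eq_zero.1 h, inv_mul_cancel₀ hr, sub_self])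
    have hd2 : x * z - Y ≠ 0 := fun h => hd1 (by rw [← neg_sub, h, neg_zero])
    have e3 : (1 - Y * (x * z)⁻¹)⁻¹ = x * z / (x * z - Y) := by
      rw [← inv_div]; congr 1; field_simp
    have e4 : (1 - Y⁻¹ * (x * z))⁻¹ = -(Y / (x * z - Y)) := by
      rw [← inv_div, ← inv_neg]; congr 1; field_simp; ring
    rw [e3, e4]
    field_simp

/-- From the symmetry of the rank generating function. -/
lemma mockH_inv {x : ℂ} (hx0 : x ≠ 0) (hx : x ≠ 1) (q : ℂ) : mockH x⁻¹ q = -x * mockH x q := by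
  have h := rankSeries_inv x q
  rw [rankSeries_eq hx, rankSeries_eq (inv_ne_one.2 hx)] at h
  have h1 : 1 - x ≠ 0 := sub_ne_zero.2 hx.symm
  apply mul_left_cancel₀ h1
  have h2 : (1 - x) = -x * (1 - x⁻¹) := by field_simp; ring
  rw [h2, mul_assoc, h, ← h2]
  ring

end functionalEquations

/-! ### The Appell–Lerch parts of the deviation -/

section parts

/-- The monomial `(-1) ^ b q ^ (-b (b + 1) / 6)`. -/
noncomputable def lead (b : ℤ) (q : ℂ) : ℂ := (-1) ^ b * q ^ (-(b * (b + 1) / 6))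

/-- The Appell–Lerch sum that is, up to theta functions, the part of residue `⌊b / 3⌋` modulo `N` of
`m(q, q ^ 3, w)` if `b ≡ 0`, and of `q⁻¹ m(q⁻¹, q ^ 3, w)` if `b ≡ 2` modulo `3`. -/
noncomputable def part (N : ℕ) (w : ℂ) (b : ℤ) (q : ℂ) : ℂ :=
  lead b q * appellM (arg N q (N * (3 * N - 1 - 2 * b) / 2)) (q ^ (3 * N ^ 2)) w

lemma arg_natCast (N : ℕ) (q : ℂ) (e : ℤ) : arg N q e = (-1) ^ (N + 1) * q ^ e := by
  rw [arg, ← Nat.cast_succ, zpow_natCast]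

lemma arg_ne_zero {q : ℂ} (hq0 : q ≠ 0) (M e : ℤ) : arg M q e ≠ 0 :=
  mul_ne_zero (zpow_ne_zero _ (by norm_num)) (zpow_ne_zero _ hq0)

lemma two_dvd_partExp (N b : ℤ) : 2 * (N * (3 * N - 1 - 2 * b) / 2) = N * (3 * N - 1 - 2 * b) := by
  refine Int.mul_ediv_cancel' ?_
  rcases Int.even_or_odd N with h | h
  · exact h.two_dvd.mul_right _
  · refine Dvd.dvd.mul_left ?_ _
    obtain ⟨k, rfl⟩ := h
    exact ⟨3 * k + 1 - b, by ring⟩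

lemma six_mul_leadExp {b : ℤ} (hb : b % 3 = 0 ∨ b % 3 = 2) : 6 * (b * (b + 1) / 6) = b * (b + 1) := by
  refine Int.mul_ediv_cancel' ?_
  have h2 : (2 : ℤ) ∣ b * (b + 1) := (Int.even_mul_succ_self b).two_dvd
  have h3 : (3 : ℤ) ∣ b * (b + 1) := by
    rcases hb with h | h
    · exact (Int.dvd_of_emod_eq_zero h).mul_right _
    · exact Dvd.dvd.mul_left (by omega) _
  exact (Int.isCoprime_iff_gcd_eq_one.2 (by norm_num) : IsCoprime (2 : ℤ) 3).mul_dvd h2 h3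

lemma neg_one_zpow_mul_self (b : ℤ) : (-1 : ℂ) ^ b * (-1) ^ b = 1 := by
  rw [← mul_zpow]; norm_num

/-- A root of unity `w` with `w ^ (2 N) = -1` keeps clear of all poles and zeros at which the
Appell–Lerch sums `part N w b` and the theta quotients relating them would be undefined. -/
lemma root_conditions {N : ℕ} {w : ℂ} (hw : w ^ (2 * N) = -1) :
    IsOfFinOrder w ∧ w ^ N ≠ 1 ∧ w ≠ 1 ∧ (-1) ^ (N + 1) * w ≠ 1 ∧ 0 < N := by
  have hN : 0 < N := Nat.pos_of_ne_zero fun h => by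
    rw [h, mul_zero, pow_zero] at hw; norm_num at hw
  refine ⟨isOfFinOrder_iff_pow_eq_one.2 ⟨2 * N * 2, by omega, by rw [pow_mul, hw]; norm_num⟩,
    fun h => ?_, fun h => ?_, fun h => ?_, hN⟩
  · rw [mul_comm, pow_mul, h] at hw; norm_num at hw
  · rw [h, one_pow] at hw; norm_num at hw
  · have h1 := congrArg (· ^ (2 * N)) h
    simp only [one_pow, mul_pow, hw] at h1
    rw [← pow_mul, mul_left_comm, pow_mul] at h1
    norm_num at h1

variable {N : ℕ} {w : ℂ}

/-- The condition that `b ≡ 0` or `2` modulo `3` makes the exponents integral. -/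
lemma part_sub_part_add (hw : w ^ (2 * N) = -1) {b : ℤ} (hb : b % 3 = 0 ∨ b % 3 = 2) {q : ℂ}
    (hq0 : q ≠ 0) (hq : ‖q‖ < 1) : part N w b q - part N w (b + 3 * N) q = lead b q := by
  obtain ⟨hwo, -, hw1, hws, hN⟩ := root_conditions hw
  have hP : 3 * N ^ 2 ≠ 0 := by positivity
  have h := appellM_mul_left (pow_ne_zero _ hq0) (norm_pow_lt_one hq hP)
    (x := arg N q (N * (3 * N - 1 - 2 * (b + 3 * N)) / 2)) (z := w) (arg_ne_zero hq0 _ _)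
    (IsOfFinOrder.ne_zero' hwo)
    (by simpa using notPower_root_mul hq0 hq (e := 0) (n := 3 * N ^ 2) hwo (.inl hw1))
    (by
      rw [arg_natCast, mul_right_comm]
      exact notPower_root_mul hq0 hq ((isOfFinOrder_neg_one_pow _).mul hwo) (.inl hws))
  have e1 : (N : ℤ) * (3 * N - 1 - 2 * b) / 2 =
      (3 * N ^ 2 : ℕ) + N * (3 * N - 1 - 2 * (b + 3 * N)) / 2 := by
    have h1 := two_dvd_partExp N b
    have h2 := two_dvd_partExp N (b + 3 * N)
    push_cast
    linarith
  have e2 : lead (b + 3 * N) q =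
      -(lead b q * arg N q (N * (3 * N - 1 - 2 * (b + 3 * N)) / 2)) := by
    have h1 := six_mul_leadExp hb
    have h2 := six_mul_leadExp (b := b + 3 * N) (by omega)
    have h3 := two_dvd_partExp N (b + 3 * N)
    have e3 : -((b + 3 * N) * (b + 3 * N + 1) / 6) =
        -(b * (b + 1) / 6) + (N : ℤ) * (3 * N - 1 - 2 * (b + 3 * N)) / 2 := by
      linarith
    rw [lead, lead, arg, e3, zpow_add₀ hq0, zpow_add₀ (by norm_num : (-1 : ℂ) ≠ 0),
      zpow_add_one₀ (by norm_num : (-1 : ℂ) ≠ 0), zpow_mul]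
    norm_num
    ring
  have e4 : arg N q (N * (3 * N - 1 - 2 * b) / 2) =
      q ^ (3 * N ^ 2) * arg N q (N * (3 * N - 1 - 2 * (b + 3 * N)) / 2) := by
    rw [e1, arg, arg, zpow_add₀ hq0, zpow_natCast]
    ring
  rw [part, part, e4, h, e2]
  ring

lemma isTheta_part_symm (hw : w ^ (2 * N) = -1) {b b' : ℤ} (hb : b % 3 = 0 ∨ b % 3 = 2)
    (hbb : b' = 3 * N - 1 - b) :
    IsTheta (-1 / 24) fun q => part N w b q - part N w b' q := by
  obtain ⟨hwo, -, hw1, hws, hN⟩ := root_conditions hw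
  have hP : 0 < 3 * N ^ 2 := by positivity
  have hb' : b' % 3 = 0 ∨ b' % 3 = 2 := by omega
  have hs := isOfFinOrder_neg_one_pow (N + 1)
  have hss : (-1 : ℂ) ^ (N + 1) * (-1) ^ (N + 1) = 1 := by rw [← mul_pow]; norm_num
  have hws' : (-1) ^ (N + 1) * w⁻¹ ≠ 1 := fun h => hws (by
    have h1 := (mul_inv_eq_one₀ (IsOfFinOrder.ne_zero' hwo)).1 h
    rw [h1] at hss ⊢
    exact hss)
  refine ((isTheta_appellM_sub hs hwo (IsOfFinOrder.inv' hwo) hw1 (inv_ne_one.2 hw1) hws hws'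
    (N * (3 * N - 1 - 2 * b') / 2) hP).mul_monomial ((-1) ^ b') (-(b' * (b' + 1) / 6))
    (ν := -1 / 24) ?_).congr fun q hq0 hq => ?_
  · have h1 := six_mul_leadExp hb'
    have h2 := two_dvd_partExp N b'
    have hN0 : (N : ℚ) ≠ 0 := by exact_mod_cast hN.ne'
    have q1 : ((b' * (b' + 1) / 6 : ℤ) : ℚ) = b' * (b' + 1) / 6 := by
      rw [eq_div_iff (by norm_num), mul_comm]; exact_mod_cast h1
    have q2 : (((N : ℤ) * (3 * N - 1 - 2 * b') / 2 : ℤ) : ℚ) = N * (3 * N - 1 - 2 * b') / 2 := by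
      rw [eq_div_iff (by norm_num), mul_comm]; exact_mod_cast h2
    push_cast [q1, q2]
    field_simp
    ring
  · have h := appellM_inv (norm_pow_lt_one hq hP.ne') (pow_ne_zero _ hq0)
      (x := arg N q (N * (3 * N - 1 - 2 * b) / 2)) (z := w) (arg_ne_zero hq0 _ _)
      (IsOfFinOrder.ne_zero' hwo) (by
        rw [arg_natCast, mul_right_comm]
        exact notPower_root_mul hq0 hq (hs.mul hwo) (.inl hws))
    have h1 := six_mul_leadExp hb
    have h2 := six_mul_leadExp hb'
    have h3 := two_dvd_partExp N b
    have h4 := two_dvd_partExp N b'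
    have e1 : (arg N q (N * (3 * N - 1 - 2 * b) / 2))⁻¹ =
        arg N q (N * (3 * N - 1 - 2 * b') / 2) := by
      have e : (N : ℤ) * (3 * N - 1 - 2 * b') / 2 = -(N * (3 * N - 1 - 2 * b) / 2) := by
        subst hbb; linarith
      rw [e, arg, arg, mul_inv, zpow_neg, inv_eq_of_mul_eq_one_left (neg_one_zpow_mul_self _)]
    have e2 : lead b q = lead b' q * arg N q (N * (3 * N - 1 - 2 * b) / 2) := by
      have e : -(b * (b + 1) / 6) = -(b' * (b' + 1) / 6) + N * (3 * N - 1 - 2 * b) / 2 := by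
        subst hbb; linarith
      have e' : (-1 : ℂ) ^ b = (-1) ^ b' * (-1) ^ ((N : ℤ) + 1) := by
        rw [← zpow_add₀ (by norm_num)]
        have : b' + (N + 1) = b + 2 * (2 * N - b) := by rw [hbb]; ring
        rw [this, zpow_add₀ (by norm_num), zpow_mul]
        norm_num
      rw [lead, lead, arg, e, e', zpow_add₀ hq0]
      ring
    rw [part, part, e2, mul_assoc (lead b' q), ← h, e1, ← arg_natCast, lead]
    ring

lemma six_mul_argExp {m k : ℤ} (h3 : 3 ∣ k) (h2 : (m + k) % 2 = 1) :
    6 * (m * k / 6) = m * k := by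
  refine Int.mul_ediv_cancel' ?_
  refine (Int.isCoprime_iff_gcd_eq_one.2 (by norm_num) : IsCoprime (2 : ℤ) 3).mul_dvd ?_
    (h3.mul_left _)
  rcases Int.emod_two_eq_zero_or_one m with h | h
  · exact (Int.dvd_of_emod_eq_zero h).mul_right _
  · exact Dvd.dvd.mul_left (by omega) _

/-- The universal mock theta function at `x_b = (-1) ^ (N + 1) q ^ (N (N - 2 b - 1) / 6)` as a
difference of two parts.  The bounds on `b` exclude that `x_b` is a power of `q ^ (N ^ 2)`, except
for `x_b = 1`, that is `N = 2 b + 1`. -/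
lemma isTheta_mockH_sub (hw : w ^ (2 * N) = -1) {b : ℤ} (hb : b % 3 = 0 ∨ b % 3 = 2)
    (h3 : (3 : ℤ) ∣ N - 2 * b - 1) (hb1 : -(N : ℤ) ≤ b) (hb2 : b < 3 * N)
    (hne : (N : ℤ) ≠ 2 * b + 1) :
    IsTheta (-1 / 24) fun q => lead b q * mockH (arg N q (N * (N - 2 * b - 1) / 6)) (q ^ N ^ 2) -
      (part N w b q - part N w (b + 2 * N) q) := by
  obtain ⟨hwo, -, hw1, hws, hN⟩ := root_conditions hw
  have hP : 0 < N ^ 2 := by positivity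
  have hs := isOfFinOrder_neg_one_pow (N + 1)
  have hss : (-1 : ℂ) ^ (N + 1) * (-1) ^ (N + 1) = 1 := by rw [← mul_pow]; norm_num
  have hs3 : ((-1 : ℂ) ^ (N + 1)) ^ 3 = (-1) ^ (N + 1) := by
    rw [pow_succ, sq, hss, one_mul]
  have hf : 6 * ((N : ℤ) * (N - 2 * b - 1) / 6) = N * (N - 2 * b - 1) :=
    six_mul_argExp h3 (by omega)
  set f : ℤ := (N : ℤ) * (N - 2 * b - 1) / 6 with hfdef
  have hvis : (-1 : ℂ) ^ (N + 1) ≠ 1 ∨ ¬((N ^ 2 : ℕ) : ℤ) ∣ f := by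
    right
    rintro ⟨k, hk⟩
    have hN0 : (N : ℤ) ≠ 0 := by exact_mod_cast hN.ne'
    have h1 : (N : ℤ) - 2 * b - 1 = 6 * (N * k) := by
      apply mul_left_cancel₀ hN0
      rw [← hf, hk]
      push_cast
      ring
    have hk0 : k = 0 := by
      have hNp : (0 : ℤ) < N := by exact_mod_cast hN
      rcases lt_trichotomy k 0 with h | h | h
      · nlinarith
      · exact h
      · nlinarith
    rw [hk0] at h1
    omega
  have hL := six_mul_leadExp hb
  have hL2 := six_mul_leadExp (b := b + 2 * N) (by omega)
  have hE := two_dvd_partExp N b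
  have hE2 := two_dvd_partExp N (b + 2 * N)
  refine ((isTheta_mockTheta hs hwo hw1 (by rwa [hs3]) hP hvis).mul_monomial ((-1) ^ b)
    (-(b * (b + 1) / 6)) (ν := -1 / 24) ?_).neg.congr fun q hq0 hq => ?_
  · have hN0 : (N : ℚ) ≠ 0 := by exact_mod_cast hN.ne'
    have q1 : ((b * (b + 1) / 6 : ℤ) : ℚ) = b * (b + 1) / 6 := by
      rw [eq_div_iff (by norm_num), mul_comm]; exact_mod_cast hL
    have q2 : (f : ℚ) = N * (N - 2 * b - 1) / 6 := by
      rw [eq_div_iff (by norm_num), mul_comm]; exact_mod_cast hf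
    push_cast [q1, q2]
    field_simp
    ring
  · have hQ := norm_pow_lt_one hq hP.ne'
    have hx3 : arg N q f ^ 3 = (-1) ^ (N + 1) * q ^ (3 * f) := by
      rw [arg_natCast, mul_pow, hs3, mul_comm 3 f, zpow_mul, zpow_ofNat]
    have h := mockH_eq (pow_ne_zero (N ^ 2) hq0) hQ (x := arg N q f) (w := w) (arg_ne_zero hq0 _ _)
      (IsOfFinOrder.ne_zero' hwo) (by rw [arg_natCast]; exact notPower_root_mul hq0 hq hs hvis)
      (by simpa using notPower_root_mul hq0 hq (e := 0) (n := N ^ 2) hwo (.inl hw1))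
      (by
        rw [hx3, mul_right_comm]
        exact notPower_root_mul hq0 hq (hs.mul hwo) (.inl hws))
    have e1 : q ^ N ^ 2 * arg N q f ^ 3 = arg N q (N * (3 * N - 1 - 2 * b) / 2) := by
      have : (N : ℤ) * (3 * N - 1 - 2 * b) / 2 = (N ^ 2 : ℕ) + 3 * f := by push_cast; linarith
      rw [hx3, arg_natCast, this, zpow_add₀ hq0, zpow_natCast]
      ring
    have e2 : (q ^ N ^ 2)⁻¹ * arg N q f ^ 3 = arg N q (N * (3 * N - 1 - 2 * (b + 2 * N)) / 2) := by
      have : (N : ℤ) * (3 * N - 1 - 2 * (b + 2 * N)) / 2 = -(N ^ 2 : ℕ) + 3 * f := by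
        push_cast; linarith
      rw [hx3, arg_natCast, this, zpow_add₀ hq0, zpow_neg, zpow_natCast]
      ring
    have e3 : lead b q * (arg N q f ^ 2 * (q ^ N ^ 2)⁻¹) = lead (b + 2 * N) q := by
      have : -((b + 2 * N) * (b + 2 * N + 1) / 6) =
          -(b * (b + 1) / 6) + (2 * f - (N ^ 2 : ℕ)) := by push_cast; linarith
      rw [lead, lead, this, zpow_add₀ hq0, zpow_sub₀ hq0, zpow_natCast, arg_natCast, mul_pow,
        sq ((-1 : ℂ) ^ _), hss, mul_comm 2 f, zpow_mul, zpow_ofNat,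
        zpow_add₀ (by norm_num : (-1 : ℂ) ≠ 0), zpow_mul]
      norm_num
      ring
    rw [h, e1, e2, ← pow_mul, mul_comm (N ^ 2) 3, part, part, ← e3, ← arg_natCast, lead]
    ring

lemma mockH_arg {q : ℂ} (hq0 : q ≠ 0) (M e : ℤ) (Q : ℂ) :
    mockH (arg M q e) Q = 1 + arg M q e * mockG (arg M q e) Q :=
  (one_add_mul_mockG (arg_ne_zero hq0 _ _)).symm

/-- The variant of `isTheta_mockH_sub` obtained by inverting the argument of the universal mock
theta function. -/
lemma isTheta_mockG_sub (hw : w ^ (2 * N) = -1) {c : ℤ} (hc : c % 3 = 0 ∨ c % 3 = 2)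
    (h3 : (3 : ℤ) ∣ N + 2 * c + 1) (hc1 : -2 * (N : ℤ) ≤ c) (hc2 : c < 2 * N)
    (hne : (N : ℤ) + 2 * c + 1 ≠ 0) :
    IsTheta (-1 / 24) fun q => lead c q * (arg N q (N * (N + 2 * c + 1) / 6) *
      mockG (arg N q (N * (N + 2 * c + 1) / 6)) (q ^ N ^ 2)) -
      (part N w (c + N) q - part N w c q) := by
  refine (isTheta_mockH_sub hw (b := c + N) (by omega) (by omega) (by omega) (by omega)
    (by omega)).congr fun q hq0 hq => ?_
  have hN := (root_conditions hw).2.2.2.2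
  have h6 : 6 * ((N : ℤ) * (N + 2 * c + 1) / 6) = N * (N + 2 * c + 1) :=
    six_mul_argExp h3 (by omega)
  set f : ℤ := (N : ℤ) * (N + 2 * c + 1) / 6 with hf
  have hf' : (N : ℤ) * (N - 2 * (c + N) - 1) / 6 = -f := by
    rw [show (N : ℤ) * (N - 2 * (c + N) - 1) = 6 * -f by rw [mul_neg, h6]; ring]
    exact Int.mul_ediv_cancel_left _ (by norm_num)
  have hinv : arg N q (-f) = (arg N q f)⁻¹ := by
    rw [arg, arg, mul_inv, zpow_neg, inv_eq_of_mul_eq_one_left (neg_one_zpow_mul_self _)]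
  have hx1 : arg N q f ≠ 1 := fun h => by
    have h1 := congrArg norm h
    rw [arg, norm_mul, norm_zpow, norm_zpow, norm_neg, norm_one, one_zpow, one_mul] at h1
    have h2 : f = 0 :=
      zpow_right_injective₀ (norm_pos_iff.2 hq0) hq.ne (h1.trans (zpow_zero _).symm)
    rw [h2, mul_zero] at h6
    rcases mul_eq_zero.1 h6.symm with h | h
    · omega
    · exact hne h
  have hlead : lead (c + N) q * arg N q f = -lead c q := by
    have h1 := six_mul_leadExp hc
    have h2 := six_mul_leadExp (b := c + N) (by omega)
    have e : -(c * (c + 1) / 6) = -((c + N) * (c + N + 1) / 6) + f := by linarith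
    have h4 := neg_one_zpow_mul_self N
    have h5 : (-1 : ℂ) ≠ 0 := by norm_num
    rw [lead, lead, arg, e, zpow_add₀ hq0 _ f, zpow_add₀ h5, zpow_add_one₀ h5]
    linear_combination -((-1) ^ c * q ^ (-((c + N) * (c + N + 1) / 6)) * q ^ f) * h4
  have hp := part_sub_part_add hw hc hq0 hq
  rw [hf', hinv, mockH_inv (arg_ne_zero hq0 _ _) hx1, mockH_arg hq0,
    show c + N + 2 * (N : ℤ) = c + 3 * N by ring]
  linear_combination -hp - (1 + arg N q f * mockG (arg N q f) (q ^ N ^ 2)) * hlead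

end parts

/-! ### The deviation as a combination of four parts -/

section deviation

variable {M : ℕ} {ζ w : ℂ}

/-- The terms of `m(q ^ e, q ^ 3, w)` in which the exponent of a further variable, replaced by the
roots of unity `ζ ^ (3 j)`, matches `k`. -/
noncomputable def average (M : ℕ) (ζ w : ℂ) (e k : ℤ) (q : ℂ) : ℂ :=
  (M : ℂ)⁻¹ * ∑ j ∈ Finset.range M, (ζ ^ k) ^ j * appellM ((ζ ^ 3) ^ j * q ^ e) (q ^ 3) w

lemma isTheta_deviation_sub_average (hζ : IsPrimitiveRoot ζ M) (hw : w ^ (2 * M) = -1) (a : ℕ) :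
    IsTheta (-1 / 24) fun q => deviation a M q - (average M ζ w 1 (-a) q -
      average M ζ w 1 (1 - a) q - q⁻¹ * average M ζ w (-1) (2 - a) q +
      q⁻¹ * average M ζ w (-1) (3 - a) q) := by
  obtain ⟨hwo, -, hw1, -, hM⟩ := root_conditions hw
  have hζ0 : ζ ≠ 0 := hζ.ne_zero hM.ne'
  have hζo : IsOfFinOrder ζ := isOfFinOrder_iff_pow_eq_one.2 ⟨M, hM, hζ.pow_eq_one⟩
  have hj3w : ∀ j : ℕ, (ζ ^ j) ^ 3 * w ≠ 1 := fun j h => by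
    have h1 := congrArg (· ^ (2 * M)) h
    simp only [mul_pow, hw, one_pow] at h1
    rw [← pow_mul, ← pow_mul, show j * (3 * (2 * M)) = M * (j * 3 * 2) by ring, pow_mul,
      hζ.pow_eq_one] at h1
    norm_num at h1
  have hj1 : ∀ j ∈ Finset.Ico 1 M, ζ ^ j ≠ 1 := fun j hj h => by
    have h1 := Finset.mem_Ico.1 hj
    have := Nat.le_of_dvd (by omega) ((hζ.pow_eq_one_iff_dvd j).1 h)
    omega
  refine ((isTheta_sum (s := Finset.Ico 1 M) fun j hj =>
    ((isTheta_mockTheta (hζo.pow (n := j)) hwo hw1 (hj3w j) (f := 0) (n := 1) one_pos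
      (.inl (hj1 j hj))).const_mul ((ζ ^ (-(a : ℤ))) ^ j * (1 - ζ ^ j)))).mul_monomial
        (-(M : ℂ)⁻¹) 0 (by norm_num)).congr fun q hq0 hq => ?_
  · have hd := (hasSum_deviationTerm hq hM a hζ.inv).tsum_eq
    have hterm : ∀ j ∈ Finset.Ico 1 M, ζ⁻¹ ^ (j * a) * rankSeries (ζ⁻¹ ^ j) q =
        (ζ ^ (-(a : ℤ))) ^ j * (1 - ζ ^ j) * (appellM ((ζ ^ 3) ^ j * q) (q ^ 3) w -
          (ζ ^ j) ^ 2 * q⁻¹ * appellM ((ζ ^ 3) ^ j * q⁻¹) (q ^ 3) w -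
          mockTheta (ζ ^ j) q w) := fun j hj => by
      have root : ∀ {ω : ℂ} (_ : IsOfFinOrder ω) (_ : ω ≠ 1), NotPower ω q := fun ho h1 => by
        simpa using notPower_root_mul hq0 hq ho (e := 0) (n := 1) (.inl h1)
      rw [inv_pow ζ j, rankSeries_inv, rankSeries_eq (hj1 j hj),
        mockH_eq hq0 hq (pow_ne_zero _ hζ0) (IsOfFinOrder.ne_zero' hwo)
          (root (hζo.pow (n := j)) (hj1 j hj)) (root hwo hw1)
          (root (((hζo.pow (n := j)).pow (n := 3)).mul hwo) (hj3w j)),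
        mul_comm q, mul_comm q⁻¹ ((ζ ^ j) ^ 3), mul_comm j a, pow_mul, zpow_neg, zpow_natCast,
        inv_pow ζ a, ← pow_mul ζ j 3, mul_comm j 3, pow_mul ζ 3 j]
      ring
    rw [Finset.sum_congr rfl hterm] at hd
    have hsum : ∑ j ∈ Finset.Ico 1 M, (ζ ^ (-(a : ℤ))) ^ j * (1 - ζ ^ j) *
        (appellM ((ζ ^ 3) ^ j * q) (q ^ 3) w -
          (ζ ^ j) ^ 2 * q⁻¹ * appellM ((ζ ^ 3) ^ j * q⁻¹) (q ^ 3) w) =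
        ∑ j ∈ Finset.range M, (ζ ^ (-(a : ℤ))) ^ j * (1 - ζ ^ j) *
        (appellM ((ζ ^ 3) ^ j * q) (q ^ 3) w -
          (ζ ^ j) ^ 2 * q⁻¹ * appellM ((ζ ^ 3) ^ j * q⁻¹) (q ^ 3) w) := by
      rw [Finset.range_eq_Ico, Finset.sum_eq_sum_Ico_succ_bot hM]
      simp
    have hk : ∀ (j k : ℕ), (ζ ^ ((k : ℤ) - a)) ^ j = (ζ ^ (-(a : ℤ))) ^ j * (ζ ^ j) ^ k := by
      intro j k
      rw [sub_eq_add_neg, zpow_add₀ hζ0, zpow_natCast, mul_pow, mul_comm, ← pow_mul ζ k,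
        mul_comm k, pow_mul]
    have hk1 := fun j => hk j 1
    have hk2 := fun j => hk j 2
    have hk3 := fun j => hk j 3
    push_cast at hk1 hk2 hk3
    rw [deviation, hd]
    simp only [mul_sub _ _ (mockTheta _ _ _), Finset.sum_sub_distrib, hsum, average, zpow_one,
      zpow_neg_one, hk1, hk2, hk3, zpow_zero, mul_one, pow_one]
    have hc : ∑ j ∈ Finset.range M, (ζ ^ (-(a : ℤ))) ^ j * (1 - ζ ^ j) *
        (appellM ((ζ ^ 3) ^ j * q) (q ^ 3) w -
          (ζ ^ j) ^ 2 * q⁻¹ * appellM ((ζ ^ 3) ^ j * q⁻¹) (q ^ 3) w) =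
        ∑ j ∈ Finset.range M, (ζ ^ (-(a : ℤ))) ^ j * appellM ((ζ ^ 3) ^ j * q) (q ^ 3) w -
        ∑ j ∈ Finset.range M, (ζ ^ (-(a : ℤ))) ^ j * ζ ^ j *
          appellM ((ζ ^ 3) ^ j * q) (q ^ 3) w -
        q⁻¹ * ∑ j ∈ Finset.range M, (ζ ^ (-(a : ℤ))) ^ j * (ζ ^ j) ^ 2 *
          appellM ((ζ ^ 3) ^ j * q⁻¹) (q ^ 3) w +
        q⁻¹ * ∑ j ∈ Finset.range M, (ζ ^ (-(a : ℤ))) ^ j * (ζ ^ j) ^ 3 *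
          appellM ((ζ ^ 3) ^ j * q⁻¹) (q ^ 3) w := by
      rw [Finset.mul_sum, Finset.mul_sum, ← Finset.sum_sub_distrib, ← Finset.sum_sub_distrib,
        ← Finset.sum_add_distrib]
      exact Finset.sum_congr rfl fun j _ => by ring
    linear_combination -(M : ℂ)⁻¹ * hc

variable {N : ℕ}

lemma average_eq_zero (hζ : IsPrimitiveRoot ζ M) (hM : M = 3 * N) (hN : 0 < N) {k : ℤ}
    (hk : ¬3 ∣ k) (e : ℤ) (q : ℂ) : average M ζ w e k q = 0 := by
  set f : ℕ → ℂ := fun j => (ζ ^ k) ^ j * appellM ((ζ ^ 3) ^ j * q ^ e) (q ^ 3) w with hf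
  have h3 : (ζ ^ 3) ^ N = 1 := by rw [← pow_mul, ← hM, hζ.pow_eq_one]
  have hstep : ∀ j, f (N + j) = (ζ ^ k) ^ N * f j := fun j => by
    simp only [hf, pow_add, h3, one_mul]
    ring
  have hρ : (ζ ^ k) ^ N ≠ 1 := fun h => hk (by
    rw [← zpow_natCast, ← zpow_mul, hζ.zpow_eq_one_iff_dvd, hM] at h
    obtain ⟨l, hl⟩ := h
    refine ⟨l, ?_⟩
    have : (N : ℤ) ≠ 0 := by exact_mod_cast hN.ne'
    apply mul_right_cancel₀ this
    rw [hl]; push_cast; ring)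
  have hρ3 : ((ζ ^ k) ^ N) ^ 3 = 1 := by
    rw [← pow_mul, mul_comm N, ← hM, ← zpow_natCast, ← zpow_mul, mul_comm, zpow_mul, zpow_natCast,
      hζ.pow_eq_one, one_zpow]
  have hsum : ∑ j ∈ Finset.range M, f j = 0 := by
    rw [hM, show 3 * N = N + (N + N) by ring, Finset.sum_range_add]
    simp only [hstep]
    rw [Finset.sum_range_add]
    simp only [hstep, ← Finset.mul_sum]
    generalize (ζ ^ k) ^ N = ρ at *
    apply mul_left_cancel₀ (sub_ne_zero.2 hρ)
    linear_combination (∑ i ∈ Finset.range N, f i) * hρ3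
  rw [average, hsum, mul_zero]

lemma average_eq (hζ : IsPrimitiveRoot ζ M) (hM : M = N ∨ M = 3 * N) (hN : 0 < N) {k c : ℤ}
    (hk : (M : ℤ) ∣ k + 3 * c) (e : ℤ) (q : ℂ) : average M ζ w e k q =
      (N : ℂ)⁻¹ * ∑ j ∈ Finset.range N,
        ((ζ ^ 3) ^ (-c)) ^ j * appellM ((ζ ^ 3) ^ j * q ^ e) (q ^ 3) w := by
  have hM0 : 0 < M := by omega
  have hζ0 : ζ ≠ 0 := hζ.ne_zero hM0.ne'
  have hk1 : ζ ^ k = (ζ ^ 3) ^ (-c) := by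
    have h := (hζ.zpow_eq_one_iff_dvd _).2 hk
    rw [zpow_add₀ hζ0] at h
    rw [zpow_neg, ← zpow_natCast, ← zpow_mul]
    exact eq_inv_of_mul_eq_one_left h
  rw [average, hk1]
  rcases hM with rfl | hM
  · rfl
  · set f : ℕ → ℂ := fun j =>
      ((ζ ^ 3) ^ (-c)) ^ j * appellM ((ζ ^ 3) ^ j * q ^ e) (q ^ 3) w with hf
    have h3 : (ζ ^ 3) ^ N = 1 := by rw [← pow_mul, ← hM, hζ.pow_eq_one]
    have h3c : ((ζ ^ 3) ^ (-c)) ^ N = 1 := by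
      rw [← zpow_natCast, ← zpow_mul, mul_comm, zpow_mul, zpow_natCast, h3, one_zpow]
    have hstep : ∀ j, f (N + j) = f j := fun j => by
      simp only [hf, pow_add, h3, h3c, one_mul]
    have hsum : ∑ j ∈ Finset.range M, f j = 3 * ∑ j ∈ Finset.range N, f j := by
      rw [hM, show 3 * N = N + (N + N) by ring, Finset.sum_range_add]
      simp only [hstep]
      rw [Finset.sum_range_add]
      simp only [hstep]
      ring
    have : (N : ℂ) ≠ 0 := by exact_mod_cast hN.ne'
    rw [hsum, hM]
    push_cast
    field_simp

lemma isTheta_average_sub_part (hζ : IsPrimitiveRoot ζ M) (hη : IsPrimitiveRoot (ζ ^ 3) N)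
    (hM : M = N ∨ M = 3 * N) (hw : w ^ (2 * N) = -1) {k b : ℤ} (hb : b % 3 = 0) (hb0 : 0 ≤ b)
    (hb1 : b < 3 * N) (hk : (M : ℤ) ∣ k + b) :
    IsTheta (-1 / 24) fun q => average M ζ w 1 k q - part N w b q := by
  obtain ⟨hwo, hwN, hw1, hws, hN⟩ := root_conditions hw
  obtain ⟨c, hc⟩ : ∃ c : ℕ, b = 3 * c := ⟨(b / 3).toNat, by omega⟩
  have h := (isTheta_dissection hη (c := c) (by omega) hwo hwN hws 1).mul_monomial 1 0
    (ν := -1 / 24) (by norm_num)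
  refine h.congr fun q hq0 hq => ?_
  have h1 := two_mul_choose N
  have h2 := two_mul_choose (c + 1)
  have h3 := two_dvd_partExp N b
  have h4 := six_mul_leadExp (.inl hb)
  rw [add_sub_cancel_right] at h2
  rw [average_eq hζ hM hN (c := c) (by rwa [← hc]), part, arg_natCast, lead]
  have e1 : 3 * ((N : ℤ) * (N - 1) / 2 - c * N) + 1 * N = N * (3 * N - 1 - 2 * b) / 2 := by
    subst hc; linarith
  have e2 : 1 * (c : ℤ) - 3 * (c * (c + 1) / 2) = -(b * (b + 1) / 6) := by
    subst hc; rw [mul_comm (c : ℤ) (c + 1)]; linarith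
  have e3 : (-1 : ℂ) ^ b = (-1) ^ c := by
    rw [hc, zpow_mul, zpow_natCast]; norm_num
  rw [e1, e2, e3]
  simp

lemma isTheta_inv_mul_average_sub_part (hζ : IsPrimitiveRoot ζ M) (hη : IsPrimitiveRoot (ζ ^ 3) N)
    (hM : M = N ∨ M = 3 * N) (hw : w ^ (2 * N) = -1) {k b : ℤ} (hb : b % 3 = 2) (hb0 : 2 ≤ b)
    (hb1 : b < 3 * N + 2) (hk : (M : ℤ) ∣ k + b - 2) :
    IsTheta (-1 / 24) fun q => q⁻¹ * average M ζ w (-1) k q - part N w b q := by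
  obtain ⟨hwo, hwN, hw1, hws, hN⟩ := root_conditions hw
  obtain ⟨c, hc⟩ : ∃ c : ℕ, b = 3 * c + 2 := ⟨((b - 2) / 3).toNat, by omega⟩
  have h := (isTheta_dissection hη (c := c) (by omega) hwo hwN hws (-1)).mul_monomial 1 (-1)
    (ν := -1 / 24) (by norm_num)
  refine h.congr fun q hq0 hq => ?_
  have h1 := two_mul_choose N
  have h2 := two_mul_choose (c + 1)
  have h3 := two_dvd_partExp N b
  have h4 := six_mul_leadExp (.inr hb)
  rw [add_sub_cancel_right] at h2
  rw [average_eq hζ hM hN (c := c) (by rwa [show k + 3 * (c : ℤ) = k + b - 2 by rw [hc]; ring]),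
    part, arg_natCast, lead]
  have e1 : 3 * ((N : ℤ) * (N - 1) / 2 - c * N) + -1 * N = N * (3 * N - 1 - 2 * b) / 2 := by
    subst hc; linarith
  have e2 : -(b * (b + 1) / 6) = -1 + (-1 * (c : ℤ) - 3 * (c * (c + 1) / 2)) := by
    subst hc; rw [mul_comm (c : ℤ) (c + 1)]; linarith
  have e3 : (-1 : ℂ) ^ b = (-1) ^ c := by
    rw [hc, zpow_add₀ (by norm_num), zpow_mul, zpow_natCast]; norm_num
  rw [e1, e2, e3, zpow_add₀ hq0, zpow_neg_one]
  ring

/-- The deviation for `3 ∤ M` as a combination of four parts. -/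
lemma isTheta_deviation_sub_parts (hM3 : ¬3 ∣ M) (hw : w ^ (2 * M) = -1) (a : ℕ)
    {b₀ b₁ b₂ b₃ : ℤ} (h0 : b₀ % 3 = 0) (h00 : 0 ≤ b₀) (h01 : b₀ < 3 * M)
    (h02 : (M : ℤ) ∣ -a + b₀) (h1 : b₁ % 3 = 0) (h10 : 0 ≤ b₁) (h11 : b₁ < 3 * M)
    (h12 : (M : ℤ) ∣ 1 - a + b₁) (h2 : b₂ % 3 = 2) (h20 : 2 ≤ b₂) (h21 : b₂ < 3 * M + 2)
    (h22 : (M : ℤ) ∣ -a + b₂) (h3 : b₃ % 3 = 2) (h30 : 2 ≤ b₃) (h31 : b₃ < 3 * M + 2)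
    (h32 : (M : ℤ) ∣ 1 - a + b₃) :
    IsTheta (-1 / 24) fun q => deviation a M q -
      (part M w b₀ q - part M w b₁ q - part M w b₂ q + part M w b₃ q) := by
  have hM : 0 < M := (root_conditions hw).2.2.2.2
  have hζ := Complex.isPrimitiveRoot_exp M hM.ne'
  have hη := hζ.pow_of_coprime 3 ((Nat.Prime.coprime_iff_not_dvd Nat.prime_three).2 hM3)
  refine ((((isTheta_deviation_sub_average hζ hw a).add
    (isTheta_average_sub_part hζ hη (.inl rfl) hw h0 h00 h01 h02)).sub
    (isTheta_average_sub_part hζ hη (.inl rfl) hw h1 h10 h11 h12)).sub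
    (isTheta_inv_mul_average_sub_part hζ hη (.inl rfl) hw (k := 2 - a) h2 h20 h21
      (by rwa [show (2 : ℤ) - a + b₂ - 2 = -a + b₂ by ring]))).add
    (isTheta_inv_mul_average_sub_part hζ hη (.inl rfl) hw (k := 3 - a) h3 h30 h31
      (by rwa [show (3 : ℤ) - a + b₃ - 2 = 1 - a + b₃ by ring])) |>.congr fun q hq0 hq => ?_
  ring

end deviation

/-! ### The cases with `M` not divisible by three -/

section notDvd

variable {M : ℕ}

lemma exists_pow_two_mul_eq_neg_one (hM : 0 < M) : ∃ w : ℂ, w ^ (2 * M) = -1 := by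
  obtain ⟨w, hw⟩ := IsAlgClosed.exists_pow_nat_eq (-1 : ℂ) (n := 2 * M) (by omega)
  exact ⟨w, hw⟩

lemma neg_one_zpow_eq {s t : ℤ} (h : (s - t) % 2 = 0) : (-1 : ℂ) ^ s = (-1) ^ t := by
  obtain ⟨k, hk⟩ := Int.dvd_of_emod_eq_zero h
  rw [show s = t + 2 * k by omega, zpow_add₀ (by norm_num), zpow_mul]
  norm_num

lemma lead_mul_arg {q : ℂ} (hq0 : q ≠ 0) {m b e s Z : ℤ} (hb : b % 3 = 0 ∨ b % 3 = 2)
    (hs : (s - (m + b + 1)) % 2 = 0) (hZ : Z = 6 * e - b * (b + 1)) :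
    lead b q * arg m q e = (-1) ^ s * q ^ (Z / 6) := by
  have h := six_mul_leadExp hb
  have e1 : Z / 6 = -(b * (b + 1) / 6) + e := by rw [hZ]; omega
  rw [e1, neg_one_zpow_eq hs, lead, arg, zpow_add₀ hq0, show m + b + 1 = b + (m + 1) by ring,
    zpow_add₀ (by norm_num) b (m + 1)]
  ring

lemma neg_lead_mul_arg {q : ℂ} (hq0 : q ≠ 0) {m b e s Z : ℤ} (hb : b % 3 = 0 ∨ b % 3 = 2)
    (hs : (s - (m + b)) % 2 = 0) (hZ : Z = 6 * e - b * (b + 1)) :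
    -(lead b q * arg m q e) = (-1) ^ s * q ^ (Z / 6) := by
  rw [lead_mul_arg hq0 hb (s := s + 1) (by omega) hZ, zpow_add_one₀ (by norm_num)]
  ring

lemma deviation_one (q : ℂ) (hq : ‖q‖ < 1) : deviation 0 1 q = 0 := by
  rw [deviation, (hasSum_deviationTerm hq one_pos 0 IsPrimitiveRoot.one).tsum_eq]
  simp

lemma isTheta_mock1 {a : ℕ} (haM : a < M) (hM : M % 3 = 1) (ha : a % 3 ≠ 1) :
    IsTheta (-1 / 24) fun q => deviation a M q - mock1 a M q := by
  obtain ⟨w, hw⟩ := exists_pow_two_mul_eq_neg_one (show 0 < M by omega)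
  have hM3 : ¬3 ∣ M := by omega
  have hQ : ∀ q : ℂ, q ^ ((M : ℤ) ^ 2) = q ^ M ^ 2 := fun q => by
    rw [← Nat.cast_pow, zpow_natCast]
  by_cases ha2 : a % 3 = 2
  · have hD := isTheta_deviation_sub_parts hM3 hw a (b₀ := a + M) (b₁ := a - 1 + 2 * M) (b₂ := a)
      (b₃ := a - 1 + M) (by omega) (by omega) (by omega) ⟨1, by ring⟩ (by omega) (by omega)
      (by omega) ⟨2, by ring⟩ (by omega) (by omega) (by omega) ⟨0, by ring⟩ (by omega) (by omega)
      (by omega) ⟨1, by ring⟩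
    have hU := isTheta_mockG_sub hw (c := a) (by omega) (by omega) (by omega) (by omega) (by omega)
    have hV := isTheta_mockG_sub hw (c := a - 1 + M) (by omega) (by omega) (by omega) (by omega)
      (by omega)
    refine ((hD.sub hU).add hV).congr fun q hq0 hq => ?_
    rw [mock1, if_neg (by omega), if_neg (by omega), if_neg (by omega), if_neg (by omega), hQ,
      ← lead_mul_arg hq0 (b := a) (m := M) (e := M * (M + 2 * a + 1) / 6) (by omega) (by omega)
        (by rw [six_mul_argExp (by omega) (by omega)]),
      ← neg_lead_mul_arg hq0 (b := a - 1 + M) (m := M) (e := M * (M + 2 * (a - 1 + M) + 1) / 6)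
        (by omega) (by omega) (by rw [six_mul_argExp (by omega) (by omega)]; ring),
      show (3 : ℤ) * M + 2 * a - 1 = M + 2 * (a - 1 + M) + 1 by ring,
      show (a : ℤ) - 1 + 2 * M = a - 1 + M + M by ring]
    ring
  have ha0 : a % 3 = 0 := by omega
  by_cases hz : a = 0
  · subst hz
    by_cases hM1 : M = 1
    · subst hM1
      refine (isTheta_zero _).congr fun q hq0 hq => ?_
      rw [deviation_one q hq, mock1, if_pos (by simp), sub_zero]
    have hD := isTheta_deviation_sub_parts hM3 hw 0 (b₀ := 0) (b₁ := -1 + M) (b₂ := 0 + 2 * M)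
      (b₃ := -1 + 3 * M) (by omega) (by omega) (by omega) ⟨0, by simp⟩ (by omega) (by omega)
      (by omega) ⟨1, by simp⟩ (by omega) (by omega) (by omega) ⟨2, by simp; ring⟩ (by omega)
      (by omega) (by omega) ⟨3, by simp; ring⟩
    have hU := isTheta_mockG_sub hw (c := -1) (by omega) (by omega) (by omega) (by omega) (by omega)
    have hV := isTheta_mockH_sub hw (b := 0) (by omega) (by omega) (by omega) (by omega) (by omega)
    refine ((hD.sub hV).add hU).congr fun q hq0 hq => ?_
    have hp := part_sub_part_add hw (b := -1) (by omega) hq0 hq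
    have l0 : lead 0 q = 1 := by simp [lead]
    have l1 : lead (-1) q = -1 := by simp [lead]
    rw [l1] at hp
    rw [mock1, if_neg (by simp; omega), if_pos (by simp), mockH_arg hq0, l0, l1,
      show (M : ℤ) + 2 * (-1) + 1 = M - 1 by ring, show (M : ℤ) - 2 * 0 - 1 = M - 1 by ring, hQ]
    have ea : arg M q (M * (M - 1) / 6) = (-1) ^ ((M : ℤ) + 1) * q ^ ((M : ℤ) * (M - 1) / 6) := rfl
    linear_combination hp - 2 * mockG (arg M q (M * (M - 1) / 6)) (q ^ M ^ 2) * ea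
  · have hD := isTheta_deviation_sub_parts hM3 hw a (b₀ := a) (b₁ := a - 1 + M) (b₂ := a + 2 * M)
      (b₃ := a - 1) (by omega) (by omega) (by omega) ⟨0, by ring⟩ (by omega) (by omega)
      (by omega) ⟨1, by ring⟩ (by omega) (by omega) (by omega) ⟨2, by ring⟩ (by omega) (by omega)
      (by omega) ⟨0, by ring⟩
    have hU := isTheta_mockG_sub hw (c := a - 1) (by omega) (by omega) (by omega) (by omega)
      (by omega)
    rw [show (M : ℤ) + 2 * (a - 1) + 1 = M + 2 * a - 1 by ring] at hU
    by_cases h2 : M = 2 * a + 1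
    · have hS := isTheta_part_symm hw (b := a) (b' := a + 2 * M) (by omega) (by omega)
      refine ((hD.add hU).add hS).congr fun q hq0 hq => ?_
      have e1 : arg M q (M * (M + 2 * a - 1) / 6) = q ^ (2 * (a : ℤ) * M / 3) := by
        rw [arg, show (M : ℤ) + 1 = 2 * (a + 1) by omega, zpow_mul]
        rw [show (M : ℤ) * (M + 2 * a - 1) = 2 * a * M * 2 by
          rw [show (M : ℤ) + 2 * a - 1 = 2 * a * 2 by omega]; ring,
          show (6 : ℤ) = 3 * 2 by norm_num, Int.mul_ediv_mul_of_pos_left _ _ (by norm_num)]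
        norm_num
      rw [mock1, if_neg (by omega), if_neg (by omega), if_neg (by omega), if_pos (by omega), hQ,
        ← neg_lead_mul_arg hq0 (b := a - 1) (m := M) (e := M * (M + 2 * a - 1) / 6) (by omega)
          (by omega) (by
            rw [six_mul_argExp (by omega) (by omega), show (M : ℤ) = 2 * a + 1 by omega]; ring), ← e1]
      ring
    · have hV := isTheta_mockH_sub hw (b := a) (by omega) (by omega) (by omega) (by omega) (by omega)
      refine ((hD.add hU).sub hV).congr fun q hq0 hq => ?_
      rw [mock1, if_neg (by omega), if_neg (by omega), if_pos (by omega), hQ,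
        ← lead_mul_arg hq0 (b := a) (m := M) (e := M * (M - 2 * a - 1) / 6) (by omega) (by omega)
          (by rw [six_mul_argExp (by omega) (by omega)]),
        ← neg_lead_mul_arg hq0 (b := a - 1) (m := M) (e := M * (M + 2 * a - 1) / 6) (by omega)
          (by omega) (by rw [six_mul_argExp (by omega) (by omega)]; ring), mockH_arg hq0,
        ← lead]
      ring

lemma isTheta_mock2 {a : ℕ} (haM : a < M) (hM : M % 3 = 2) (ha : a % 3 ≠ 2) :
    IsTheta (-1 / 24) fun q => deviation a M q - mock2 a M q := by
  obtain ⟨w, hw⟩ := exists_pow_two_mul_eq_neg_one (show 0 < M by omega)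
  have hM3 : ¬3 ∣ M := by omega
  have hQ : ∀ q : ℂ, q ^ ((M : ℤ) ^ 2) = q ^ M ^ 2 := fun q => by
    rw [← Nat.cast_pow, zpow_natCast]
  by_cases ha1 : a % 3 = 1
  · have hD := isTheta_deviation_sub_parts hM3 hw a (b₀ := a + M) (b₁ := a - 1) (b₂ := a + 2 * M)
      (b₃ := a - 1 + M) (by omega) (by omega) (by omega) ⟨1, by ring⟩ (by omega) (by omega)
      (by omega) ⟨0, by ring⟩ (by omega) (by omega) (by omega) ⟨2, by ring⟩ (by omega) (by omega)
      (by omega) ⟨1, by ring⟩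
    have hU := isTheta_mockG_sub hw (c := a - 1) (by omega) (by omega) (by omega) (by omega)
      (by omega)
    have hV := isTheta_mockH_sub hw (b := a - M) (by omega) (by omega) (by omega) (by omega)
      (by omega)
    refine ((hD.sub hU).add hV).congr fun q hq0 hq => ?_
    have hp := part_sub_part_add hw (b := a - M) (by omega) hq0 hq
    rw [mock2, if_neg (by omega), if_neg (by omega), if_neg (by omega), hQ,
      ← lead_mul_arg hq0 (b := a - 1) (m := M) (e := M * (M + 2 * a - 1) / 6) (by omega)
        (by omega) (by rw [six_mul_argExp (by omega) (by omega)]; ring),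
      ← neg_lead_mul_arg hq0 (b := a - M) (m := M) (e := M * (3 * M - 2 * a - 1) / 6)
        (by omega) (by omega) (by rw [six_mul_argExp (by omega) (by omega)]; ring),
      show (M : ℤ) + 2 * (a - 1) + 1 = M + 2 * a - 1 by ring,
      show (M : ℤ) - 2 * (a - M) - 1 = 3 * M - 2 * a - 1 by ring, mockH_arg hq0,
      show (a : ℤ) - M + 2 * M = a + M by ring]
    rw [show (a : ℤ) - M + 3 * M = a + 2 * M by ring] at hp
    linear_combination -hp
  have ha0 : a % 3 = 0 := by omega
  have hU := isTheta_mockG_sub hw (c := a) (by omega) (by omega) (by omega) (by omega) (by omega)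
  by_cases hz : a = 0
  · subst hz
    have hD := isTheta_deviation_sub_parts hM3 hw 0 (b₀ := 0) (b₁ := -1 + 2 * M) (b₂ := 0 + M)
      (b₃ := -1 + 3 * M) (by omega) (by omega) (by omega) ⟨0, by simp⟩ (by omega) (by omega)
      (by omega) ⟨2, by simp; ring⟩ (by omega) (by omega) (by omega) ⟨1, by simp⟩ (by omega)
      (by omega) (by omega) ⟨3, by simp; ring⟩
    have hV := isTheta_mockH_sub hw (b := -1) (by omega) (by omega) (by omega) (by omega) (by omega)
    refine ((hD.sub hV).add hU).congr fun q hq0 hq => ?_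
    have hp := part_sub_part_add hw (b := -1) (by omega) hq0 hq
    have l0 : lead 0 q = 1 := by simp [lead]
    have l1 : lead (-1) q = -1 := by simp [lead]
    rw [l1] at hp
    rw [mock2, if_pos (by simp), mockH_arg hq0, Nat.cast_zero, l0, l1,
      show (M : ℤ) + 2 * 0 + 1 = M + 1 by ring, show (M : ℤ) - 2 * (-1) - 1 = M + 1 by ring, hQ]
    have ea : arg M q (M * (M + 1) / 6) = (-1) ^ ((M : ℤ) + 1) * q ^ ((M : ℤ) * (M + 1) / 6) := rfl
    rw [zpow_add_one₀ (by norm_num)] at ea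
    linear_combination hp + 2 * mockG (arg M q (M * (M + 1) / 6)) (q ^ M ^ 2) * ea
  · have hD := isTheta_deviation_sub_parts hM3 hw a (b₀ := a) (b₁ := a - 1 + 2 * M) (b₂ := a + M)
      (b₃ := a - 1) (by omega) (by omega) (by omega) ⟨0, by ring⟩ (by omega) (by omega)
      (by omega) ⟨2, by ring⟩ (by omega) (by omega) (by omega) ⟨1, by ring⟩ (by omega) (by omega)
      (by omega) ⟨0, by ring⟩
    by_cases h2 : M = 2 * a - 1
    · have hS := isTheta_part_symm hw (b := a - 1) (b' := a - 1 + 2 * M) (by omega) (by omega)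
      refine ((hD.add hU).add hS).congr fun q hq0 hq => ?_
      have e1 : arg M q (M * (M + 2 * a + 1) / 6) = q ^ (2 * (a : ℤ) * M / 3) := by
        rw [arg, show (M : ℤ) + 1 = 2 * a by omega, zpow_mul]
        rw [show (M : ℤ) * (M + 2 * a + 1) = 2 * a * M * 2 by
          rw [show (M : ℤ) + 2 * a + 1 = 2 * a * 2 by omega]; ring,
          show (6 : ℤ) = 3 * 2 by norm_num, Int.mul_ediv_mul_of_pos_left _ _ (by norm_num)]
        norm_num
      rw [mock2, if_neg (by omega), if_neg (by omega), if_pos (by omega), hQ,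
        ← neg_lead_mul_arg hq0 (b := a) (m := M) (e := M * (M + 2 * a + 1) / 6) (by omega)
          (by omega) (by
            rw [six_mul_argExp (by omega) (by omega), show (M : ℤ) = 2 * a - 1 by omega]; ring), ← e1]
      ring
    · have hV := isTheta_mockH_sub hw (b := a - 1) (by omega) (by omega) (by omega) (by omega)
        (by omega)
      refine ((hD.add hU).sub hV).congr fun q hq0 hq => ?_
      have el : lead (a - 1) q = (-1) ^ ((a : ℤ) + 1) * q ^ (-((a : ℤ) * (a - 1) / 6)) := by
        rw [lead, neg_one_zpow_eq (s := (a : ℤ) - 1) (t := a + 1) (by omega), sub_add_cancel,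
          mul_comm ((a : ℤ) - 1)]
      rw [mock2, if_neg (by omega), if_pos (by omega), hQ, ← el,
        ← lead_mul_arg hq0 (b := a - 1) (m := M) (e := M * (M - 2 * a + 1) / 6) (by omega)
          (by omega) (by rw [six_mul_argExp (by omega) (by omega)]; ring),
        ← neg_lead_mul_arg hq0 (b := a) (m := M) (e := M * (M + 2 * a + 1) / 6) (by omega)
          (by omega) (by rw [six_mul_argExp (by omega) (by omega)]), mockH_arg hq0,
        show (M : ℤ) - 2 * (a - 1) - 1 = M - 2 * a + 1 by ring]
      ring

end notDvd

/-! ### The cases with `M` divisible by three -/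

section dvd

variable {N : ℕ} {w : ℂ}

/-- The base variable `(-1) ^ (N + 1) q ^ (N (3 N - 1 - 2 b) / 2)` of the Appell–Lerch sum in
`part N w b q`. -/
noncomputable def partArg (N : ℕ) (b : ℤ) (q : ℂ) : ℂ := arg N q (N * (3 * N - 1 - 2 * b) / 2)

lemma partArg_eq (N : ℕ) (b : ℤ) (q : ℂ) :
    partArg N b q = (-1) ^ (N + 1) * q ^ ((N : ℤ) * (3 * N - 1 - 2 * b) / 2) :=
  arg_natCast N q _

lemma partArg_ne_zero {q : ℂ} (hq0 : q ≠ 0) (N : ℕ) (b : ℤ) : partArg N b q ≠ 0 :=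
  arg_ne_zero hq0 _ _

lemma partArg_sub_one {q : ℂ} (hq0 : q ≠ 0) (N : ℕ) (b : ℤ) :
    partArg N (b - 1) q = q ^ N * partArg N b q := by
  have h1 := two_dvd_partExp N b
  have h2 := two_dvd_partExp N (b - 1)
  have e : (N : ℤ) * (3 * N - 1 - 2 * (b - 1)) / 2 = N + N * (3 * N - 1 - 2 * b) / 2 := by linarith
  rw [partArg_eq, partArg_eq, e, zpow_add₀ hq0, zpow_natCast]
  ring

lemma notPower_partArg_mul {q : ℂ} (hq0 : q ≠ 0) (hq : ‖q‖ < 1) {ω : ℂ} (hω : IsOfFinOrder ω)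
    (h : (-1) ^ (N + 1) * ω ≠ 1) (b : ℤ) : NotPower (partArg N b q * ω) (q ^ (3 * N ^ 2)) := by
  rw [partArg_eq, mul_right_comm]
  exact notPower_root_mul hq0 hq ((isOfFinOrder_neg_one_pow _).mul hω) (.inl h)

lemma notPower_root {q : ℂ} (hq0 : q ≠ 0) (hq : ‖q‖ < 1) {ω : ℂ} (hω : IsOfFinOrder ω)
    (h : ω ≠ 1) (n : ℕ) : NotPower ω (q ^ n) := by
  simpa using notPower_root_mul hq0 hq (e := 0) (n := n) hω (.inl h)

lemma appellAdmissible_iff {x q z : ℂ} :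
    AppellAdmissible x q z ↔ z ≠ 0 ∧ NotPower z q ∧ NotPower (x * z) q :=
  and_congr_right fun _ => forall_and

/-- The theta quotient in `q` and `z` that is `c (-1) ^ b q ^ (-b (b + 1) / 6)` times the difference
of the values of the Appell–Lerch sum in `part N w b q` at the auxiliary variables `w` and `z`. -/
noncomputable def changeQuotient (N : ℕ) (hN : 0 < N) (w : ℂ) (hw : IsOfFinOrder w) (c : ℂ)
    (b : ℤ) : ThetaQuotient :=
  have hn : 0 < 3 * N ^ 2 := by positivity
  have hs := isOfFinOrder_neg_one_pow (N + 1)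
  { coeff := -(c * (-1) ^ b * w)
    qExp := -(b * (b + 1) / 6)
    zExp := 0
    num := [eulerFactor (3 * N ^ 2) hn, eulerFactor (3 * N ^ 2) hn, eulerFactor (3 * N ^ 2) hn,
      ⟨w⁻¹, IsOfFinOrder.inv' hw, 0, 1, 3 * N ^ 2, hn⟩,
      ⟨(-1) ^ (N + 1) * w, hs.mul hw, N * (3 * N - 1 - 2 * b) / 2, 1, 3 * N ^ 2, hn⟩]
    den := [⟨w, hw, 0, 0, 3 * N ^ 2, hn⟩, ⟨1, IsOfFinOrder.one, 0, 1, 3 * N ^ 2, hn⟩,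
      ⟨(-1) ^ (N + 1) * w, hs.mul hw, N * (3 * N - 1 - 2 * b) / 2, 0, 3 * N ^ 2, hn⟩,
      ⟨(-1) ^ (N + 1), hs, N * (3 * N - 1 - 2 * b) / 2, 1, 3 * N ^ 2, hn⟩] }

lemma changeQuotient_weightHalf (hN : 0 < N) (hw : IsOfFinOrder w) (c : ℂ) (b : ℤ) :
    (changeQuotient N hN w hw c b).WeightHalf := by
  simp [changeQuotient, ThetaQuotient.WeightHalf]

lemma changeQuotient_multiplier (hN : 0 < N) (hw : IsOfFinOrder w) (c : ℂ) {b : ℤ}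
    (hb : b % 3 = 0 ∨ b % 3 = 2) (s : ℚ) :
    (changeQuotient N hN w hw c b).multiplier s = -1 / 24 := by
  have hN0 : (N : ℚ) ≠ 0 := by exact_mod_cast hN.ne'
  have q1 : ((b * (b + 1) / 6 : ℤ) : ℚ) = b * (b + 1) / 6 := by
    rw [eq_div_iff (by norm_num), mul_comm]; exact_mod_cast six_mul_leadExp hb
  have q2 : (((N : ℤ) * (3 * N - 1 - 2 * b) / 2 : ℤ) : ℚ) = N * (3 * N - 1 - 2 * b) / 2 := by
    rw [eq_div_iff (by norm_num), mul_comm]; exact_mod_cast two_dvd_partExp N b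
  simp only [changeQuotient, ThetaQuotient.multiplier, List.map_cons, List.map_nil, List.sum_cons,
    List.sum_nil, multiplier_eulerFactor]
  simp only [ThetaFactor.multiplier]
  push_cast [q1, q2]
  field_simp
  ring

lemma changeQuotient_spec (hw : w ^ (2 * N) = -1) (hN : 0 < N) (hwo : IsOfFinOrder w) (c : ℂ)
    (b : ℤ) {q z : ℂ} (hq0 : q ≠ 0) (hq : ‖q‖ < 1)
    (hz : AppellAdmissible (partArg N b q) (q ^ (3 * N ^ 2)) z) :
    (changeQuotient N hN w hwo c b).Defined q z ∧
      (changeQuotient N hN w hwo c b).eval q z = c * part N w b q -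
        c * (lead b q * appellM (partArg N b q) (q ^ (3 * N ^ 2)) z) := by
  obtain ⟨-, -, hw1, hws, -⟩ := root_conditions hw
  obtain ⟨hz0, hz1, hz2⟩ := appellAdmissible_iff.1 hz
  have hP : 3 * N ^ 2 ≠ 0 := by positivity
  have hQ := norm_pow_lt_one hq hP
  have hQ0 : q ^ (3 * N ^ 2) ≠ 0 := pow_ne_zero _ hq0
  have hw0 := IsOfFinOrder.ne_zero' hwo
  have n0 := notPower_root hq0 hq hwo hw1 (3 * N ^ 2)
  have n1 := notPower_partArg_mul hq0 hq hwo hws b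
  have e1 : (-1) ^ (N + 1) * w * q ^ ((N : ℤ) * (3 * N - 1 - 2 * b) / 2) = partArg N b q * w := by
    rw [partArg_eq]; ring
  have e2 : (-1) ^ (N + 1) * q ^ ((N : ℤ) * (3 * N - 1 - 2 * b) / 2) = partArg N b q :=
    (partArg_eq N b q).symm
  constructor
  · simp only [ThetaQuotient.Defined, changeQuotient, List.mem_cons, List.not_mem_nil, or_false,
      forall_eq_or_imp, forall_eq, ThetaFactor.eval, zpow_zero, zpow_one, mul_one, one_mul, e1, e2]
    exact ⟨thetaJ_ne_zero hQ n0, thetaJ_ne_zero hQ hz1, thetaJ_ne_zero hQ n1,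
      thetaJ_ne_zero hQ hz2⟩
  · have h := appellM_sub hQ0 hQ (partArg_ne_zero hq0 N b) hw0 hz0 n0 hz1 n1 hz2
    have h' : part N w b q = lead b q * appellM (partArg N b q) (q ^ (3 * N ^ 2)) w := rfl
    rw [h', ← mul_sub, ← mul_sub, ← neg_sub (appellM _ _ z), h]
    simp only [ThetaQuotient.eval, changeQuotient, List.map_cons, List.map_nil, List.prod_cons,
      List.prod_nil, eval_eulerFactor _ _ hq]
    simp only [ThetaFactor.eval, zpow_zero, zpow_one, mul_one, one_mul, e1, e2, lead]
    rw [inv_mul_eq_div]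
    simp only [div_eq_mul_inv, mul_inv]
    ring

lemma sum_map_sub {α : Type*} (f g : α → ℂ) (L : List α) :
    (L.map fun t => f t - g t).sum = (L.map f).sum - (L.map g).sum := by
  induction L with
  | nil => simp
  | cons t L ih => simp only [List.map_cons, List.sum_cons, ih]; ring

/-- Changing the auxiliary variable of all Appell–Lerch sums in a combination of parts that represents
a function up to theta functions. -/
lemma exists_thetaFunction {D : ℂ → ℂ} (hw : w ^ (2 * N) = -1) (L : List (ℂ × ℤ))
    (hL : ∀ t ∈ L, t.2 % 3 = 0 ∨ t.2 % 3 = 2)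
    (hD : IsTheta (-1 / 24) fun q => D q - (L.map fun t => t.1 * part N w t.2 q).sum) :
    ∃ T : ThetaFunction, T.Homogeneous ∧ ∀ q : ℂ, q ≠ 0 → ‖q‖ < 1 → ∀ z : ℂ,
      (∀ t ∈ L, AppellAdmissible (partArg N t.2 q) (q ^ (3 * N ^ 2)) z) →
      T.Defined q z ∧ D q = (L.map fun t =>
        t.1 * (lead t.2 q * appellM (partArg N t.2 q) (q ^ (3 * N ^ 2)) z)).sum + T.eval q z := by
  obtain ⟨hwo, -, -, -, hN⟩ := root_conditions hw
  obtain ⟨T, h1, -, h3⟩ := hD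
  refine ⟨T ++ L.map fun t => changeQuotient N hN w hwo t.1 t.2, ?_, fun q hq0 hq z hz => ⟨?_, ?_⟩⟩
  · intro t ht
    rcases List.mem_append.1 ht with h | h
    · exact h1 t h
    · obtain ⟨p, hp, rfl⟩ := List.mem_map.1 h
      exact ⟨changeQuotient_weightHalf hN hwo p.1 p.2,
        changeQuotient_multiplier hN hwo p.1 (hL p hp)⟩
  · intro t ht
    rcases List.mem_append.1 ht with h | h
    · exact (h3 q hq0 hq z).1 t h
    · obtain ⟨p, hp, rfl⟩ := List.mem_map.1 h
      exact (changeQuotient_spec hw hN hwo p.1 p.2 hq0 hq (hz p hp)).1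
  · have h4 : ThetaFunction.eval (L.map fun t => changeQuotient N hN w hwo t.1 t.2) q z =
        (L.map fun t => t.1 * part N w t.2 q -
          t.1 * (lead t.2 q * appellM (partArg N t.2 q) (q ^ (3 * N ^ 2)) z)).sum := by
      rw [ThetaFunction.eval, List.map_map]
      exact congrArg List.sum (List.map_congr_left fun p hp =>
        (changeQuotient_spec hw hN hwo p.1 p.2 hq0 hq (hz p hp)).2)
    rw [ThetaFunction.eval_append, (h3 q hq0 hq z).2, h4, sum_map_sub]
    ring

lemma exists_primitiveRoot_three_mul (hN : 0 < N) :
    ∃ ζ : ℂ, IsPrimitiveRoot ζ (3 * N) ∧ IsPrimitiveRoot (ζ ^ 3) N := by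
  have h := Complex.isPrimitiveRoot_exp (3 * N) (by omega)
  exact ⟨_, h, h.pow (by omega) rfl⟩

/-- The deviation for `M = 3 N`: only exponents divisible by three contribute. -/
lemma isTheta_deviation_of_dvd_of_ne_zero (hw : w ^ (2 * N) = -1) {a : ℕ} (ha : a % 3 = 0)
    (ha0 : a ≠ 0) (haM : a < 3 * N) :
    IsTheta (-1 / 24) fun q => deviation a (3 * N) q - (part N w a q + part N w (a - 1) q) := by
  have hN := (root_conditions hw).2.2.2.2
  obtain ⟨ζ, hζ, hη⟩ := exists_primitiveRoot_three_mul hN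
  have hw3 : w ^ (2 * (3 * N)) = -1 := by
    rw [show 2 * (3 * N) = 2 * N * 3 by ring, pow_mul, hw]; norm_num
  refine (((isTheta_deviation_sub_average hζ hw3 a).add
    (isTheta_average_sub_part hζ hη (.inr rfl) hw (k := -a) (b := a) (by omega) (by omega)
      (by omega) ⟨0, by simp⟩)).add
    (isTheta_inv_mul_average_sub_part hζ hη (.inr rfl) hw (k := 3 - a) (b := a - 1) (by omega)
      (by omega) (by omega) ⟨0, by simp⟩)).congr fun q hq0 hq => ?_
  rw [average_eq_zero hζ rfl hN (k := 1 - a) (by omega),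
    average_eq_zero hζ rfl hN (k := 2 - a) (by omega)]
  ring

lemma isTheta_deviation_zero_of_dvd (hw : w ^ (2 * N) = -1) :
    IsTheta (-1 / 24) fun q => deviation 0 (3 * N) q - 2 * part N w 0 q := by
  have hN := (root_conditions hw).2.2.2.2
  obtain ⟨ζ, hζ, hη⟩ := exists_primitiveRoot_three_mul hN
  have hw3 : w ^ (2 * (3 * N)) = -1 := by
    rw [show 2 * (3 * N) = 2 * N * 3 by ring, pow_mul, hw]; norm_num
  refine ((((isTheta_deviation_sub_average hζ hw3 0).add
    (isTheta_average_sub_part hζ hη (.inr rfl) hw (k := 0) (b := 0) (by omega) (by omega)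
      (by omega) ⟨0, by simp⟩)).add
    (isTheta_inv_mul_average_sub_part hζ hη (.inr rfl) hw (k := 3) (b := 3 * N - 1) (by omega)
      (by omega) (by omega) ⟨1, by push_cast; ring⟩)).sub
    (isTheta_part_symm hw (b := 0) (b' := 3 * N - 1) (by omega) (by omega))).congr
      fun q hq0 hq => ?_
  rw [average_eq_zero hζ rfl hN (k := 1 - (0 : ℕ)) (by omega),
    average_eq_zero hζ rfl hN (k := 2 - (0 : ℕ)) (by omega)]
  push_cast
  rw [neg_zero, sub_zero]
  ring

lemma isTheta_deviation_of_dvd_of_one (hw : w ^ (2 * N) = -1) {a : ℕ} (ha : a % 3 = 1)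
    (haM : a < 3 * N) :
    IsTheta (-1 / 24) fun q => deviation a (3 * N) q - -part N w (a - 1) q := by
  have hN := (root_conditions hw).2.2.2.2
  obtain ⟨ζ, hζ, hη⟩ := exists_primitiveRoot_three_mul hN
  have hw3 : w ^ (2 * (3 * N)) = -1 := by
    rw [show 2 * (3 * N) = 2 * N * 3 by ring, pow_mul, hw]; norm_num
  refine ((isTheta_deviation_sub_average hζ hw3 a).sub
    (isTheta_average_sub_part hζ hη (.inr rfl) hw (k := 1 - a) (b := a - 1) (by omega) (by omega)
      (by omega) ⟨0, by simp⟩)).congr fun q hq0 hq => ?_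
  rw [average_eq_zero hζ rfl hN (k := -a) (by omega),
    average_eq_zero hζ rfl hN (k := 2 - a) (by omega),
    average_eq_zero hζ rfl hN (k := 3 - a) (by omega)]
  ring

/-! ### Dependence on the auxiliary variable -/

lemma neg_one_pow_mul_sq_ne_one (hw : w ^ (2 * N) = -1) : (-1) ^ (N + 1) * w ^ 2 ≠ 1 := fun h => by
  have h1 := congrArg (· ^ N) h
  simp only [one_pow, mul_pow] at h1
  rw [← pow_mul, ← pow_mul, hw, Even.neg_one_pow (by rw [mul_comm]; exact Nat.even_mul_succ_self N)]
    at h1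
  norm_num at h1

/-- A single Appell–Lerch sum takes different values at `w` and `w ^ 2`. -/
lemma exists_appellM_ne (hw : w ^ (2 * N) = -1) (b : ℤ) {q : ℂ} (hq0 : q ≠ 0) (hq : ‖q‖ < 1) :
    AppellAdmissible (partArg N b q) (q ^ (3 * N ^ 2)) w ∧
    AppellAdmissible (partArg N b q) (q ^ (3 * N ^ 2)) (w ^ 2) ∧
      appellM (partArg N b q) (q ^ (3 * N ^ 2)) (w ^ 2) ≠
        appellM (partArg N b q) (q ^ (3 * N ^ 2)) w := by
  obtain ⟨hwo, -, hw1, hws, hN⟩ := root_conditions hw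
  have hP : 3 * N ^ 2 ≠ 0 := by positivity
  have hQ := norm_pow_lt_one hq hP
  have hQ0 : q ^ (3 * N ^ 2) ≠ 0 := pow_ne_zero _ hq0
  have hw0 := IsOfFinOrder.ne_zero' hwo
  have hw2 := hwo.pow (n := 2)
  have hsw2 := neg_one_pow_mul_sq_ne_one hw
  have hw21 : w ^ 2 ≠ 1 := fun h => by
    rw [pow_mul, h, one_pow] at hw; norm_num at hw
  have hsw3 : (-1) ^ (N + 1) * (w * w ^ 2) ≠ 1 := fun h => by
    have h1 := congrArg (· ^ (2 * N)) h
    simp only [one_pow, mul_pow] at h1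
    rw [pow_right_comm w 2 (2 * N), hw, ← pow_mul (-1) (N + 1), mul_left_comm (N + 1) 2 N,
      pow_mul (-1) 2] at h1
    norm_num at h1
  have n0 := notPower_root hq0 hq hwo hw1 (3 * N ^ 2)
  have n1 := notPower_root hq0 hq hw2 hw21 (3 * N ^ 2)
  have m0 := notPower_partArg_mul hq0 hq hwo hws b
  have m1 := notPower_partArg_mul hq0 hq hw2 hsw2 b
  have m2 := notPower_partArg_mul hq0 hq (hwo.mul hw2) hsw3 b
  refine ⟨appellAdmissible_iff.2 ⟨hw0, n0, m0⟩,
    appellAdmissible_iff.2 ⟨pow_ne_zero _ hw0, n1, m1⟩, sub_ne_zero.1 ?_⟩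
  rw [appellM_sub hQ0 hQ (partArg_ne_zero hq0 N b) hw0 (pow_ne_zero _ hw0) n0 n1 m0 m1,
    show w ^ 2 / w = w by field_simp, mul_assoc _ w (w ^ 2)]
  have j0 := thetaJ_ne_zero hQ n0
  have j1 := thetaJ_ne_zero hQ n1
  have j2 := thetaJ_ne_zero hQ m0
  have j3 := thetaJ_ne_zero hQ m1
  have j4 := thetaJ_ne_zero hQ m2
  have j5 := qPochInf_self_ne_zero hQ
  positivity

/-- For two Appell–Lerch sums with base variables `x₁` and `x₀ = q ^ N x₁`, the auxiliary variables
`w` and `1 / (x₀ w)` give the same value of the second but different values of the first. -/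
lemma exists_appellM_ne_eq (hw : w ^ (2 * N) = -1) (b : ℤ) {q : ℂ} (hq0 : q ≠ 0) (hq : ‖q‖ < 1) :
    ∃ z : ℂ, AppellAdmissible (partArg N b q) (q ^ (3 * N ^ 2)) z ∧
      AppellAdmissible (partArg N (b - 1) q) (q ^ (3 * N ^ 2)) z ∧
      appellM (partArg N b q) (q ^ (3 * N ^ 2)) z ≠ appellM (partArg N b q) (q ^ (3 * N ^ 2)) w ∧
      appellM (partArg N (b - 1) q) (q ^ (3 * N ^ 2)) z =
        appellM (partArg N (b - 1) q) (q ^ (3 * N ^ 2)) w := by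
  obtain ⟨hwo, -, hw1, hws, hN⟩ := root_conditions hw
  have hP : 3 * N ^ 2 ≠ 0 := by positivity
  have hQ := norm_pow_lt_one hq hP
  have hQ0 : q ^ (3 * N ^ 2) ≠ 0 := pow_ne_zero _ hq0
  have hw0 := IsOfFinOrder.ne_zero' hwo
  have hw2 := hwo.pow (n := 2)
  have hsw2 := neg_one_pow_mul_sq_ne_one hw
  have n0 := notPower_root hq0 hq hwo hw1 (3 * N ^ 2)
  have m0 := notPower_partArg_mul hq0 hq hwo hws b
  have m0' := notPower_partArg_mul hq0 hq hwo hws (b - 1)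
  have x0 := partArg_ne_zero hq0 N b
  have x0' := partArg_ne_zero hq0 N (b - 1)
  set z := (partArg N (b - 1) q * w)⁻¹ with hz
  have hz0 : z ≠ 0 := inv_ne_zero (mul_ne_zero x0' hw0)
  have hx : partArg N b q * (partArg N (b - 1) q)⁻¹ = q ^ (-(N : ℤ)) := by
    rw [partArg_sub_one hq0, zpow_neg, zpow_natCast]; field_simp
  have n1 : NotPower z (q ^ (3 * N ^ 2)) := notPower_inv_iff.2 m0'
  have m1' : NotPower (partArg N (b - 1) q * z) (q ^ (3 * N ^ 2)) := by
    rw [hz, show partArg N (b - 1) q * (partArg N (b - 1) q * w)⁻¹ = w⁻¹ by field_simp]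
    exact notPower_inv_iff.2 n0
  have m1 : NotPower (partArg N b q * z) (q ^ (3 * N ^ 2)) := by
    rw [hz, mul_inv, ← mul_assoc, hx, mul_comm]
    exact notPower_root_mul hq0 hq (IsOfFinOrder.inv' hwo) (.inl (inv_ne_one.2 hw1))
  have m2 : NotPower (partArg N b q * w * z) (q ^ (3 * N ^ 2)) := by
    rw [hz, show partArg N b q * w * (partArg N (b - 1) q * w)⁻¹ =
      1 * (partArg N b q * (partArg N (b - 1) q)⁻¹) by field_simp, hx]
    refine notPower_root_mul hq0 hq IsOfFinOrder.one (.inr fun h => ?_)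
    rw [dvd_neg, Int.natCast_dvd_natCast] at h
    have := Nat.le_of_dvd hN h
    nlinarith
  have m3 : NotPower (z / w) (q ^ (3 * N ^ 2)) := by
    rw [hz, show (partArg N (b - 1) q * w)⁻¹ / w = (partArg N (b - 1) q * w ^ 2)⁻¹ by field_simp]
    exact notPower_inv_iff.2 (notPower_partArg_mul hq0 hq hw2 hsw2 _)
  refine ⟨z, appellAdmissible_iff.2 ⟨hz0, n1, m1⟩, appellAdmissible_iff.2 ⟨hz0, n1, m1'⟩,
    sub_ne_zero.1 ?_, sub_eq_zero.1 ?_⟩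
  · rw [appellM_sub hQ0 hQ x0 hw0 hz0 n0 n1 m0 m1]
    have j0 := thetaJ_ne_zero hQ n0
    have j1 := thetaJ_ne_zero hQ n1
    have j2 := thetaJ_ne_zero hQ m0
    have j3 := thetaJ_ne_zero hQ m1
    have j4 := thetaJ_ne_zero hQ m2
    have j5 := thetaJ_ne_zero hQ m3
    have j6 := qPochInf_self_ne_zero hQ
    positivity
  · rw [appellM_sub hQ0 hQ x0' hw0 hz0 n0 n1 m0' m1', hz,
      mul_inv_cancel₀ (mul_ne_zero x0' hw0), thetaJ_one hQ]
    simp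

end dvd

/-! ### Symmetry of the residue classes and dependence of the theta part on `z` -/

section final

/-- Conjugate partitions have opposite ranks; here it follows from the symmetry of the rank
generating function. -/
lemma deviation_sub {a M : ℕ} (haM : a < M) {q : ℂ} (hq : ‖q‖ < 1) :
    deviation (M - a) M q = deviation a M q := by
  have hM : 0 < M := by omega
  have hζ := Complex.isPrimitiveRoot_exp M hM.ne'
  set ζ := Complex.exp (2 * Real.pi * Complex.I / M)
  have hζ0 : ζ ≠ 0 := hζ.ne_zero hM.ne'
  rw [deviation, deviation, (hasSum_deviationTerm hq hM (M - a) hζ.inv).tsum_eq,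
    (hasSum_deviationTerm hq hM a hζ).tsum_eq]
  congr 1
  refine Finset.sum_congr rfl fun j _ => ?_
  rw [inv_pow ζ j, rankSeries_inv]
  congr 1
  rw [inv_pow, inv_eq_iff_eq_inv]
  refine eq_inv_of_mul_eq_one_left ?_
  rw [← pow_add, ← mul_add, Nat.sub_add_cancel haM.le, mul_comm, pow_mul, hζ.pow_eq_one, one_pow]

lemma representative_spec {a M : ℕ} (haM : a < M) : representative a M < M ∧
    (M % 3 = 0 → representative a M % 3 ≠ 2) ∧ (M % 3 = 1 → representative a M % 3 ≠ 1) ∧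
    (M % 3 = 2 → representative a M % 3 ≠ 2) := by
  rw [representative]
  split_ifs <;> omega

lemma deviation_representative {a M : ℕ} (haM : a < M) {q : ℂ} (hq : ‖q‖ < 1) :
    deviation (representative a M) M q = deviation a M q := by
  rw [representative]
  split_ifs
  · exact deviation_sub haM hq
  · rfl

lemma arg_three_mul (N : ℕ) (b k : ℤ) (hk : k = 3 * N - 1 - 2 * b) (q : ℂ) :
    arg ((3 * N : ℕ) : ℤ) q (((3 * N : ℕ) : ℤ) * k / 6) = partArg N b q := by
  have e : ((3 * N : ℕ) : ℤ) * k / 6 = N * (3 * N - 1 - 2 * b) / 2 := by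
    rw [hk, Nat.cast_mul, Nat.cast_ofNat, mul_assoc, show (6 : ℤ) = 3 * 2 by norm_num,
      Int.mul_ediv_mul_of_pos _ _ (by norm_num)]
  rw [e, partArg, arg, arg, neg_one_zpow_eq (t := (N : ℤ) + 1) (by push_cast; omega)]

lemma zpow_three_mul_sq (N : ℕ) (q : ℂ) : q ^ (((3 * N : ℕ) : ℤ) ^ 2 / 3) = q ^ (3 * N ^ 2) := by
  rw [← zpow_natCast]
  congr 1
  rw [show ((3 * N : ℕ) : ℤ) ^ 2 = 3 * (3 * N ^ 2 : ℕ) by push_cast; ring]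
  exact Int.mul_ediv_cancel_left _ (by norm_num)

lemma exists_thetaFunction_of_dvd {N a : ℕ} (haM : a < 3 * N) (ha : a % 3 ≠ 2) :
    ∃ T : ThetaFunction, T.Homogeneous ∧ ∀ q : ℂ, q ≠ 0 → ‖q‖ < 1 →
      (∀ z, admissible0 a (3 * N : ℕ) q z → T.Defined q z ∧
        deviation a (3 * N) q = mock0 a (3 * N : ℕ) q z + T.eval q z) ∧
      ∃ z w, admissible0 a (3 * N : ℕ) q z ∧ admissible0 a (3 * N : ℕ) q w ∧
        mock0 a (3 * N : ℕ) q z ≠ mock0 a (3 * N : ℕ) q w := by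
  obtain ⟨w, hw⟩ := exists_pow_two_mul_eq_neg_one (M := N) (by omega)
  have hlead : ∀ (b : ℤ) {q : ℂ}, q ≠ 0 → lead b q ≠ 0 := fun b q hq0 =>
    mul_ne_zero (zpow_ne_zero _ (by norm_num)) (zpow_ne_zero _ hq0)
  have hQ := zpow_three_mul_sq N
  by_cases hz : a = 0
  · subst hz
    obtain ⟨T, hT, h⟩ := exists_thetaFunction (D := deviation 0 (3 * N)) hw [(2, 0)] (by simp)
      ((isTheta_deviation_zero_of_dvd hw).congr fun q _ _ => by simp)
    have hX := arg_three_mul N 0 ((3 * N : ℕ) - 1) (by push_cast; ring)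
    have hadm : ∀ q z, admissible0 (0 : ℕ) (3 * N : ℕ) q z ↔
        AppellAdmissible (partArg N 0 q) (q ^ (3 * N ^ 2)) z := fun q z => by
      rw [admissible0, if_pos (by simp), hX, hQ]
    have hmock : ∀ q z, mock0 (0 : ℕ) (3 * N : ℕ) q z =
        2 * appellM (partArg N 0 q) (q ^ (3 * N ^ 2)) z := fun q z => by
      rw [mock0, if_pos (by simp), hX, hQ]
    refine ⟨T, hT, fun q hq0 hq => ⟨fun z hz => ?_, ?_⟩⟩
    · have h1 := h q hq0 hq z (by simpa using (hadm q z).1 hz)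
      rw [hmock]
      simpa [lead] using h1
    · obtain ⟨h1, h2, h3⟩ := exists_appellM_ne hw 0 hq0 hq
      refine ⟨w ^ 2, w, (hadm _ _).2 h2, (hadm _ _).2 h1, ?_⟩
      rw [hmock, hmock]
      exact fun h => h3 (mul_left_cancel₀ two_ne_zero h)
  by_cases ha0 : a % 3 = 0
  · obtain ⟨T, hT, h⟩ := exists_thetaFunction (D := deviation a (3 * N)) hw
      [(1, (a : ℤ)), (1, (a : ℤ) - 1)]
      (by simp only [List.mem_cons, List.not_mem_nil, or_false, forall_eq_or_imp, forall_eq]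
          omega)
      ((isTheta_deviation_of_dvd_of_ne_zero hw ha0 hz haM).congr fun q _ _ => by simp)
    have hX := arg_three_mul N a ((3 * N : ℕ) - 2 * a - 1) (by push_cast; ring)
    have hX' := arg_three_mul N (a - 1) ((3 * N : ℕ) - 2 * a + 1) (by push_cast; ring)
    have hadm : ∀ q z, admissible0 a (3 * N : ℕ) q z ↔
        AppellAdmissible (partArg N a q) (q ^ (3 * N ^ 2)) z ∧
        AppellAdmissible (partArg N (a - 1) q) (q ^ (3 * N ^ 2)) z := fun q z => by
      rw [admissible0, if_neg (by omega), if_pos (by omega), hX, hX', hQ]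
    have hmock : ∀ q z, mock0 a (3 * N : ℕ) q z =
        lead a q * appellM (partArg N a q) (q ^ (3 * N ^ 2)) z +
        lead (a - 1) q * appellM (partArg N (a - 1) q) (q ^ (3 * N ^ 2)) z := fun q z => by
      rw [mock0, if_neg (by omega), if_pos (by omega), hX, hX', hQ, lead, lead,
        neg_one_zpow_eq (s := (a : ℤ) - 1) (t := a + 1) (by omega), sub_add_cancel,
        mul_comm ((a : ℤ) - 1)]
    refine ⟨T, hT, fun q hq0 hq => ⟨fun z hz => ?_, ?_⟩⟩
    · have h1 := h q hq0 hq z (by simpa using (hadm q z).1 hz)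
      rw [hmock]
      simpa using h1
    · obtain ⟨z, h1, h2, h3, h4⟩ := exists_appellM_ne_eq hw a hq0 hq
      refine ⟨z, w, (hadm _ _).2 ⟨h1, h2⟩, (hadm _ _).2 ⟨(exists_appellM_ne hw a hq0 hq).1,
        (exists_appellM_ne hw (a - 1) hq0 hq).1⟩, ?_⟩
      rw [hmock, hmock, h4]
      exact fun h => h3 (mul_left_cancel₀ (hlead a hq0) (add_right_cancel h))
  · obtain ⟨T, hT, h⟩ := exists_thetaFunction (D := deviation a (3 * N)) hw [(-1, (a : ℤ) - 1)]
      (by simp only [List.mem_cons, List.not_mem_nil, or_false, forall_eq]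
          omega)
      ((isTheta_deviation_of_dvd_of_one hw (a := a) (by omega) haM).congr fun q _ _ => by simp)
    have hX' := arg_three_mul N (a - 1) ((3 * N : ℕ) - 2 * a + 1) (by push_cast; ring)
    have hadm : ∀ q z, admissible0 a (3 * N : ℕ) q z ↔
        AppellAdmissible (partArg N (a - 1) q) (q ^ (3 * N ^ 2)) z := fun q z => by
      rw [admissible0, if_neg (by omega), if_neg (by omega), hX', hQ]
    have hmock : ∀ q z, mock0 a (3 * N : ℕ) q z =
        -(lead (a - 1) q * appellM (partArg N (a - 1) q) (q ^ (3 * N ^ 2)) z) := fun q z => by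
      rw [mock0, if_neg (by omega), if_neg (by omega), hX', hQ, lead,
        zpow_sub_one₀ (by norm_num), sub_add_cancel, mul_comm ((a : ℤ) - 1)]
      norm_num
    refine ⟨T, hT, fun q hq0 hq => ⟨fun z hz => ?_, ?_⟩⟩
    · have h1 := h q hq0 hq z (by simpa using (hadm q z).1 hz)
      rw [hmock]
      simpa using h1
    · obtain ⟨h1, h2, h3⟩ := exists_appellM_ne hw (a - 1) hq0 hq
      refine ⟨w ^ 2, w, (hadm _ _).2 h2, (hadm _ _).2 h1, ?_⟩
      rw [hmock, hmock]
      exact fun h => h3 (mul_left_cancel₀ (hlead _ hq0) (neg_injective h))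

end final

end DysonRank

theorem theorem3p1 (a M : ℕ) (haM : a < M) :
    ∃ T : DysonRank.ThetaFunction,
      T.Homogeneous ∧
      (¬ 3 ∣ M → T.ZFree) ∧
      ∀ q : ℂ, 0 < ‖q‖ → ‖q‖ < 1 →
        Summable (DysonRank.deviationTerm a M q) ∧
        (∀ z : ℂ, DysonRank.Admissible a M q z →
          T.Defined q z ∧
          DysonRank.deviation a M q = DysonRank.mockPart a M q z + T.eval q z) ∧
        (3 ∣ M → ∃ z w : ℂ, DysonRank.Admissible a M q z ∧ DysonRank.Admissible a M q w ∧
          T.eval q z ≠ T.eval q w) := by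
  open DysonRank in
  obtain ⟨hr, hr0, hr1, hr2⟩ := representative_spec haM
  have hM : 0 < M := by omega
  have hsum : ∀ q : ℂ, ‖q‖ < 1 → Summable (deviationTerm a M q) := fun q hq =>
    (hasSum_deviationTerm hq hM a (Complex.isPrimitiveRoot_exp M hM.ne')).summable
  by_cases h3 : 3 ∣ M
  · obtain ⟨N, rfl⟩ := h3
    have h30 : 3 * N % 3 = 0 := by omega
    obtain ⟨T, hT, h⟩ := exists_thetaFunction_of_dvd hr (hr0 h30)
    have hadm : ∀ {q z : ℂ}, Admissible a (3 * N) q z ↔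
        admissible0 (representative a (3 * N)) (3 * N : ℕ) q z := ⟨fun h => h h30, fun h _ => h⟩
    have heq : ∀ {q z : ℂ}, q ≠ 0 → ‖q‖ < 1 → Admissible a (3 * N) q z →
        T.Defined q z ∧ deviation a (3 * N) q = mockPart a (3 * N) q z + T.eval q z :=
      fun hq0 hq hz => by
        rw [← deviation_representative haM hq, mockPart, if_pos h30]
        exact (h _ hq0 hq).1 _ (hadm.1 hz)
    refine ⟨T, hT, fun h' => absurd (dvd_mul_right 3 N) h', fun q hq0 hq =>
      ⟨hsum q hq, fun z hz => heq (norm_pos_iff.1 hq0) hq hz, fun _ => ?_⟩⟩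
    obtain ⟨z, w, hz, hw, hne⟩ := (h q (norm_pos_iff.1 hq0) hq).2
    refine ⟨z, w, hadm.2 hz, hadm.2 hw, fun hT' => hne ?_⟩
    have h1 := (heq (norm_pos_iff.1 hq0) hq (hadm.2 hz)).2
    have h2 := (heq (norm_pos_iff.1 hq0) hq (hadm.2 hw)).2
    rw [mockPart, if_pos h30] at h1 h2
    rw [hT'] at h1
    exact add_right_cancel (h1.symm.trans h2)
  · have hmain : IsTheta (-1 / 24) fun q => deviation (representative a M) M q -
        mockPart a M q 0 := by
      rcases (by omega : M % 3 = 1 ∨ M % 3 = 2) with h | h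
      · refine (isTheta_mock1 hr h (hr1 h)).congr fun q _ _ => ?_
        rw [mockPart, if_neg (by omega), if_pos h]
      · refine (isTheta_mock2 hr h (hr2 h)).congr fun q _ _ => ?_
        rw [mockPart, if_neg (by omega), if_neg (by omega)]
    obtain ⟨T, hT, hTz, h⟩ := hmain
    refine ⟨T, hT, fun _ => hTz, fun q hq0 hq => ⟨hsum q hq, fun z _ => ?_,
      fun h' => absurd h' h3⟩⟩
    obtain ⟨h1, h2⟩ := h q (norm_pos_iff.1 hq0) hq z
    have hz : mockPart a M q z = mockPart a M q 0 := by
      simp only [mockPart, if_neg (show M % 3 ≠ 0 by omega)]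
    refine ⟨h1, ?_⟩
    simp only [h2]
    rw [hz, deviation_representative haM hq]
    ring
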